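/- Let $k$ be a field and let $A=\bigoplus_{i\in\mathbb Z}A_i$ be a finite-dimensional associative unital $\mathbb Z$-graded $k$-algebra with graded (unital) subalgebras $A^0,A^{\le 0},A^{\ge 0}\subset A$ such that (1) $A^{\le 0}$ and $A^{\ge 0}$ are concentrated in degrees $\le 0$ and $\ge 0$ respectively, and $A^0=A^{\le 0}\cap A^{\ge 0}$ is the degree-$0$ component of $A^{\ge 0}$ and of $A^{\le 0}$; (2) the multiplication maps $A^{\ge 0}\otimes_{A^0}A^{\le 0}\to A$ and $A^{\le 0}\otimes_{A^0}A^{\ge 0}\to A$ are isomorphisms; (3) $A^0$ is semisimple, and $A^{\ge 0}$ is self-injective (the free module $A^{\ge 0}$ is injective). Let $A\text{-mod}$ be the category of finite-dimensional $\mathbb Z$-graded left $A$-modules with degree-preserving $A$-linear maps, and $D=D^b(A\text{-mod})$. For a subalgebra $S\in\{A^{\ge0},A^{\le0}\}$, an $A$-module is called $S$-injective ($S$-projective) if its restriction to $S$ is injective (projective) in the category of finite-dimensional graded $S$-modules. A complex of modules is convex (resp. concave) if for every $n\in\mathbb Z$ the sum of all weight spaces of degree $>n$ (resp. $<n$) of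 all its terms is finite-dimensional. Let $D_{\infty/2}\subset D$ be the smallest strictly full triangulated subcategory that contains the $A^{\ge 0}$-injective modules (placed in degree $0$). For $X,Y\in D$ let $\mathrm{Hom}_{D_{D_{\infty/2}}}(X,Y)$ be the set of connected components of the category of diagrams $X\to Z\to Y$ in $D$ with $Z\in D_{\infty/2}$ (morphisms being morphisms $Z\to Z'$ compatible with the arrows); it is an abelian group under $(X\xrightarrow{f}Z\xrightarrow{g}Y)+(X\xrightarrow{f'}Z'\xrightarrow{g'}Y)=(X\xrightarrow{f\times f'}Z\oplus Z'\xrightarrow{g\oplus g'}Y)$. Then: (a) an $A$-module is $A^{\ge0}$-injective if and only if it is $A^{\ge0}$-projective; (b) every $X\in D$ is isomorphic in $D$ to a bounded below convex complex $J_\searrow^X$ of $A^{\ge 0}$-injective $A$-modules, and every $Y\in D$ is isomorphic in $D$ to a bounded below concave complex $J_\nearrow^Y$ of $A^{\le 0}$-injective $A$-modules; (c) for all $X,Y\in D$, all choices of such complexes (with their identifications with $X$ and $Y$) and all $i\in\mathbb Z$ there is an isomorphism of abelian groups $$\mathrm{Hom}_{D_{D_{\infty/2}}}(X,Y[i])\;\cong\;\mathrm{Ext}^{\infty/2+i}(X,Y):=H^i\bigl(\mathrm{Hom}^\bullet(J_\searrow^X,J_\nearrow^Y)\bigr).$$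 In particular, the right-hand side does not depend on the choices. These isomorphisms are natural in $X$ and $Y$: they are compatible with chain maps $J_\searrow^{X'}\to J_\searrow^{X}$ and $J_\nearrow^{Y}\to J_\nearrow^{Y'}$ that represent given morphisms $X'\to X$ and $Y\to Y'$ of $D$. Moreover, if a diagram $X\to Z\to Y[i]$ with $Z\in D_{\infty/2}$ is represented by chain maps $J_\searrow^X\xrightarrow{p}K\xrightarrow{q}J_\nearrow^Y[i]$, where $K$ is a bounded complex isomorphic to $Z$ in $D$, then the isomorphism sends the class of this diagram to the class of $q\circ p$. -/

import Mathlib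

open CategoryTheory CategoryTheory.Limits

universe w u

set_option linter.unusedSectionVars false

namespace SemiInf

/-! ## Finite dimensional graded modules -/

section Graded

/-- A criterion for an internal direct sum decomposition, through a family of projections. -/
lemma isInternal_of_proj {k : Type*} [Field k] {N : Type*} [AddCommGroup N] [Module k N]
    (deg : ℤ → Submodule k N) (p : ℤ → N →ₗ[k] N)
    (h1 : ∀ i x, p i x ∈ deg i) (h2 : ∀ i, ∀ x ∈ deg i, p i x = x)
    (h3 : ∀ i j, i ≠ j → ∀ x ∈ deg j, p i x = 0)
    (h4 : ∀ x, ∃ s : Finset ℤ, ∑ i ∈ s, p i x = x) : DirectSum.IsInternal deg := by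
  have key : ∀ (y : DirectSum ℤ fun i => deg i) (i : ℤ),
      p i (DirectSum.coeAddMonoidHom deg y) = y i := by
    intro y i
    induction y using DirectSum.induction_on with
    | zero => simp
    | of j x =>
      rw [DirectSum.coeAddMonoidHom_of]
      by_cases hij : i = j
      · subst hij
        rw [h2 i _ x.2, DirectSum.of_eq_same]
      · rw [h3 i j hij _ x.2, DirectSum.of_eq_of_ne _ _ _ hij]
        rfl
    | add a b ha hb => simp [ha, hb]
  constructor
  · rw [injective_iff_map_eq_zero]
    intro y hy
    ext i
    rw [← key y i, hy]
    simp
  · intro x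
    obtain ⟨s, hs⟩ := h4 x
    refine ⟨∑ i ∈ s, DirectSum.of (fun i => deg i) i ⟨p i x, h1 i x⟩, ?_⟩
    rw [map_sum]
    simp only [DirectSum.coeAddMonoidHom_of]
    exact hs

variable {k A : Type u} [Field k] [Ring A] [Algebra k A]

/-- A finite dimensional `ℤ`-graded (left) module over the `k`-algebra `A`, whose grading is
given by the subspaces `𝒜 i`. -/
structure GrMod (𝒜 : ℤ → Submodule k A) : Type (u + 1) where
  /-- the underlying module -/
  carrier : Type u
  [addCommGroup : AddCommGroup carrier]
  [moduleBase : Module k carrier]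
  [module : Module A carrier]
  [isScalarTower : IsScalarTower k A carrier]
  [finite : Module.Finite k carrier]
  /-- the graded components (weight spaces) -/
  deg : ℤ → Submodule k carrier
  isInternal : DirectSum.IsInternal deg
  smul_mem : ∀ (i j : ℤ) (a : A) (m : carrier), a ∈ 𝒜 i → m ∈ deg j → a • m ∈ deg (i + j)

namespace GrMod

attribute [instance] addCommGroup moduleBase module isScalarTower finite

variable {𝒜 : ℤ → Submodule k A}

instance : CoeSort (GrMod 𝒜) (Type u) := ⟨carrier⟩

/-- Morphisms of graded modules: `A`-linear maps that preserve the degrees. -/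
@[ext]
structure Hom (M N : GrMod 𝒜) : Type u where
  /-- the underlying linear map -/
  lin : M →ₗ[A] N
  map_deg : ∀ (i : ℤ) (x : M), x ∈ M.deg i → lin x ∈ N.deg i

instance : Category (GrMod 𝒜) where
  Hom M N := Hom M N
  id M := ⟨LinearMap.id, fun _ _ h => h⟩
  comp f g := ⟨g.lin.comp f.lin, fun i x h => g.map_deg i _ (f.map_deg i x h)⟩

@[ext]
lemma hom_ext {M N : GrMod 𝒜} {f g : M ⟶ N} (h : ∀ x, f.lin x = g.lin x) : f = g :=
  Hom.ext (LinearMap.ext h)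

@[simp] lemma id_lin (M : GrMod 𝒜) (x : M) : Hom.lin (𝟙 M) x = x := rfl

@[simp] lemma comp_lin {M N P : GrMod 𝒜} (f : M ⟶ N) (g : N ⟶ P) (x : M) :
    (f ≫ g).lin x = g.lin (f.lin x) := rfl

section preadditive

variable {M N : GrMod 𝒜}

instance : Add (M ⟶ N) :=
  ⟨fun f g => ⟨f.lin + g.lin, fun i x h => add_mem (f.map_deg i x h) (g.map_deg i x h)⟩⟩

instance : Zero (M ⟶ N) := ⟨⟨0, fun _ _ _ => zero_mem _⟩⟩

instance : Neg (M ⟶ N) := ⟨fun f => ⟨-f.lin, fun i x h => neg_mem (f.map_deg i x h)⟩⟩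

@[simp] lemma add_lin (f g : M ⟶ N) (x : M) : (f + g).lin x = f.lin x + g.lin x := rfl

@[simp] lemma zero_lin (x : M) : (0 : M ⟶ N).lin x = 0 := rfl

@[simp] lemma neg_lin (f : M ⟶ N) (x : M) : (-f).lin x = -f.lin x := rfl

instance : AddCommGroup (M ⟶ N) where
  add_assoc f g h := by ext x; simp [add_assoc]
  zero_add f := by ext x; simp
  add_zero f := by ext x; simp
  add_comm f g := by ext x; simp [add_comm]
  neg_add_cancel f := by ext x; simp
  nsmul := nsmulRec
  zsmul := zsmulRec

end preadditive

instance : Preadditive (GrMod 𝒜) where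
  add_comp _ _ _ f f' g := by ext x; simp
  comp_add _ _ _ f g g' := by ext x; simp

lemma bijective_coe (M : GrMod 𝒜) : Function.Bijective (DirectSum.coeLinearMap M.deg) :=
  M.isInternal

/-- The projection of a graded module to its component of degree `i`. -/
noncomputable def proj (M : GrMod 𝒜) (i : ℤ) : M →ₗ[k] M :=
  (M.deg i).subtype ∘ₗ DirectSum.component k ℤ (fun i => M.deg i) i ∘ₗ
    (LinearEquiv.ofBijective (DirectSum.coeLinearMap M.deg) M.bijective_coe).symm.toLinearMap

section proj

variable (M : GrMod 𝒜)

lemma proj_mem (i : ℤ) (x : M) : M.proj i x ∈ M.deg i := Subtype.property _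

lemma symm_of_mem {j : ℤ} {x : M} (hx : x ∈ M.deg j) :
    (LinearEquiv.ofBijective (DirectSum.coeLinearMap M.deg) M.bijective_coe).symm x =
      DirectSum.lof k ℤ (fun i => M.deg i) j ⟨x, hx⟩ := by
  rw [LinearEquiv.symm_apply_eq, LinearEquiv.ofBijective_apply, DirectSum.coeLinearMap_lof]

lemma proj_of_mem {i : ℤ} {x : M} (hx : x ∈ M.deg i) : M.proj i x = x := by
  simp only [proj, LinearMap.comp_apply, LinearEquiv.coe_coe, M.symm_of_mem hx,
    DirectSum.component.lof_self]
  rfl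

lemma proj_of_mem_ne {i j : ℤ} (hij : i ≠ j) {x : M} (hx : x ∈ M.deg j) : M.proj i x = 0 := by
  simp only [proj, LinearMap.comp_apply, LinearEquiv.coe_coe, M.symm_of_mem hx,
    DirectSum.component.of, dif_neg (Ne.symm hij)]
  rfl

lemma exists_sum_proj (x : M) : ∃ s : Finset ℤ, ∑ i ∈ s, M.proj i x = x := by
  classical
  set y := (LinearEquiv.ofBijective (DirectSum.coeLinearMap M.deg) M.bijective_coe).symm x with hy
  refine ⟨DFinsupp.support y, ?_⟩
  have hx : DirectSum.coeLinearMap M.deg y = x :=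
    (LinearEquiv.ofBijective (DirectSum.coeLinearMap M.deg) M.bijective_coe).apply_symm_apply x
  conv_rhs => rw [← hx]
  exact (DirectSum.coeAddMonoidHom_eq_dfinsuppSum (A := M.deg) y).symm

lemma mem_deg_iff (i : ℤ) (x : M) : x ∈ M.deg i ↔ M.proj i x = x :=
  ⟨M.proj_of_mem, fun h => h ▸ M.proj_mem i x⟩

end proj

lemma lin_smul_base {M N : GrMod 𝒜} (f : M ⟶ N) (c : k) (x : M) :
    f.lin (c • x) = c • f.lin x := by
  rw [← algebraMap_smul A c x, map_smul, algebraMap_smul]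

lemma map_proj {M N : GrMod 𝒜} (f : M ⟶ N) (i : ℤ) (x : M) :
    f.lin (M.proj i x) = N.proj i (f.lin x) := by
  classical
  obtain ⟨s, hs⟩ := M.exists_sum_proj x
  conv_rhs => rw [← hs, map_sum, map_sum]
  have h : ∀ j, N.proj i (f.lin (M.proj j x)) = if j = i then f.lin (M.proj i x) else 0 := by
    intro j
    split_ifs with hj
    · subst hj
      exact N.proj_of_mem (f.map_deg _ _ (M.proj_mem _ _))
    · exact N.proj_of_mem_ne (Ne.symm hj) (f.map_deg _ _ (M.proj_mem _ _))
  rw [Finset.sum_congr rfl fun j _ => h j, Finset.sum_ite_eq']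
  split_ifs with hi
  · rfl
  · have : M.proj i x = 0 := by
      conv_lhs => rw [← hs, map_sum]
      refine Finset.sum_eq_zero fun j hj => ?_
      exact M.proj_of_mem_ne (by rintro rfl; exact hi hj) (M.proj_mem _ _)
    rw [this, map_zero]

/-! ### Kernels, cokernels and products -/

section kernel

variable {M N : GrMod 𝒜} (f : M ⟶ N)

/-- The kernel of a morphism, with the induced grading. -/
noncomputable def ker : GrMod 𝒜 where
  carrier := LinearMap.ker f.lin
  finite := Module.Finite.of_injective ((LinearMap.ker f.lin).subtype.restrictScalars k)
    Subtype.val_injective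
  deg i := (M.deg i).comap ((LinearMap.ker f.lin).subtype.restrictScalars k)
  isInternal := by
    refine isInternal_of_proj _ (fun i =>
      { toFun := fun x => ⟨M.proj i x.1, ?_⟩
        map_add' := fun x y => Subtype.ext (map_add (M.proj i) x.1 y.1)
        map_smul' := fun c x => Subtype.ext (map_smul (M.proj i) c x.1) }) ?_ ?_ ?_ ?_
    · have hx' : f.lin x.1 = 0 := x.2
      rw [LinearMap.mem_ker, map_proj, hx', map_zero]
    · intro i x
      exact M.proj_mem i x.1
    · intro i x hx
      exact Subtype.ext (M.proj_of_mem hx)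
    · intro i j hij x hx
      exact Subtype.ext (M.proj_of_mem_ne hij hx)
    · intro x
      obtain ⟨s, hs⟩ := M.exists_sum_proj x.1
      refine ⟨s, Subtype.ext ?_⟩
      rw [← hs, AddSubmonoidClass.coe_finsetSum]
      rfl
  smul_mem i j a m ha hm := M.smul_mem i j a m.1 ha hm

/-- The inclusion of the kernel. -/
noncomputable def kerι : ker f ⟶ M := ⟨(LinearMap.ker f.lin).subtype, fun _ _ h => h⟩

lemma kerι_lin (x : ker f) : (kerι f).lin x = x.1 := rfl

lemma kerι_comp : kerι f ≫ f = 0 := by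
  ext x
  exact x.2

/-- `kerι f` is a kernel of `f`. -/
noncomputable def kerIsLimit : IsLimit (KernelFork.ofι (kerι f) (kerι_comp f)) :=
  KernelFork.IsLimit.ofι _ _
    (fun {W} g hg => ⟨g.lin.codRestrict _ fun x => congrArg (fun h : W ⟶ N => h.lin x) hg,
      fun i x hx => g.map_deg i x hx⟩)
    (fun _ _ => rfl)
    (fun {W} g hg m hm => by
      ext x
      exact Subtype.ext (congrArg (fun h : W ⟶ M => h.lin x) hm))

instance : HasKernels (GrMod 𝒜) := ⟨fun f => ⟨⟨_, kerIsLimit f⟩⟩⟩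

/-- The range of a morphism, as a subspace. -/
def rng : Submodule k N := (LinearMap.range f.lin).restrictScalars k

lemma proj_rng (i : ℤ) : rng f ≤ (rng f).comap (N.proj i) := by
  rintro _ ⟨x, rfl⟩
  exact ⟨M.proj i x, map_proj f i x⟩

/-- The map that the projection to a graded component induces on the cokernel. -/
noncomputable def projCoker (i : ℤ) :
    (N ⧸ LinearMap.range f.lin) →ₗ[k] (N ⧸ LinearMap.range f.lin) :=
  (Submodule.Quotient.restrictScalarsEquiv k (LinearMap.range f.lin)).toLinearMap ∘ₗ
    (rng f).mapQ (rng f) (N.proj i) (proj_rng f i) ∘ₗ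
    (Submodule.Quotient.restrictScalarsEquiv k (LinearMap.range f.lin)).symm.toLinearMap

/-- The cokernel of a morphism, with the induced grading. -/
noncomputable def coker : GrMod 𝒜 where
  carrier := N ⧸ LinearMap.range f.lin
  finite := Module.Finite.of_surjective ((LinearMap.range f.lin).mkQ.restrictScalars k)
    (LinearMap.range f.lin).mkQ_surjective
  deg i := (N.deg i).map ((LinearMap.range f.lin).mkQ.restrictScalars k)
  isInternal := by
    have hp : ∀ (i : ℤ) (y : N), (projCoker f i) ((LinearMap.range f.lin).mkQ y) =
      (LinearMap.range f.lin).mkQ (N.proj i y) := fun _ _ => rfl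
    refine isInternal_of_proj _ (projCoker f) ?_ ?_ ?_ ?_
    · intro i x
      obtain ⟨y, rfl⟩ := (LinearMap.range f.lin).mkQ_surjective x
      exact ⟨N.proj i y, N.proj_mem i y, rfl⟩
    · rintro i _ ⟨y, hy, rfl⟩
      exact (hp i y).trans (by rw [N.proj_of_mem hy]; rfl)
    · rintro i j hij _ ⟨y, hy, rfl⟩
      exact (hp i y).trans (by rw [N.proj_of_mem_ne hij hy, map_zero])
    · intro x
      obtain ⟨y, rfl⟩ := (LinearMap.range f.lin).mkQ_surjective x
      obtain ⟨s, hs⟩ := N.exists_sum_proj y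
      refine ⟨s, ?_⟩
      conv_rhs => rw [← hs, map_sum]
      exact Finset.sum_congr rfl fun i _ => hp i y
  smul_mem i j a m ha hm := by
    obtain ⟨y, hy, rfl⟩ := hm
    exact ⟨a • y, N.smul_mem i j a y ha hy, rfl⟩

/-- The projection to the cokernel. -/
noncomputable def cokerπ : N ⟶ coker f :=
  ⟨(LinearMap.range f.lin).mkQ, fun _ x h => ⟨x, h, rfl⟩⟩

lemma comp_cokerπ : f ≫ cokerπ f = 0 := by
  ext x
  exact (Submodule.Quotient.mk_eq_zero _).2 ⟨x, rfl⟩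

/-- `cokerπ f` is a cokernel of `f`. -/
noncomputable def cokerIsColimit : IsColimit (CokernelCofork.ofπ (cokerπ f) (comp_cokerπ f)) :=
  CokernelCofork.IsColimit.ofπ _ _
    (fun {W} g hg => ⟨(LinearMap.range f.lin).liftQ g.lin (by
        rintro _ ⟨x, rfl⟩
        exact congrArg (fun h : M ⟶ W => h.lin x) hg),
      fun i x hx => by
        obtain ⟨y, hy, rfl⟩ := hx
        exact g.map_deg i y hy⟩)
    (fun _ _ => rfl)
    (fun {W} g hg m hm => by
      ext x
      obtain ⟨y, rfl⟩ := (LinearMap.range f.lin).mkQ_surjective x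
      exact congrArg (fun h : N ⟶ W => h.lin y) hm)

instance : HasCokernels (GrMod 𝒜) := ⟨fun f => ⟨⟨_, cokerIsColimit f⟩⟩⟩

end kernel

section product

/-- The direct sum of two graded modules. -/
noncomputable def prod (M N : GrMod 𝒜) : GrMod 𝒜 where
  carrier := M × N
  deg i := (M.deg i).prod (N.deg i)
  isInternal := by
    classical
    refine isInternal_of_proj _ (fun i => (M.proj i).prodMap (N.proj i)) ?_ ?_ ?_ ?_
    · intro i x
      exact ⟨M.proj_mem i x.1, N.proj_mem i x.2⟩
    · intro i x hx
      exact Prod.ext (M.proj_of_mem hx.1) (N.proj_of_mem hx.2)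
    · intro i j hij x hx
      exact Prod.ext (M.proj_of_mem_ne hij hx.1) (N.proj_of_mem_ne hij hx.2)
    · have aux : ∀ (L : GrMod 𝒜) (x : L), ∃ s : Finset ℤ, ∀ t, s ⊆ t →
          ∑ i ∈ t, L.proj i x = x := by
        intro L x
        obtain ⟨s, hs⟩ := L.exists_sum_proj x
        refine ⟨s, fun t hst => ?_⟩
        rw [← Finset.sum_subset hst, hs]
        intro i _ hi
        conv_lhs => rw [← hs, map_sum]
        exact Finset.sum_eq_zero fun j hj =>
          L.proj_of_mem_ne (by rintro rfl; exact hi hj) (L.proj_mem _ _)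
      intro x
      obtain ⟨s, hs⟩ := aux M x.1
      obtain ⟨t, ht⟩ := aux N x.2
      refine ⟨s ∪ t, ?_⟩
      apply Prod.ext
      · rw [Prod.fst_sum]
        exact hs _ Finset.subset_union_left
      · rw [Prod.snd_sum]
        exact ht _ Finset.subset_union_right
  smul_mem i j a m ha hm := ⟨M.smul_mem i j a _ ha hm.1, N.smul_mem i j a _ ha hm.2⟩

/-- The direct sum is a product. -/
noncomputable def prodIsLimit (M N : GrMod 𝒜) : IsLimit (BinaryFan.mk (P := prod M N)
    (⟨LinearMap.fst A M N, fun _ _ h => h.1⟩ : Hom (prod M N) M)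
    (⟨LinearMap.snd A M N, fun _ _ h => h.2⟩ : Hom (prod M N) N)) :=
  BinaryFan.IsLimit.mk _
    (fun {W} f g => (⟨f.lin.prod g.lin, fun i x h => ⟨f.map_deg i x h, g.map_deg i x h⟩⟩ :
      Hom W (prod M N)))
    (fun _ _ => rfl) (fun _ _ => rfl)
    (fun {W} f g m h1 h2 => by
      apply hom_ext
      intro x
      exact Prod.ext (congrArg (fun h : W ⟶ M => h.lin x) h1)
        (congrArg (fun h : W ⟶ N => h.lin x) h2))

instance : HasBinaryProducts (GrMod 𝒜) :=
  have : ∀ {M N : GrMod 𝒜}, HasLimit (pair M N) := fun {M N} => ⟨⟨_, prodIsLimit M N⟩⟩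
  hasBinaryProducts_of_hasLimit_pair _

/-- The zero module. -/
def zeroModule (𝒜 : ℤ → Submodule k A) : GrMod 𝒜 where
  carrier := PUnit
  deg _ := ⊤
  isInternal := isInternal_of_proj _ (fun _ => 0) (fun _ _ => trivial) (fun _ _ _ => rfl)
    (fun _ _ _ _ _ => rfl) (fun _ => ⟨∅, rfl⟩)
  smul_mem _ _ _ _ _ _ := trivial

lemma isZero_zeroModule : IsZero (zeroModule 𝒜) := by
  rw [IsZero.iff_id_eq_zero]
  ext x
  rfl

instance : HasZeroObject (GrMod 𝒜) := ⟨⟨_, isZero_zeroModule⟩⟩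

instance : HasFiniteProducts (GrMod 𝒜) :=
  have : HasTerminal (GrMod 𝒜) := HasZeroObject.hasTerminal
  hasFiniteProducts_of_has_binary_and_terminal

end product

section abelian

variable {M N : GrMod 𝒜} (f : M ⟶ N)

lemma injective_of_mono [Mono f] : Function.Injective f.lin := by
  rw [injective_iff_map_eq_zero]
  intro x hx
  have h : kerι f = 0 := by
    rw [← cancel_mono f, kerι_comp, zero_comp]
  exact congrArg (fun g : ker f ⟶ M => g.lin ⟨x, hx⟩) h

lemma surjective_of_epi [Epi f] : Function.Surjective f.lin := by
  intro y
  have h : cokerπ f = 0 := by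
    rw [← cancel_epi f, comp_cokerπ, comp_zero]
  exact (Submodule.Quotient.mk_eq_zero _).1 (congrArg (fun g : N ⟶ coker f => g.lin y) h)

/-- Every monomorphism is the kernel of its cokernel. -/
@[reducible]
noncomputable def normalMono [Mono f] : NormalMono f where
  Z := coker f
  g := cokerπ f
  w := comp_cokerπ f
  isLimit := by
    have hf := injective_of_mono f
    have key : ∀ {W : GrMod 𝒜} (g : W ⟶ N), g ≫ cokerπ f = 0 →
        ∀ x, g.lin x ∈ LinearMap.range f.lin := fun {W} g hg x =>
      (Submodule.Quotient.mk_eq_zero _).1 (congrArg (fun h : W ⟶ coker f => h.lin x) hg)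
    have spec : ∀ (y : LinearMap.range f.lin),
        f.lin ((LinearEquiv.ofInjective f.lin hf).symm y) = y := fun y =>
      congrArg Subtype.val ((LinearEquiv.ofInjective f.lin hf).apply_symm_apply y)
    refine KernelFork.IsLimit.ofι _ _
      (fun {W} g hg => ⟨(LinearEquiv.ofInjective f.lin hf).symm.toLinearMap ∘ₗ
        g.lin.codRestrict _ (key g hg), fun i x hx => ?_⟩) ?_ ?_
    · rw [mem_deg_iff]
      apply hf
      rw [map_proj]
      simp only [LinearMap.comp_apply, LinearEquiv.coe_coe, spec]
      exact N.proj_of_mem (g.map_deg i x hx)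
    · intro W g hg
      ext x
      exact spec _
    · intro W g hg m hm
      rw [← cancel_mono f, hm]
      ext x
      exact (spec ⟨g.lin x, key g hg x⟩).symm

/-- Every epimorphism is the cokernel of its kernel. -/
@[reducible]
noncomputable def normalEpi [Epi f] : NormalEpi f where
  W := ker f
  g := kerι f
  w := kerι_comp f
  isColimit := by
    have hf := surjective_of_epi f
    have spec : ∀ (x : M), (f.lin.quotKerEquivOfSurjective hf).symm (f.lin x) =
        (LinearMap.ker f.lin).mkQ x := fun x => by
      rw [LinearEquiv.symm_apply_eq]
      rfl
    have key : ∀ {W : GrMod 𝒜} (g : M ⟶ W), kerι f ≫ g = 0 →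
        LinearMap.ker f.lin ≤ LinearMap.ker g.lin := fun {W} g hg x hx =>
      congrArg (fun h : ker f ⟶ W => h.lin ⟨x, hx⟩) hg
    have lift : ∀ {W : GrMod 𝒜} (g : M ⟶ W) (hg : kerι f ≫ g = 0) (x : M),
        ((LinearMap.ker f.lin).liftQ g.lin (key g hg) ∘ₗ
        (f.lin.quotKerEquivOfSurjective hf).symm.toLinearMap) (f.lin x) = g.lin x := by
      intro W g hg x
      simp only [LinearMap.comp_apply, LinearEquiv.coe_coe, spec]
      rfl
    refine CokernelCofork.IsColimit.ofπ _ _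
      (fun {W} g hg => ⟨(LinearMap.ker f.lin).liftQ g.lin (key g hg) ∘ₗ
        (f.lin.quotKerEquivOfSurjective hf).symm.toLinearMap, fun i y hy => ?_⟩) ?_ ?_
    · obtain ⟨x, rfl⟩ := hf y
      rw [← N.proj_of_mem hy, ← map_proj, lift g hg]
      exact g.map_deg i _ (M.proj_mem i x)
    · intro W g hg
      ext x
      exact lift g hg x
    · intro W g hg m hm
      rw [← cancel_epi f, hm]
      ext x
      exact (lift g hg x).symm

noncomputable instance : Abelian (GrMod 𝒜) where
  normalMonoOfMono f _ := ⟨normalMono f⟩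
  normalEpiOfEpi f _ := ⟨normalEpi f⟩

end abelian

/-! ### Restriction to a subalgebra -/

/-- The grading that a subalgebra `S` of the graded algebra `A` inherits:
`S_i` is the intersection of `S` and `A_i`. -/
def subGrading (𝒜 : ℤ → Submodule k A) (S : Subalgebra k A) (i : ℤ) : Submodule k S :=
  (𝒜 i).comap S.val.toLinearMap

/-- The restriction of a graded `A`-module to a subalgebra. -/
def res (S : Subalgebra k A) (M : GrMod 𝒜) : GrMod (subGrading 𝒜 S) where
  carrier := M
  deg := M.deg
  isInternal := M.isInternal
  smul_mem i j a m ha hm := M.smul_mem i j a m ha hm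

/-- A graded `A`-module is `S`-injective if its restriction to `S` is an injective object of the
category of finite dimensional graded `S`-modules. -/
def IsInjectiveOver (S : Subalgebra k A) (M : GrMod 𝒜) : Prop := Injective (M.res S)

end GrMod

end Graded

/-! ## Triangular decompositions -/

section Triangular

open TensorProduct

variable {k A : Type u} [Field k] [Ring A] [Algebra k A]

/-- The relations `(p * a) ⊗ q = p ⊗ (a * q)`, `a ∈ R`, which define the tensor product of `P` and
`Q` over their common subalgebra `R`. -/
def balancedRel (R P Q : Subalgebra k A) (hP : R ≤ P) (hQ : R ≤ Q) : Submodule k (P ⊗[k] Q) :=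
  Submodule.span k {t | ∃ (p : P) (a : R) (q : Q),
    t = (p * Subalgebra.inclusion hP a) ⊗ₜ[k] q - p ⊗ₜ[k] (Subalgebra.inclusion hQ a * q)}

/-- The tensor product `P ⊗_R Q` of two subalgebras over a common (not necessarily commutative)
subalgebra. -/
abbrev BalancedTensor (R P Q : Subalgebra k A) (hP : R ≤ P) (hQ : R ≤ Q) : Type u :=
  (P ⊗[k] Q) ⧸ balancedRel R P Q hP hQ

/-- The map `P ⊗_R Q → A`, `p ⊗ q ↦ p * q`. -/
def balancedMul (R P Q : Subalgebra k A) (hP : R ≤ P) (hQ : R ≤ Q) :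
    BalancedTensor R P Q hP hQ →ₗ[k] A :=
  (balancedRel R P Q hP hQ).liftQ
    (TensorProduct.lift ((LinearMap.mul k A).compl₁₂ P.val.toLinearMap Q.val.toLinearMap)) (by
      rw [balancedRel, Submodule.span_le]
      rintro _ ⟨p, a, q, rfl⟩
      simp [mul_assoc])

lemma balancedMul_tmul (R P Q : Subalgebra k A) (hP : R ≤ P) (hQ : R ≤ Q) (p : P) (q : Q) :
    balancedMul R P Q hP hQ (Submodule.Quotient.mk (p ⊗ₜ[k] q)) = (p : A) * (q : A) := rfl

/-- The standing assumptions on the finite dimensional graded algebra `A = ⨁ 𝒜 i` and its graded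
subalgebras `A0`, `Ale`, `Age` (written `A^0`, `A^{≤0}`, `A^{≥0}`). -/
structure IsTriangular (𝒜 : ℤ → Submodule k A) [GradedAlgebra 𝒜]
    (A0 Ale Age : Subalgebra k A) : Prop where
  finite : FiniteDimensional k A
  /-- the three subalgebras are graded -/
  homogeneous_zero : DirectSum.SetLike.IsHomogeneous 𝒜 A0
  homogeneous_le : DirectSum.SetLike.IsHomogeneous 𝒜 Ale
  homogeneous_ge : DirectSum.SetLike.IsHomogeneous 𝒜 Age
  /-- `A^{≤0}` is graded by the nonpositive integers, `A^{≥0}` by the nonnegative ones -/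
  le_graded : ∀ i : ℤ, 0 < i → Subalgebra.toSubmodule Ale ⊓ 𝒜 i = ⊥
  ge_graded : ∀ i : ℤ, i < 0 → Subalgebra.toSubmodule Age ⊓ 𝒜 i = ⊥
  /-- `A^0` is the intersection of `A^{≤0}` and `A^{≥0}`, and the degree 0 component of both -/
  zero_eq : A0 = Ale ⊓ Age
  zero_eq_le : Subalgebra.toSubmodule A0 = Subalgebra.toSubmodule Ale ⊓ 𝒜 0
  zero_eq_ge : Subalgebra.toSubmodule A0 = Subalgebra.toSubmodule Age ⊓ 𝒜 0
  /-- the multiplication maps `A^{≥0} ⊗_{A^0} A^{≤0} → A` and `A^{≤0} ⊗_{A^0} A^{≥0} → A` are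
  isomorphisms -/
  mul_bijective : Function.Bijective
    (balancedMul A0 Age Ale (zero_eq.le.trans inf_le_right) (zero_eq.le.trans inf_le_left))
  mul_bijective' : Function.Bijective
    (balancedMul A0 Ale Age (zero_eq.le.trans inf_le_left) (zero_eq.le.trans inf_le_right))
  semisimple : IsSemisimpleRing A0
  selfInjective : Module.Injective Age Age

end Triangular

/-! ## Morphisms through a functor -/

section Through

universe v₁ v₂ u₁ u₂

variable {𝒞 : Type u₁} [Category.{v₁} 𝒞] {ℬ : Type u₂} [Category.{v₂} ℬ] (Φ : ℬ ⥤ 𝒞)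

/-- A diagram `X ⟶ Φ(Z) ⟶ Y` with `Z` in `ℬ`. -/
structure ThroughDiagram (X Y : 𝒞) where
  /-- the object in the middle -/
  mid : ℬ
  /-- the first arrow -/
  fst : X ⟶ Φ.obj mid
  /-- the second arrow -/
  snd : Φ.obj mid ⟶ Y

namespace ThroughDiagram

variable {Φ} {X Y : 𝒞}

/-- Morphisms of diagrams: morphisms `Z ⟶ Z'` in `ℬ` compatible with the arrows. -/
@[ext]
structure Hom (d d' : ThroughDiagram Φ X Y) where
  /-- the morphism of the middle objects -/
  map : d.mid ⟶ d'.mid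
  fst_comp : d.fst ≫ Φ.map map = d'.fst
  comp_snd : Φ.map map ≫ d'.snd = d.snd

instance : Category (ThroughDiagram Φ X Y) where
  Hom := Hom
  id d := ⟨𝟙 _, by simp, by simp⟩
  comp f g := ⟨f.map ≫ g.map, by simp [← Category.assoc, f.fst_comp, g.fst_comp],
    by simp [f.comp_snd, g.comp_snd]⟩
  id_comp f := Hom.ext (Category.id_comp _)
  comp_id f := Hom.ext (Category.comp_id _)
  assoc f g h := Hom.ext (Category.assoc _ _ _)

end ThroughDiagram

/-- The set of morphisms from `X` to `Y` through `Φ`: the set of connected components of the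
category of diagrams `X ⟶ Φ(Z) ⟶ Y`. -/
def HomThrough (X Y : 𝒞) : Type (max u₂ v₁) := ConnectedComponents (ThroughDiagram Φ X Y)

namespace HomThrough

variable {Φ} {X Y : 𝒞}

/-- The class of the diagram `X ⟶ Φ(Z) ⟶ Y`. -/
def mk (Z : ℬ) (f : X ⟶ Φ.obj Z) (g : Φ.obj Z ⟶ Y) : HomThrough Φ X Y :=
  Quotient.mk (Zigzag.setoid _) (⟨Z, f, g⟩ : ThroughDiagram Φ X Y)

lemma ind {p : HomThrough Φ X Y → Prop} (h : ∀ Z f g, p (mk Z f g)) (t : HomThrough Φ X Y) :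
    p t :=
  Quotient.inductionOn t fun d => h d.mid d.fst d.snd

lemma sound {Z Z' : ℬ} {f : X ⟶ Φ.obj Z} {g : Φ.obj Z ⟶ Y} {f' : X ⟶ Φ.obj Z'}
    {g' : Φ.obj Z' ⟶ Y} (m : Z ⟶ Z') (h : f ≫ Φ.map m = f') (h' : Φ.map m ≫ g' = g) :
    mk Z f g = mk Z' f' g' :=
  Quotient.sound (Zigzag.of_hom (⟨m, h, h'⟩ : ThroughDiagram.Hom _ _))

/-- To define a map on classes, it suffices to define it on diagrams, compatibly with morphisms of
diagrams. -/
def lift {α : Sort*} (F : ThroughDiagram Φ X Y → α)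
    (hF : ∀ d d' (_ : d ⟶ d'), F d = F d') : HomThrough Φ X Y → α :=
  Quotient.lift F fun _ _ h => by
    induction h with
    | refl => rfl
    | tail _ h ih =>
      rw [ih]
      rcases h with ⟨⟨f⟩⟩ | ⟨⟨f⟩⟩
      · exact hF _ _ f
      · exact (hF _ _ f).symm

/-- Composition with a morphism `X' ⟶ X`. -/
def precomp {X' : 𝒞} (a : X' ⟶ X) : HomThrough Φ X Y → HomThrough Φ X' Y :=
  lift (fun d => mk d.mid (a ≫ d.fst) d.snd) fun _ _ m =>
    sound m.map (by rw [Category.assoc, m.fst_comp]) m.comp_snd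

/-- Composition with a morphism `Y ⟶ Y'`. -/
def postcomp {Y' : 𝒞} (b : Y ⟶ Y') : HomThrough Φ X Y → HomThrough Φ X Y' :=
  lift (fun d => mk d.mid d.fst (d.snd ≫ b)) fun _ _ m =>
    sound m.map m.fst_comp (by rw [← Category.assoc, m.comp_snd])

section additive

variable [Preadditive 𝒞] [Preadditive ℬ] [Φ.Additive] [HasZeroObject ℬ] [HasBinaryBiproducts ℬ]

open ZeroObject

/-- The sum of two diagrams: `X ⟶ Φ(Z ⊞ Z') ⟶ Y`, with the arrows induced by those of the
summands. -/
noncomputable def addMk (d d' : ThroughDiagram Φ X Y) : HomThrough Φ X Y :=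
  mk (d.mid ⊞ d'.mid) (d.fst ≫ Φ.map biprod.inl + d'.fst ≫ Φ.map biprod.inr)
    (Φ.map biprod.fst ≫ d.snd + Φ.map biprod.snd ≫ d'.snd)

lemma addMk_congr {d₁ d₂ d₁' d₂' : ThroughDiagram Φ X Y} (m : d₁ ⟶ d₂) (m' : d₁' ⟶ d₂') :
    addMk d₁ d₁' = addMk d₂ d₂' := by
  refine sound (biprod.map m.map m'.map) ?_ ?_
  · rw [← m.fst_comp, ← m'.fst_comp]
    simp only [Preadditive.add_comp, Category.assoc, ← Φ.map_comp, biprod.inl_map, biprod.inr_map]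
  · rw [← m.comp_snd, ← m'.comp_snd]
    simp only [Preadditive.comp_add, ← Category.assoc, ← Φ.map_comp, biprod.map_fst,
      biprod.map_snd]

noncomputable instance : Add (HomThrough Φ X Y) :=
  ⟨fun s t => lift (fun d => lift (fun d' => addMk d d') (fun _ _ m => addMk_congr (𝟙 d) m) t)
    (fun _ _ m => by
      induction t using ind
      exact addMk_congr m (𝟙 _)) s⟩

lemma mk_add_mk (Z Z' : ℬ) (f : X ⟶ Φ.obj Z) (g : Φ.obj Z ⟶ Y) (f' : X ⟶ Φ.obj Z')
    (g' : Φ.obj Z' ⟶ Y) : mk Z f g + mk Z' f' g' =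
      mk (Z ⊞ Z') (f ≫ Φ.map biprod.inl + f' ≫ Φ.map biprod.inr)
        (Φ.map biprod.fst ≫ g + Φ.map biprod.snd ≫ g') := rfl

noncomputable instance : Zero (HomThrough Φ X Y) := ⟨mk 0 0 0⟩

lemma zero_def : (0 : HomThrough Φ X Y) = mk 0 0 0 := rfl

lemma mk_zero_right (Z : ℬ) (f : X ⟶ Φ.obj Z) : mk Z f (0 : Φ.obj Z ⟶ Y) = 0 :=
  sound 0 (by simp) (by simp)

instance : Neg (HomThrough Φ X Y) :=
  ⟨lift (fun d => mk d.mid d.fst (-d.snd)) fun _ _ m =>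
    sound m.map m.fst_comp (by rw [Preadditive.comp_neg, m.comp_snd])⟩

lemma neg_mk (Z : ℬ) (f : X ⟶ Φ.obj Z) (g : Φ.obj Z ⟶ Y) : -mk Z f g = mk Z f (-g) := rfl

/-- Addition of diagrams with the same first arrow. -/
lemma mk_add_mk_same (Z : ℬ) (f : X ⟶ Φ.obj Z) (g g' : Φ.obj Z ⟶ Y) :
    mk Z f g + mk Z f g' = mk Z f (g + g') := by
  rw [mk_add_mk]
  refine (sound (biprod.lift (𝟙 Z) (𝟙 Z)) ?_ ?_).symm
  · rw [← Preadditive.comp_add, ← Φ.map_add]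
    congr 2
    apply biprod.hom_ext <;> simp
  · simp only [Preadditive.comp_add, ← Category.assoc, ← Φ.map_comp, biprod.lift_fst,
      biprod.lift_snd, Φ.map_id, Category.id_comp]

protected lemma zero_add' (t : HomThrough Φ X Y) : 0 + t = t := by
  induction t using ind with
  | _ Z f g => ?_
  rw [zero_def, mk_add_mk]
  refine sound biprod.snd ?_ ?_
  · simp only [Category.assoc, ← Φ.map_comp, biprod.inr_snd, zero_comp, zero_add, Φ.map_id, Category.comp_id]
  · simp

protected lemma add_comm' (s t : HomThrough Φ X Y) : s + t = t + s := by
  induction s using ind with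
  | _ Z f g => ?_
  induction t using ind with
  | _ Z' f' g' => ?_
  rw [mk_add_mk, mk_add_mk]
  refine sound (biprod.lift biprod.snd biprod.fst) ?_ ?_
  · rw [add_comm]
    simp only [Preadditive.add_comp, Category.assoc, ← Φ.map_comp]
    congr 3 <;> apply biprod.hom_ext <;> simp
  · rw [add_comm]
    simp only [Preadditive.comp_add, ← Category.assoc, ← Φ.map_comp, biprod.lift_fst,
      biprod.lift_snd]

protected lemma add_assoc' (s t r : HomThrough Φ X Y) : s + t + r = s + (t + r) := by
  induction s using ind with
  | _ Z f g => ?_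
  induction t using ind with
  | _ Z' f' g' => ?_
  induction r using ind with
  | _ Z'' f'' g'' => ?_
  simp only [mk_add_mk]
  have h1 : (biprod.inl ≫ biprod.inl : Z ⟶ (Z ⊞ Z') ⊞ Z'') ≫
      biprod.lift (biprod.fst ≫ biprod.fst) (biprod.lift (biprod.fst ≫ biprod.snd) biprod.snd) =
      biprod.inl := by
    apply biprod.hom_ext
    · simp
    · apply biprod.hom_ext <;> simp
  have h2 : (biprod.inr ≫ biprod.inl : Z' ⟶ (Z ⊞ Z') ⊞ Z'') ≫
      biprod.lift (biprod.fst ≫ biprod.fst) (biprod.lift (biprod.fst ≫ biprod.snd) biprod.snd) =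
      biprod.inl ≫ biprod.inr := by
    apply biprod.hom_ext
    · simp
    · apply biprod.hom_ext <;> simp
  have h3 : (biprod.inr : Z'' ⟶ (Z ⊞ Z') ⊞ Z'') ≫
      biprod.lift (biprod.fst ≫ biprod.fst) (biprod.lift (biprod.fst ≫ biprod.snd) biprod.snd) =
      biprod.inr ≫ biprod.inr := by
    apply biprod.hom_ext
    · simp
    · apply biprod.hom_ext <;> simp
  simp only [Category.assoc] at h1 h2
  refine sound (biprod.lift (biprod.fst ≫ biprod.fst)
    (biprod.lift (biprod.fst ≫ biprod.snd) biprod.snd)) ?_ ?_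
  · simp only [Preadditive.add_comp, Category.assoc, ← Φ.map_comp, add_assoc]
    rw [h1, h2, h3]
  · simp only [Preadditive.comp_add, ← Category.assoc, ← Φ.map_comp, biprod.lift_fst,
      biprod.lift_snd, add_assoc]

noncomputable instance : AddCommGroup (HomThrough Φ X Y) where
  add_assoc := HomThrough.add_assoc'
  zero_add := HomThrough.zero_add'
  add_zero t := by rw [HomThrough.add_comm', HomThrough.zero_add']
  add_comm := HomThrough.add_comm'
  neg_add_cancel t := by
    induction t using ind with
    | _ Z f g => ?_
    rw [neg_mk, mk_add_mk_same, neg_add_cancel, mk_zero_right]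
  nsmul := nsmulRec
  zsmul := zsmulRec

end additive

end HomThrough

end Through

/-! ## The triangulated subcategory generated by a class of objects -/

section Hull

open Pretriangulated ZeroObject

variable {𝒟 : Type*} [Category* 𝒟] [HasZeroObject 𝒟] [HasShift 𝒟 ℤ] [Preadditive 𝒟]
  [∀ n : ℤ, (shiftFunctor 𝒟 n).Additive] [Pretriangulated 𝒟]

/-- The (strictly) full triangulated subcategory generated by a class `P` of objects: the smallest
one that contains `P`. -/
def triangulatedHull (P : ObjectProperty 𝒟) : ObjectProperty 𝒟 := fun Z =>
  ∀ Q : ObjectProperty 𝒟, Q.IsTriangulated → Q.IsClosedUnderIsomorphisms → P ≤ Q → Q Z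

lemma le_triangulatedHull (P : ObjectProperty 𝒟) : P ≤ triangulatedHull P :=
  fun Z hZ _ _ _ h => h Z hZ

lemma triangulatedHull_le {P Q : ObjectProperty 𝒟} [hQ : Q.IsTriangulated]
    [hQ' : Q.IsClosedUnderIsomorphisms] (h : P ≤ Q) : triangulatedHull P ≤ Q :=
  fun _ hZ => hZ Q hQ hQ' h

instance (P : ObjectProperty 𝒟) : (triangulatedHull P).IsClosedUnderIsomorphisms where
  of_iso e hX Q hQ hQ' h := Q.prop_of_iso e (hX Q hQ hQ' h)

instance (P : ObjectProperty 𝒟) : (triangulatedHull P).IsTriangulated where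
  exists_zero := ⟨0, isZero_zero _, fun Q _ _ _ => by
    obtain ⟨Z, hZ, hQZ⟩ := Q.exists_prop_of_containsZero
    exact Q.prop_of_iso (hZ.iso (isZero_zero _)) hQZ⟩
  isStableUnderShiftBy n := ⟨fun X hX Q hQ hQ' h => Q.le_shift n _ (hX Q hQ hQ' h)⟩
  ext₂' T hT h₁ h₃ := ObjectProperty.le_isoClosure _ _ fun Q hQ hQ' h =>
    Q.ext_of_isTriangulatedClosed₂ T hT (h₁ Q hQ hQ' h) (h₃ Q hQ hQ' h)

end Hull

/-! ## Semi-infinite Ext -/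

section SemiInfinite

variable {k A : Type u} [Field k] [Ring A] [Algebra k A] {𝒜 : ℤ → Submodule k A}

/-- A complex of graded modules is convex if the weights go down: for any `n`, the sum of the
weight spaces of degree more than `n` (of all the terms of the complex) is finite dimensional.
As every single weight space is finite dimensional, this says that only finitely many of them
are nonzero. -/
def IsConvex (K : CochainComplex (GrMod 𝒜) ℤ) : Prop :=
  ∀ n : ℤ, {q : ℤ × ℤ | n < q.2 ∧ (K.X q.1).deg q.2 ≠ ⊥}.Finite

/-- A complex of graded modules is concave if the weights go up: for any `n`, the sum of the
weight spaces of degree less than `n` (of all the terms of the complex) is finite dimensional. -/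
def IsConcave (K : CochainComplex (GrMod 𝒜) ℤ) : Prop :=
  ∀ n : ℤ, {q : ℤ × ℤ | q.2 < n ∧ (K.X q.1).deg q.2 ≠ ⊥}.Finite

variable [HasDerivedCategory.{w} (GrMod 𝒜)]

open DerivedCategory

/-- The class of the `S`-injective `A`-modules (as complexes concentrated in degree 0) in the
bounded derived category of finite dimensional graded `A`-modules. -/
def injectiveObjects (S : Subalgebra k A) : ObjectProperty (Bounded (GrMod 𝒜)) := fun Z =>
  ∃ M : GrMod 𝒜, M.IsInjectiveOver S ∧ Nonempty (Z.obj ≅ (singleFunctor (GrMod 𝒜) 0).obj M)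

/-- The full triangulated subcategory of the bounded derived category that is generated by the
`S`-injective `A`-modules. -/
def semiInfProp (𝒜 : ℤ → Submodule k A) [HasDerivedCategory.{w} (GrMod 𝒜)]
    (S : Subalgebra k A) : ObjectProperty (Bounded (GrMod 𝒜)) :=
  triangulatedHull (injectiveObjects S)

instance (S : Subalgebra k A) : (semiInfProp 𝒜 S).IsTriangulated :=
  inferInstanceAs (triangulatedHull _).IsTriangulated

/-- The morphisms `X ⟶ Y` in the bounded derived category through the full triangulated
subcategory generated by the `S`-injective modules. -/
abbrev HomThroughInjectives (S : Subalgebra k A) (X Y : Bounded (GrMod 𝒜)) : Type (max (u + 1) w) :=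
  HomThrough (semiInfProp 𝒜 S).ι X Y

/-- A bounded below convex complex of `S`-injective modules, with an isomorphism to `X` in the
derived category. -/
structure ConvexResolution (S : Subalgebra k A) (X : Bounded (GrMod 𝒜)) where
  /-- the complex -/
  cx : CochainComplex (GrMod 𝒜) ℤ
  boundedBelow : ∃ n : ℤ, cx.IsStrictlyGE n
  convex : IsConvex cx
  injective : ∀ n : ℤ, (cx.X n).IsInjectiveOver S
  /-- the quasi-isomorphism -/
  iso : Q.obj cx ≅ X.obj

/-- A bounded below concave complex of `S`-injective modules, with an isomorphism to `Y` in the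
derived category. -/
structure ConcaveResolution (S : Subalgebra k A) (Y : Bounded (GrMod 𝒜)) where
  /-- the complex -/
  cx : CochainComplex (GrMod 𝒜) ℤ
  boundedBelow : ∃ n : ℤ, cx.IsStrictlyGE n
  concave : IsConcave cx
  injective : ∀ n : ℤ, (cx.X n).IsInjectiveOver S
  /-- the quasi-isomorphism -/
  iso : Q.obj cx ≅ Y.obj

/-- The isomorphism from the shift of a resolution of `Y` to the shift of `Y`. -/
noncomputable def ConcaveResolution.shiftIso {S : Subalgebra k A} {Y : Bounded (GrMod 𝒜)}
    (J : ConcaveResolution S Y) (i : ℤ) : Q.obj (J.cx⟦i⟧) ≅ (Y⟦i⟧).obj :=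
  (Q.commShiftIso i).app J.cx ≪≫ (shiftFunctor _ i).mapIso J.iso ≪≫
    ((Bounded.ι (C := GrMod 𝒜)).commShiftIso i).symm.app Y

/-- The semi-infinite Ext group `Ext^{∞/2+i}(X, Y)`, computed through a convex resolution of `X`
and a concave resolution of `Y`: the `i`-th cohomology of the complex of (degree preserving)
homomorphisms between the resolutions. -/
abbrev SemiInfExt {S T : Subalgebra k A} {X Y : Bounded (GrMod 𝒜)}
    (I : ConvexResolution S X) (J : ConcaveResolution T Y) (i : ℤ) : Type u :=
  CochainComplex.HomComplex.CohomologyClass I.cx J.cx i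

end SemiInfinite

end SemiInf

/-! ### Weights of graded modules and homogeneous parts of linear maps. -/

namespace SemiInf

namespace GrMod

section Basic

variable {k A : Type u} [Field k] [Ring A] [Algebra k A] {𝒜 : ℤ → Submodule k A}

/-! Coinduction produces the resolutions. Since `A = A^{≤0} ⊗_{A^0} A^{≥0}`, a module coinduced from
`A^{≤0}` restricts to `A^{≥0}` as `Hom_{A^0}(A^{≥0}, M)`, which is injective because `A^0` is
semisimple (`isInjectiveOver_coind`). The unit `X ⟶ Hom_{A^{≤0}}(A, X)` is onto in the top weight of
`X`, so its cokernel has a smaller top weight. Resolving a bounded complex by such modules therefore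
pushes the weights down by one at each step after the end of the complex: the resolution is convex.
The mirror image, with `A^{≤0}` and `A^{≥0}` exchanged, gives concave resolutions by
`A^{≤0}`-injective modules.

Two further facts link the two halves. First, a self-injective algebra with semisimple degree 0 part
and nilpotent positive part is a cogenerator, so every graded `A^{≥0}`-module embeds in a sum of
shifted free modules, and injective and projective modules coincide
(`isInjectiveOver_iff_projective`). Secondly, `Ext^1(P, I) = 0` if `P` is `A^{≥0}`-projective and
`I` is `A^{≤0}`-injective (`ext_one_eq_zero`): by `exists_coind_quotient`, `I` is filtered by
modules coinduced from `A^{≥0}`, and for these the claim is Shapiro's lemma. Hence morphisms in the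
derived category from a bounded complex of `A^{≥0}`-injectives to a bounded below complex of
`A^{≤0}`-injectives are homotopy classes of chain maps (`computesHom`).

The comparison is a colimit over the brutal truncations `σ_{≤ n} I` of the convex resolution `I` of
`X`, which are bounded and belong to the subcategory `D_{∞/2}`. Every `Z` in `D_{∞/2}` has a
K-injective model whose weights are bounded below (`semiInfProp_le`). As the weights of `I` go down,
there are no nonzero maps from `I` to this model in high degrees, so `X ⟶ Z` factors through `σ_{≤
n} I`, and uniquely for large `n`. Any diagram `X ⟶ Z ⟶ Y` is thus equivalent to a diagram `X ⟶ σ_{≤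
n} I ⟶ Y`, whose second arrow is a chain map to the concave resolution `J` of `Y`, unique up to
homotopy. By the same comparison of weights, chain maps `I ⟶ J` and homotopies between them factor
through truncations as well. Both sides are therefore the colimit of the homotopy classes of maps
`σ_{≤ n} I ⟶ J`. -/

lemma finite_weights (M : GrMod 𝒜) : {i : ℤ | M.deg i ≠ ⊥}.Finite :=
  WellFoundedGT.finite_ne_bot_of_iSupIndep M.isInternal.submodule_iSupIndep

/-- The finite set of the weights of a graded module. -/
noncomputable def wts (M : GrMod 𝒜) : Finset ℤ := M.finite_weights.toFinset

lemma mem_wts {M : GrMod 𝒜} {i : ℤ} : i ∈ M.wts ↔ M.deg i ≠ ⊥ := by simp [wts]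

lemma eq_zero_of_notMem_wts {M : GrMod 𝒜} {i : ℤ} (hi : i ∉ M.wts) {x : M} (hx : x ∈ M.deg i) :
    x = 0 := by
  rw [mem_wts, not_not] at hi
  rw [hi] at hx
  simpa using hx

lemma proj_proj_ne (M : GrMod 𝒜) {i j : ℤ} (hij : i ≠ j) (x : M) : M.proj i (M.proj j x) = 0 :=
  M.proj_of_mem_ne hij (M.proj_mem j x)

lemma sum_proj_of_subset (M : GrMod 𝒜) {s : Finset ℤ} (hs : M.wts ⊆ s) (x : M) :
    ∑ i ∈ s, M.proj i x = x := by
  obtain ⟨t, ht⟩ := M.exists_sum_proj x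
  have h0 : ∀ i, i ∉ s → M.proj i x = 0 := fun i hi =>
    eq_zero_of_notMem_wts (fun h => hi (hs h)) (M.proj_mem i x)
  have h1 : ∀ i, i ∉ t → M.proj i x = 0 := fun i hi => by
    conv_lhs => rw [← ht, map_sum]
    exact Finset.sum_eq_zero fun j hj => M.proj_proj_ne (by rintro rfl; exact hi hj) x
  rw [Finset.sum_subset (Finset.subset_union_left (s₂ := t)) fun i _ hi => h0 i hi,
    ← Finset.sum_subset (Finset.subset_union_right (s₁ := s)) fun i _ hi => h1 i hi, ht]

lemma sum_proj (M : GrMod 𝒜) (x : M) : ∑ i ∈ M.wts, M.proj i x = x :=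
  M.sum_proj_of_subset subset_rfl x

lemma eq_zero_of_proj {M : GrMod 𝒜} {x : M} (h : ∀ i, M.proj i x = 0) : x = 0 := by
  rw [← M.sum_proj x]
  exact Finset.sum_eq_zero fun i _ => h i

lemma proj_smul (M : GrMod 𝒜) {i : ℤ} {a : A} (ha : a ∈ 𝒜 i) (j : ℤ) (x : M) :
    M.proj (i + j) (a • x) = a • M.proj j x := by
  conv_lhs => rw [← M.sum_proj_of_subset (Finset.subset_insert j M.wts) x, Finset.smul_sum, map_sum]
  rw [Finset.sum_eq_single j]
  · exact M.proj_of_mem (M.smul_mem _ _ _ _ ha (M.proj_mem j x))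
  · intro l _ hl
    exact M.proj_of_mem_ne (by omega) (M.smul_mem _ _ _ _ ha (M.proj_mem l x))
  · intro h
    exact absurd (Finset.mem_insert_self _ _) h

lemma mono_of_injective {M N : GrMod 𝒜} (f : M ⟶ N) (hf : Function.Injective f.lin) : Mono f where
  right_cancellation g h e := by
    ext x
    exact hf (congrArg (fun u : _ ⟶ N => u.lin x) e)

lemma epi_of_surjective {M N : GrMod 𝒜} (f : M ⟶ N) (hf : Function.Surjective f.lin) : Epi f where
  left_cancellation g h e := by
    ext x
    obtain ⟨y, rfl⟩ := hf x
    exact congrArg (fun u : M ⟶ _ => u.lin y) e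

lemma isIso_of_bijective {M N : GrMod 𝒜} (f : M ⟶ N) (hf : Function.Bijective f.lin) :
    IsIso f := by
  have := mono_of_injective f hf.1
  have := epi_of_surjective f hf.2
  exact isIso_of_mono_of_epi f

lemma exists_mem_deg_of_surjective {M N : GrMod 𝒜} (f : M ⟶ N) (hf : Function.Surjective f.lin)
    {i : ℤ} {y : N} (hy : y ∈ N.deg i) : ∃ x ∈ M.deg i, f.lin x = y := by
  obtain ⟨x, rfl⟩ := hf y
  exact ⟨M.proj i x, M.proj_mem i x, by rw [map_proj, N.proj_of_mem hy]⟩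

lemma lin_congr {M N : GrMod 𝒜} {f g : M ⟶ N} (h : f = g) (x : M) : f.lin x = g.lin x := by rw [h]

/-- Two graded maps which agree on homogeneous elements are equal. -/
lemma hom_ext_deg {M N : GrMod 𝒜} {f g : M ⟶ N} (h : ∀ i, ∀ x ∈ M.deg i, f.lin x = g.lin x) :
    f = g := by
  ext x
  rw [← M.sum_proj x, map_sum, map_sum]
  exact Finset.sum_congr rfl fun i _ => h i _ (M.proj_mem i x)

section DegPart

variable {M N : GrMod 𝒜}

/-- The homogeneous part of degree `d` of an additive map between graded modules. -/
noncomputable def degPartAux (h : M →+ N) (d : ℤ) : M →+ N :=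
  ∑ i ∈ M.wts, (N.proj (i + d)).toAddMonoidHom.comp (h.comp (M.proj i).toAddMonoidHom)

lemma degPartAux_apply (h : M →+ N) (d : ℤ) (x : M) :
    degPartAux h d x = ∑ i ∈ M.wts, N.proj (i + d) (h (M.proj i x)) := by
  simp [degPartAux]

lemma degPartAux_of_mem (h : M →+ N) (d : ℤ) {i : ℤ} {x : M} (hx : x ∈ M.deg i) :
    degPartAux h d x = N.proj (i + d) (h x) := by
  rw [degPartAux_apply, Finset.sum_eq_single i, M.proj_of_mem hx]
  · intro j _ hj
    rw [M.proj_of_mem_ne hj hx, map_zero, map_zero]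
  · intro hi
    rw [eq_zero_of_notMem_wts hi hx]
    simp

/-- The homogeneous part of degree `d` of a linear map between graded modules. -/
noncomputable def degPart (h𝒜 : ⨆ i, 𝒜 i = ⊤) (h : M →ₗ[A] N) (d : ℤ) : M →ₗ[A] N where
  toFun := degPartAux h.toAddMonoidHom d
  map_add' := map_add _
  map_smul' a x := by
    have ha : a ∈ ⨆ i, 𝒜 i := h𝒜 ▸ Submodule.mem_top
    rw [RingHom.id_apply]
    induction ha using Submodule.iSup_induction' with
    | mem j a ha =>
      rw [← M.sum_proj x, Finset.smul_sum, map_sum, map_sum, Finset.smul_sum]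
      refine Finset.sum_congr rfl fun i _ => ?_
      have hx := M.proj_mem i x
      rw [degPartAux_of_mem _ _ hx, degPartAux_of_mem _ _ (M.smul_mem _ _ _ _ ha hx), add_assoc,
        LinearMap.toAddMonoidHom_coe, map_smul, N.proj_smul ha]
    | zero => simp
    | add a b _ _ ha hb => rw [add_smul, add_smul, map_add, ha, hb]

variable (h𝒜 : ⨆ i, 𝒜 i = ⊤) (h : M →ₗ[A] N) (d : ℤ)

lemma degPart_of_mem {i : ℤ} {x : M} (hx : x ∈ M.deg i) :
    degPart h𝒜 h d x = N.proj (i + d) (h x) :=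
  degPartAux_of_mem _ d hx

lemma degPart_mem {i : ℤ} {x : M} (hx : x ∈ M.deg i) : degPart h𝒜 h d x ∈ N.deg (i + d) := by
  rw [degPart_of_mem h𝒜 h d hx]
  exact N.proj_mem _ _

lemma degPart_eq_self (hh : ∀ i, ∀ x ∈ M.deg i, h x ∈ N.deg (i + d)) : degPart h𝒜 h d = h := by
  ext x
  rw [← M.sum_proj x, map_sum, map_sum]
  refine Finset.sum_congr rfl fun i _ => ?_
  rw [degPart_of_mem h𝒜 h d (M.proj_mem i x), N.proj_of_mem (hh _ _ (M.proj_mem i x))]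

lemma degPart_eq_zero {d d' : ℤ} (hd : d ≠ d') (hh : ∀ i, ∀ x ∈ M.deg i, h x ∈ N.deg (i + d')) :
    degPart h𝒜 h d = 0 := by
  ext x
  rw [← M.sum_proj x, map_sum, map_sum]
  refine Finset.sum_congr rfl fun i _ => ?_
  rw [degPart_of_mem h𝒜 h d (M.proj_mem i x),
    N.proj_of_mem_ne (by omega) (hh _ _ (M.proj_mem i x)), LinearMap.zero_apply]

/-- A finite set that contains the degrees of all homogeneous maps from `M` to `N`. -/
noncomputable def homDegs (M N : GrMod 𝒜) : Finset ℤ := (N.wts ×ˢ M.wts).image fun q => q.1 - q.2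

lemma sum_degPart : ∑ d ∈ homDegs M N, degPart h𝒜 h d = h := by
  ext x
  rw [LinearMap.sum_apply]
  conv_rhs => rw [← M.sum_proj x, map_sum]
  conv_lhs => enter [2, d]; rw [← M.sum_proj x, map_sum]
  rw [Finset.sum_comm]
  refine Finset.sum_congr rfl fun i hi => ?_
  rw [Finset.sum_congr rfl fun d _ => degPart_of_mem h𝒜 h d (M.proj_mem i x)]
  -- For a fixed weight `i` of `M`, the degrees `i + d` with `d` in `homDegs M N` exhaust the
  -- weights of `N`, so the sum of the projections in these degrees is the identity.
  have hs : N.wts ⊆ (homDegs M N).map (addLeftEmbedding i) := fun j hj => by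
    simp only [Finset.mem_map, addLeftEmbedding_apply, homDegs, Finset.mem_image,
      Finset.mem_product, Prod.exists]
    exact ⟨j - i, ⟨j, i, ⟨hj, hi⟩, rfl⟩, by omega⟩
  conv_rhs => rw [← N.sum_proj_of_subset hs (h (M.proj i x)), Finset.sum_map]
  rfl

/-- The degree preserving part of a linear map. -/
noncomputable def homOfLin : M ⟶ N :=
  ⟨degPart h𝒜 h 0, fun i x hx => by simpa using degPart_mem h𝒜 h 0 hx⟩

lemma homOfLin_of_mem {i : ℤ} {x : M} (hx : x ∈ M.deg i) :
    (homOfLin h𝒜 h).lin x = N.proj i (h x) :=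
  (degPart_of_mem h𝒜 h 0 hx).trans (by rw [add_zero])

end DegPart

end Basic

end GrMod

end SemiInf

/-! ### Restriction to a subalgebra and coinduction. -/

namespace SemiInf

namespace GrMod

section Shift

variable {k A : Type u} [Field k] [Ring A] [Algebra k A] {𝒜 : ℤ → Submodule k A}

/-- The graded module with the weights moved down by `d`. -/
noncomputable def shiftDeg (M : GrMod 𝒜) (d : ℤ) : GrMod 𝒜 where
  carrier := M
  deg i := M.deg (i + d)
  isInternal := by
    refine isInternal_of_proj _ (fun i => M.proj (i + d)) (fun i x => M.proj_mem _ x)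
      (fun i x hx => M.proj_of_mem hx) (fun i j hij x hx => M.proj_of_mem_ne (by omega) hx)
      fun x => ⟨M.wts.map (Equiv.subRight d).toEmbedding, ?_⟩
    rw [Finset.sum_map]
    simpa using M.sum_proj x
  smul_mem i j a m ha hm := by
    rw [add_assoc]
    exact M.smul_mem _ _ a m ha hm

lemma injective_iff_exists_extension (Q : GrMod 𝒜) :
    Injective Q ↔ ∀ (X Y : GrMod 𝒜) (f : X ⟶ Y) (_ : Function.Injective f.lin) (g : X ⟶ Q),
      ∃ h : Y ⟶ Q, ∀ x, h.lin (f.lin x) = g.lin x := by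
  constructor
  · intro hQ X Y f hf g
    have := mono_of_injective f hf
    exact ⟨Injective.factorThru g f, fun x => lin_congr (Injective.comp_factorThru g f) x⟩
  · intro h
    refine ⟨fun {X Y} g f _ => ?_⟩
    obtain ⟨h, hh⟩ := h X Y f (injective_of_mono f) g
    exact ⟨h, by ext x; exact hh x⟩

end Shift

section Restriction

variable {k A : Type u} [Field k] [Ring A] [Algebra k A] {𝒜 : ℤ → Submodule k A}
  (S : Subalgebra k A)

/-- The restriction of a morphism to a subalgebra. -/
def resMap {M N : GrMod 𝒜} (f : M ⟶ N) : M.res S ⟶ N.res S :=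
  ⟨f.lin.restrictScalars S, f.map_deg⟩

lemma resMap_comp {M N P : GrMod 𝒜} (f : M ⟶ N) (g : N ⟶ P) :
    resMap S (f ≫ g) = resMap S f ≫ resMap S g := rfl

lemma resMap_id (M : GrMod 𝒜) : resMap S (𝟙 M) = 𝟙 (M.res S) := rfl

lemma resMap_zero (M N : GrMod 𝒜) : resMap S (0 : M ⟶ N) = 0 := rfl

variable {S} in
lemma IsInjectiveOver.of_retract {M N : GrMod 𝒜} (hN : N.IsInjectiveOver S) (r : Retract M N) :
    M.IsInjectiveOver S := by
  have : Injective (N.res S) := hN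
  exact Retract.injective (Y := N.res S)
    ⟨resMap S r.i, resMap S r.r, by rw [← resMap_comp, r.retract, resMap_id]⟩

variable {S} in
lemma IsInjectiveOver.of_iso {M N : GrMod 𝒜} (hN : N.IsInjectiveOver S) (e : M ≅ N) :
    M.IsInjectiveOver S :=
  hN.of_retract (Retract.ofIso e)

variable {S} in
-- An injective `A`-module splits off every module in which it embeds.
lemma isInjectiveOver_of_injective_of_mono {M N : GrMod 𝒜} (hM : Injective M)
    (hN : N.IsInjectiveOver S) (f : M ⟶ N) [Mono f] : M.IsInjectiveOver S :=
  hN.of_retract ⟨f, Injective.factorThru (𝟙 M) f, Injective.comp_factorThru _ _⟩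

end Restriction

section Regular

variable {k A : Type u} [Field k] [Ring A] [Algebra k A]

/-- A finite dimensional graded algebra, as a graded module over itself. -/
noncomputable def regular [FiniteDimensional k A] (𝒜 : ℤ → Submodule k A)
    (h : DirectSum.IsInternal 𝒜)
    (h' : ∀ i j a b, a ∈ 𝒜 i → b ∈ 𝒜 j → a * b ∈ 𝒜 (i + j)) : GrMod 𝒜 where
  carrier := A
  deg := 𝒜
  isInternal := h
  smul_mem i j a m ha hm := h' i j a m ha hm

/-- A finite dimensional graded algebra, as a graded module over itself. -/
noncomputable abbrev reg (𝒜 : ℤ → Submodule k A) [GradedAlgebra 𝒜] [FiniteDimensional k A] :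
    GrMod 𝒜 :=
  regular 𝒜 (DirectSum.Decomposition.isInternal 𝒜) fun _ _ _ _ ha hb => SetLike.mul_mem_graded ha hb

variable (𝒜 : ℤ → Submodule k A) [GradedAlgebra 𝒜] (S : Subalgebra k A)

lemma isInternal_subGrading (hS : DirectSum.SetLike.IsHomogeneous 𝒜 S) :
    DirectSum.IsInternal (subGrading 𝒜 S) := by
  refine isInternal_of_proj _ (fun i =>
    (((GradedAlgebra.proj 𝒜 i).comp S.val.toLinearMap).codRestrict (Subalgebra.toSubmodule S)
      fun x => hS i x.2 : S →ₗ[k] Subalgebra.toSubmodule S)) ?_ ?_ ?_ ?_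
  · intro i x
    exact (DirectSum.decompose 𝒜 (x : A) i).2
  · intro i x hx
    exact Subtype.ext (DirectSum.decompose_of_mem_same 𝒜 hx)
  · intro i j hij x hx
    exact Subtype.ext (DirectSum.decompose_of_mem_ne 𝒜 hx (Ne.symm hij))
  · classical
    intro x
    refine ⟨(DirectSum.decompose 𝒜 (x : A)).support, Subtype.ext ?_⟩
    exact (AddSubmonoidClass.coe_finsetSum _ _).trans (DirectSum.sum_support_decompose 𝒜 (x : A))

lemma subGrading_mul_mem (i j : ℤ) (a b : S) (ha : a ∈ subGrading 𝒜 S i)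
    (hb : b ∈ subGrading 𝒜 S j) : a * b ∈ subGrading 𝒜 S (i + j) :=
  SetLike.mul_mem_graded (A := 𝒜) (show (a : A) ∈ 𝒜 i from ha) hb

lemma iSup_subGrading (hS : DirectSum.SetLike.IsHomogeneous 𝒜 S) :
    ⨆ i, subGrading 𝒜 S i = ⊤ :=
  (isInternal_subGrading 𝒜 S hS).submodule_iSup_eq_top

end Regular

section Coind

variable {k A : Type u} [Field k] [Ring A] [Algebra k A] {𝒜 : ℤ → Submodule k A}
   {S : Subalgebra k A}

/-- The `S`-linear maps from `A` to an `S`-module, with the action of `A` given by the right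
multiplication. -/
def CoindCarrier (M : GrMod (subGrading 𝒜 S)) : Type u := A →ₗ[S] M

namespace CoindCarrier

variable {M : GrMod (subGrading 𝒜 S)}

instance : AddCommGroup (CoindCarrier M) := inferInstanceAs (AddCommGroup (A →ₗ[S] M))

instance : FunLike (CoindCarrier M) A M := inferInstanceAs (FunLike (A →ₗ[S] M) A M)

instance : AddMonoidHomClass (CoindCarrier M) A M :=
  inferInstanceAs (AddMonoidHomClass (A →ₗ[S] M) A M)

@[ext] lemma ext {f g : CoindCarrier M} (h : ∀ a, f a = g a) : f = g := LinearMap.ext h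

@[simp] lemma add_apply (f g : CoindCarrier M) (a : A) : (f + g) a = f a + g a := rfl

@[simp] lemma zero_apply (a : A) : (0 : CoindCarrier M) a = 0 := rfl

lemma map_smul (f : CoindCarrier M) (s : S) (a : A) : f (s * a) = s • f a :=
  LinearMap.map_smul (show A →ₗ[S] M from f) s a

instance : SMul A (CoindCarrier M) :=
  ⟨fun a f => (show A →ₗ[S] M from f).comp ((LinearMap.toSpanSingleton A A a).restrictScalars S)⟩

@[simp] lemma smul_apply (a : A) (f : CoindCarrier M) (b : A) : (a • f) b = f (b * a) := rfl

instance : Module A (CoindCarrier M) where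
  one_smul f := by ext; simp
  mul_smul a b f := by ext; simp [mul_assoc]
  smul_zero a := by ext; simp
  smul_add a f g := by ext; simp
  add_smul a b f := by ext; simp [mul_add]
  zero_smul f := by ext; simp

instance : Module k (CoindCarrier M) := Module.compHom _ (algebraMap k A)

lemma base_smul_def (c : k) (f : CoindCarrier M) : c • f = algebraMap k A c • f := rfl

instance : IsScalarTower k A (CoindCarrier M) :=
  ⟨fun c a f => by rw [base_smul_def, Algebra.smul_def, mul_smul]⟩

/-- The field acts through right multiplication on the source. As scalars are central, this is also
the left multiplication, which the `S`-linear map carries to its values. -/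
lemma base_smul_apply (c : k) (f : CoindCarrier M) (a : A) : (c • f) a = c • f a := by
  rw [base_smul_def, smul_apply, ← Algebra.commutes,
    ← algebraMap_smul (S : Subalgebra k A) c (f a)]
  exact map_smul f (algebraMap k S c) a

lemma map_base_smul (f : CoindCarrier M) (c : k) (a : A) : f (c • a) = c • f a := by
  rw [Algebra.smul_def, ← algebraMap_smul (S : Subalgebra k A) c (f a)]
  exact map_smul f (algebraMap k S c) a

/-- Elements of the coinduced module, as linear maps over the base field. -/
def toLin : CoindCarrier M →ₗ[k] (A →ₗ[k] M) where
  toFun f := { toFun := f, map_add' := map_add f, map_smul' := map_base_smul f }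
  map_add' _ _ := rfl
  map_smul' c f := by
    ext a
    exact base_smul_apply c f a

instance [FiniteDimensional k A] : Module.Finite k (CoindCarrier M) :=
  Module.Finite.of_injective (toLin (M := M)) fun f g h => by
    ext a
    exact congrArg (fun u : A →ₗ[k] M => u a) h

end CoindCarrier

variable [GradedAlgebra 𝒜] [FiniteDimensional k A]

/-- The coinduced module `Hom_S(A, M)`. -/
noncomputable def coind (hS : DirectSum.SetLike.IsHomogeneous 𝒜 S) (M : GrMod (subGrading 𝒜 S)) :
    GrMod 𝒜 where
  carrier := CoindCarrier M
  -- The elements of degree `d` are the maps that raise degrees by `d`.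
  deg d :=
    { carrier := {f | ∀ i, ∀ a ∈ 𝒜 i, f a ∈ M.deg (i + d)}
      add_mem' := fun hf hg i a ha => add_mem (hf i a ha) (hg i a ha)
      zero_mem' := fun i a _ => zero_mem _
      smul_mem' := fun c f hf i a ha => by
        rw [CoindCarrier.base_smul_apply]
        exact Submodule.smul_mem _ c (hf i a ha) }
  isInternal := by
    -- The projections are the homogeneous parts of linear maps out of `A`, regarded as a graded
    -- `S`-module; this uses that `S` is spanned by homogeneous elements.
    refine isInternal_of_proj _ (fun d =>
      { toFun := fun f => degPart (M := (reg 𝒜).res S) (N := M) (iSup_subGrading 𝒜 S hS) f d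
        map_add' := fun f g => ?_
        map_smul' := fun c f => ?_ }) ?_ ?_ ?_ ?_
    · refine CoindCarrier.ext fun a => ?_
      refine (degPartAux_apply (M := (reg 𝒜).res S) _ d a).trans ?_
      refine Eq.trans ?_ (congrArg₂ (· + ·)
        (degPartAux_apply (M := (reg 𝒜).res S) (LinearMap.toAddMonoidHom f) d a)
        (degPartAux_apply (M := (reg 𝒜).res S) (LinearMap.toAddMonoidHom g) d a)).symm
      rw [← Finset.sum_add_distrib]
      exact Finset.sum_congr rfl fun i _ => map_add (M.proj (i + d)) _ _
    · refine CoindCarrier.ext fun a => ?_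
      refine (degPartAux_apply (M := (reg 𝒜).res S) _ d a).trans ?_
      refine Eq.trans ?_ (CoindCarrier.base_smul_apply c _ a).symm
      refine Eq.trans ?_ (congrArg (c • ·)
        (degPartAux_apply (M := (reg 𝒜).res S) (LinearMap.toAddMonoidHom f) d a)).symm
      rw [Finset.smul_sum]
      refine Finset.sum_congr rfl fun i _ => ?_
      rw [← LinearMap.map_smul]
      exact congrArg (M.proj (i + d)) (CoindCarrier.base_smul_apply c f _)
    · intro d f i a ha
      exact degPart_mem (M := (reg 𝒜).res S) (iSup_subGrading 𝒜 S hS) _ d ha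
    · intro d f hf
      exact degPart_eq_self (M := (reg 𝒜).res S) (iSup_subGrading 𝒜 S hS) _ d hf
    · intro d d' hd f hf
      exact degPart_eq_zero (M := (reg 𝒜).res S) (iSup_subGrading 𝒜 S hS) _ hd hf
    · intro f
      exact ⟨homDegs ((reg 𝒜).res S) M, sum_degPart (M := (reg 𝒜).res S) (iSup_subGrading 𝒜 S hS) _⟩
  smul_mem i j a f ha hf l b hb := by
    rw [← add_assoc]
    exact hf (l + i) (b * a) (SetLike.mul_mem_graded hb ha)

section

variable (hS : DirectSum.SetLike.IsHomogeneous 𝒜 S) {M N : GrMod (subGrading 𝒜 S)}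

/-- The value of an element of the coinduced module. -/
def coindApp (f : coind hS M) (a : A) : M := (show CoindCarrier M from f) a

lemma coind_ext {f g : coind hS M} (h : ∀ a, coindApp hS f a = coindApp hS g a) : f = g :=
  CoindCarrier.ext h

@[simp] lemma coindApp_smul (a : A) (f : coind hS M) (b : A) :
    coindApp hS (a • f) b = coindApp hS f (b * a) := rfl

@[simp] lemma coindApp_zero (b : A) : coindApp hS (0 : coind hS M) b = 0 := rfl

lemma coindApp_map_zero (f : coind hS M) : coindApp hS f 0 = 0 :=
  map_zero (show CoindCarrier M from f)

lemma coindApp_map_add (f : coind hS M) (a b : A) :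
    coindApp hS f (a + b) = coindApp hS f a + coindApp hS f b :=
  map_add (show CoindCarrier M from f) a b

lemma coindApp_map_sum (f : coind hS M) {ι : Type*} (s : Finset ι) (a : ι → A) :
    coindApp hS f (∑ i ∈ s, a i) = ∑ i ∈ s, coindApp hS f (a i) :=
  map_sum (show CoindCarrier M from f) a s

lemma coindApp_map_mul (f : coind hS M) (s : S) (a : A) :
    coindApp hS f (s * a) = s • coindApp hS f a :=
  CoindCarrier.map_smul f s a

/-- Evaluation at `1`. -/
noncomputable def coindEv (M : GrMod (subGrading 𝒜 S)) : (coind hS M).res S ⟶ M where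
  lin :=
    { toFun := fun f => coindApp hS f 1
      map_add' := fun _ _ => rfl
      map_smul' := fun s f =>
        (congrArg (coindApp hS (M := M) f) ((one_mul (s : A)).trans (mul_one (s : A)).symm)).trans
          (coindApp_map_mul hS f s 1) }
  map_deg i f hf := by
    have := hf 0 1 SetLike.GradedOne.one_mem
    rwa [zero_add] at this

lemma coindEv_lin (f : coind hS M) : (coindEv hS M).lin f = coindApp hS f 1 := rfl

/-- The adjoint of a map of `S`-modules. -/
noncomputable def coindLift {X : GrMod 𝒜} (φ : X.res S ⟶ M) : X ⟶ coind hS M where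
  lin :=
    { toFun := fun x => show CoindCarrier M from
        { toFun := fun a => φ.lin (a • x : X)
          map_add' := fun a b =>
            (congrArg φ.lin (add_smul a b x)).trans (φ.lin.map_add (a • x : X) (b • x : X))
          map_smul' := fun s a =>
            (congrArg φ.lin (mul_smul (s : A) a x)).trans (φ.lin.map_smul s (a • x : X)) }
      map_add' := fun x y => CoindCarrier.ext fun a =>
        (congrArg φ.lin (smul_add a x y)).trans (φ.lin.map_add (a • x : X) (a • y : X))
      map_smul' := fun b x => CoindCarrier.ext fun a =>
        congrArg φ.lin (mul_smul a b x).symm }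
  map_deg _ _ hx _ _ ha := φ.map_deg _ _ (X.smul_mem _ _ _ _ ha hx)

lemma coind_hom_apply {X : GrMod 𝒜} (g : X ⟶ coind hS M) (x : X) (a : A) :
    coindApp hS (g.lin x) a = (coindEv hS M).lin (g.lin (a • x : X)) := by
  rw [map_smul, coindEv_lin, coindApp_smul, one_mul]

/-- The value of `g x` at `a` is the value of `g (a • x)` at `1`. This is the uniqueness half of the
adjunction between restriction and coinduction. -/
lemma coind_hom_ext {X : GrMod 𝒜} {g h : X ⟶ coind hS M}
    (e : resMap S g ≫ coindEv hS M = resMap S h ≫ coindEv hS M) : g = h := by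
  ext x
  refine coind_ext hS fun a => ?_
  rw [coind_hom_apply, coind_hom_apply]
  exact lin_congr e _

lemma resMap_coindLift {X : GrMod 𝒜} (φ : X.res S ⟶ M) :
    resMap S (coindLift hS φ) ≫ coindEv hS M = φ := by
  ext x
  exact congrArg φ.lin (one_smul A (show X from x))

lemma comp_coindLift {X Y : GrMod 𝒜} (f : Y ⟶ X) (φ : X.res S ⟶ M) :
    f ≫ coindLift hS φ = coindLift hS (resMap S f ≫ φ) := by
  refine coind_hom_ext hS ?_
  rw [resMap_comp, Category.assoc, resMap_coindLift, resMap_coindLift]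

/-- The coinduction of an injective module is injective. -/
lemma injective_coind (hM : Injective M) : Injective (coind hS M) := by
  rw [injective_iff_exists_extension] at hM ⊢
  intro X Y f hf g
  -- Coinduction is right adjoint to restriction, which preserves injective maps: the extension is
  -- found for the adjoint map over `S`.
  obtain ⟨h, hh⟩ := hM _ _ (resMap S f) hf (resMap S g ≫ coindEv hS M)
  refine ⟨coindLift hS h, lin_congr (f := f ≫ coindLift hS h) (coind_hom_ext hS ?_)⟩
  rw [comp_coindLift, resMap_coindLift]
  ext x
  exact hh x

/-- The unit of the adjunction of restriction and coinduction. -/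
noncomputable def coindUnit (X : GrMod 𝒜) : X ⟶ coind hS (X.res S) := coindLift hS (𝟙 _)

lemma coindUnit_apply (X : GrMod 𝒜) (x : X) (a : A) : coindApp hS ((coindUnit hS X).lin x) a = a • x := rfl

lemma coindUnit_injective (X : GrMod 𝒜) : Function.Injective (coindUnit hS X).lin := fun x y h => by
  have h1 := congrArg (fun f : coind hS (X.res S) => coindApp hS f 1) h
  rw [← one_smul A x, ← one_smul A y]
  exact h1

instance (X : GrMod 𝒜) : Mono (coindUnit hS X) :=
  mono_of_injective _ (coindUnit_injective hS X)

end

end Coind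

end GrMod

end SemiInf

/-! ### Coinduction along one half of a triangular decomposition. -/

namespace SemiInf

open GrMod TensorProduct

variable {k A : Type u} [Field k] [Ring A] [Algebra k A]

/-- One half of a triangular decomposition: `A = S ⊗_R T` for graded subalgebras `S` and `T` with
the common degree 0 component `R`, which is semisimple. -/
structure IsHalfTriangular (𝒜 : ℤ → Submodule k A) [GradedAlgebra 𝒜] (R S T : Subalgebra k A) :
    Prop where
  homS : DirectSum.SetLike.IsHomogeneous 𝒜 S
  homT : DirectSum.SetLike.IsHomogeneous 𝒜 T
  leS : R ≤ S
  leT : R ≤ T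
  zeroT : Subalgebra.toSubmodule R = Subalgebra.toSubmodule T ⊓ 𝒜 0
  bij : Function.Bijective (balancedMul R S T leS leT)
  semisimple : IsSemisimpleRing R

section

variable {𝒜 : ℤ → Submodule k A} [GradedAlgebra 𝒜] {A0 Ale Age : Subalgebra k A}

lemma IsTriangular.half_le (h : IsTriangular 𝒜 A0 Ale Age) : IsHalfTriangular 𝒜 A0 Ale Age where
  homS := h.homogeneous_le
  homT := h.homogeneous_ge
  leS := h.zero_eq.le.trans inf_le_left
  leT := h.zero_eq.le.trans inf_le_right
  zeroT := h.zero_eq_ge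
  bij := h.mul_bijective'
  semisimple := h.semisimple

lemma IsTriangular.half_ge (h : IsTriangular 𝒜 A0 Ale Age) : IsHalfTriangular 𝒜 A0 Age Ale where
  homS := h.homogeneous_ge
  homT := h.homogeneous_le
  leS := h.zero_eq.le.trans inf_le_right
  leT := h.zero_eq.le.trans inf_le_left
  zeroT := h.zero_eq_le
  bij := h.mul_bijective
  semisimple := h.semisimple

end

variable {𝒜 : ℤ → Submodule k A} [GradedAlgebra 𝒜] {R S T : Subalgebra k A}

/-- The degree preserving part of any linear extension still extends `g`, because `f` and `g`
preserve degrees. Hence injectivity in the graded category can be tested with ungraded extensions.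
-/
lemma injective_of_exists_linear_extension (hS : DirectSum.SetLike.IsHomogeneous 𝒜 S)
    (Q : GrMod (subGrading 𝒜 S))
    (h : ∀ (X Y : GrMod (subGrading 𝒜 S)) (f : X ⟶ Y) (_ : Function.Injective f.lin) (g : X ⟶ Q),
      ∃ h : Y →ₗ[S] Q, ∀ x, h (f.lin x) = g.lin x) : Injective Q := by
  rw [injective_iff_exists_extension]
  intro X Y f hf g
  obtain ⟨h, hh⟩ := h X Y f hf g
  refine ⟨homOfLin (iSup_subGrading 𝒜 S hS) h,
    lin_congr (f := f ≫ homOfLin (iSup_subGrading 𝒜 S hS) h) (g := g) (hom_ext_deg ?_)⟩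
  intro i x hx
  rw [comp_lin, homOfLin_of_mem _ _ (f.map_deg i x hx), hh, Q.proj_of_mem (g.map_deg i x hx)]

lemma IsHalfTriangular.induction (h : IsHalfTriangular 𝒜 R S T) {p : A → Prop}
    (hadd : ∀ a b, p a → p b → p (a + b)) (hmul : ∀ (s : S) (t : T), p (s * t)) (a : A) : p a := by
  obtain ⟨q, rfl⟩ := h.bij.2 a
  obtain ⟨q, rfl⟩ := Submodule.mkQ_surjective _ q
  induction q using TensorProduct.induction_on with
  | zero => simpa using hmul 0 0
  | tmul s t => exact hmul s t
  | add a b ha hb =>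
    rw [map_add, map_add]
    exact hadd _ _ ha hb

/-- This is the surjectivity of `Hom_S(S ⊗_R T, M) → Hom_R(T, M)`: the formula `s ⊗ t ↦ s • φ t`
respects the balancing relations because `φ` is `R`-linear. -/
lemma IsHalfTriangular.exists_linear_extension (h : IsHalfTriangular 𝒜 R S T)
    {M : GrMod (subGrading 𝒜 S)} (φ : T →ₗ[k] M)
    (hφ : ∀ (r : R) (t : T), φ (Subalgebra.inclusion h.leT r * t) =
      Subalgebra.inclusion h.leS r • φ t) :
    ∃ F : A →ₗ[S] M, ∀ t : T, F t = φ t := by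
  let B : S →ₗ[k] T →ₗ[k] M := LinearMap.mk₂ k (fun s t => s • φ t)
    (fun s s' t => add_smul _ _ _) (fun c s t => smul_assoc _ _ _)
    (fun s t t' => by rw [map_add, smul_add])
    (fun c s t => by
      rw [map_smul, ← algebraMap_smul S c (φ t), ← algebraMap_smul S c (s • φ t), ← mul_smul,
        ← mul_smul, Algebra.commutes])
  let e := LinearEquiv.ofBijective _ h.bij
  let G : BalancedTensor R S T h.leS h.leT →ₗ[k] M :=
    (balancedRel R S T h.leS h.leT).liftQ (TensorProduct.lift B) (by
      rw [balancedRel, Submodule.span_le]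
      rintro _ ⟨p, a, q, rfl⟩
      simp [B, hφ, mul_smul])
  have key : ∀ (s : S) (t : T), G (e.symm (s * t)) = s • φ t := fun s t => by
    have : e.symm (s * t) = Submodule.Quotient.mk (s ⊗ₜ[k] t) := by
      rw [LinearEquiv.symm_apply_eq]
      rfl
    rw [this]
    rfl
  refine ⟨{ toFun := fun a => G (e.symm a), map_add' := by simp, map_smul' := fun s a => ?_ },
    fun t => ?_⟩
  · rw [RingHom.id_apply]
    induction a using h.induction with
    | hadd a b ha hb => rw [smul_add, map_add, map_add, ha, hb, map_add, map_add, smul_add]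
    | hmul s' t =>
      have : s • ((s' : A) * (t : A)) = ((s * s' : S) : A) * t := (mul_assoc (s : A) s' t).symm
      rw [this, key, key, mul_smul]
  · have := key 1 t
    rw [one_smul] at this
    rw [← this]
    exact congrArg (fun a => G (e.symm a)) (one_mul (t : A)).symm

variable [FiniteDimensional k A]

lemma IsHalfTriangular.coind_ext (h : IsHalfTriangular 𝒜 R S T) {M : GrMod (subGrading 𝒜 S)}
    {f g : coind h.homS M} (e : ∀ t : T, coindApp _ f t = coindApp _ g t) : f = g := by
  refine GrMod.coind_ext _ fun a => ?_
  induction a using h.induction with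
  | hadd a b ha hb => rw [coindApp_map_add, coindApp_map_add, ha, hb]
  | hmul s t => rw [coindApp_map_mul, coindApp_map_mul, e]

/-- Over `T`, the module `Hom_S(A, M)` becomes `Hom_R(T, M)`, which is coinduced from the semisimple
algebra `R`, where every module is injective. So a `T`-linear map to it is encoded by an `R`-linear
map to `M` (evaluate at `1`), which can be extended and decoded again. -/
lemma IsHalfTriangular.isInjectiveOver_coind (h : IsHalfTriangular 𝒜 R S T)
    (M : GrMod (subGrading 𝒜 S)) : (coind h.homS M).IsInjectiveOver T := by
  refine injective_of_exists_linear_extension h.homT _ fun X Y f hf g => ?_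
  have := h.semisimple
  have hg : ∀ (t : T) (x : X), coindApp h.homS (g.lin (t • x)) 1 =
      coindApp h.homS (g.lin x) t := fun t x => by
    rw [map_smul]
    exact congrArg (coindApp h.homS (g.lin x)) (one_mul (t : A))
  -- `R` acts on the `T`-modules `X` and `Y` through `T`, but on the `S`-module `M` through `S`.
  let : Module R X := Module.compHom X (Subalgebra.inclusion h.leT).toRingHom
  let : Module R Y := Module.compHom Y (Subalgebra.inclusion h.leT).toRingHom
  let : Module R M := Module.compHom M (Subalgebra.inclusion h.leS).toRingHom
  have : Module.Injective R M := Module.injective_of_isSemisimpleRing _ _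
  let f' : X →ₗ[R] Y :=
    { toFun := f.lin, map_add' := map_add _, map_smul' := fun r x => map_smul f.lin _ x }
  let g' : X →ₗ[R] M :=
    { toFun := fun x => coindApp h.homS (g.lin x) 1
      map_add' := fun x y => by rw [map_add]; rfl
      map_smul' := fun r x => by
        refine (hg _ x).trans ((congrArg (coindApp h.homS (g.lin x)) (mul_one (r : A)).symm).trans ?_)
        exact coindApp_map_mul h.homS (g.lin x) (Subalgebra.inclusion h.leS r) 1 }
  obtain ⟨ψ, hψ⟩ := Module.Injective.out f' hf g'
  have hψr : ∀ (r : R) (y : Y), ψ (Subalgebra.inclusion h.leT r • y) =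
    Subalgebra.inclusion h.leS r • ψ y := fun r y => ψ.map_smul r y
  have hψk : ∀ (c : k) (y : Y), ψ (c • y) = c • ψ y := fun c y => by
    rw [← algebraMap_smul T c, ← algebraMap_smul S c]
    exact hψr (algebraMap k R c) y
  -- Decoding: the extended map sends `y` to the `S`-linear extension to `A` of `t ↦ ψ (t • y)`.
  have hex : ∀ y : Y, ∃ F : coind h.homS M, ∀ t : T, coindApp _ F t = ψ (t • y) := fun y =>
    h.exists_linear_extension
      { toFun := fun t => ψ (t • y)
        map_add' := fun t t' => by rw [add_smul, map_add]
        map_smul' := fun c t => by rw [smul_assoc, hψk]; rfl }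
      fun r t => by
        change ψ ((_ * t) • y) = _ • ψ (t • y)
        rw [mul_smul, hψr]
  choose F hF using hex
  refine ⟨{ toFun := F, map_add' := fun x y => ?_, map_smul' := fun t y => ?_ }, fun x => ?_⟩
  · refine h.coind_ext fun t => ?_
    refine (hF _ _).trans ?_
    refine Eq.trans ?_ (congrArg₂ (· + ·) (hF x t) (hF y t)).symm
    rw [smul_add, map_add]
  · refine h.coind_ext fun t' => ?_
    refine (hF _ _).trans ?_
    refine Eq.trans ?_ (hF _ (t' * t)).symm
    rw [mul_smul]
  · refine h.coind_ext fun t => ?_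
    refine (hF _ _).trans ?_
    rw [← map_smul]
    exact (hψ _).trans (hg t x)

end SemiInf

/-! ### Weight bounds and the weights of coinduced modules. -/

namespace SemiInf

namespace GrMod

section Weights

variable {k A : Type u} [Field k] [Ring A] [Algebra k A] {𝒜 : ℤ → Submodule k A}

/-- All weights of the module are at most `d`. -/
def WtLE (M : GrMod 𝒜) (d : ℤ) : Prop := ∀ i, d < i → M.deg i = ⊥

/-- All weights of the module are at least `d`. -/
def WtGE (M : GrMod 𝒜) (d : ℤ) : Prop := ∀ i, i < d → M.deg i = ⊥

lemma deg_eq_bot_of_injective {M N : GrMod 𝒜} (f : M ⟶ N) (hf : Function.Injective f.lin) {i : ℤ}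
    (h : N.deg i = ⊥) : M.deg i = ⊥ := by
  rw [eq_bot_iff]
  intro x hx
  have := f.map_deg i x hx
  rw [h, Submodule.mem_bot] at this
  exact hf (this.trans (map_zero _).symm)

lemma deg_eq_bot_iff_of_iso {M N : GrMod 𝒜} (e : M ≅ N) {i : ℤ} : M.deg i = ⊥ ↔ N.deg i = ⊥ :=
  ⟨deg_eq_bot_of_injective e.inv (injective_of_mono _),
    deg_eq_bot_of_injective e.hom (injective_of_mono _)⟩

lemma exists_wtLE (M : GrMod 𝒜) : ∃ d, M.WtLE d := by
  obtain ⟨d, hd⟩ := M.wts.bddAbove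
  exact ⟨d, fun i hi => by_contra fun h => absurd (hd (mem_wts.2 h)) (not_le.2 hi)⟩

lemma exists_wtGE (M : GrMod 𝒜) : ∃ d, M.WtGE d := by
  obtain ⟨d, hd⟩ := M.wts.bddBelow
  exact ⟨d, fun i hi => by_contra fun h => absurd (hd (mem_wts.2 h)) (not_le.2 hi)⟩

lemma isZero_of_deg_eq_bot (M : GrMod 𝒜) (h : ∀ i, M.deg i = ⊥) : IsZero M := by
  rw [IsZero.iff_id_eq_zero]
  refine hom_ext_deg fun i x hx => ?_
  rw [h i, Submodule.mem_bot] at hx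
  rw [hx, map_zero, map_zero]

lemma deg_eq_bot_of_isZero {M : GrMod 𝒜} (h : IsZero M) (i : ℤ) : M.deg i = ⊥ := by
  rw [eq_bot_iff]
  intro x _
  exact lin_congr ((IsZero.iff_id_eq_zero _).1 h) x

lemma hom_eq_zero_of_deg {M N : GrMod 𝒜} (h : ∀ i, M.deg i = ⊥ ∨ N.deg i = ⊥) (f : M ⟶ N) :
    f = 0 := by
  refine hom_ext_deg fun i x hx => ?_
  rcases h i with h | h
  · rw [h, Submodule.mem_bot] at hx
    rw [hx, map_zero, map_zero]
  · have := f.map_deg i x hx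
    rwa [h, Submodule.mem_bot] at this

end Weights

section Sub

variable {k A : Type u} [Field k] [Ring A] [Algebra k A] {𝒜 : ℤ → Submodule k A}

/-- The graded module on a homogeneous submodule. -/
noncomputable def sub (M : GrMod 𝒜) (N : Submodule A M) (hN : ∀ i, ∀ x ∈ N, M.proj i x ∈ N) :
    GrMod 𝒜 where
  carrier := N
  finite := Module.Finite.of_injective (N.subtype.restrictScalars k) Subtype.val_injective
  deg i := (M.deg i).comap (N.subtype.restrictScalars k)
  isInternal := by
    refine isInternal_of_proj _ (fun i =>
      { toFun := fun x => ⟨M.proj i x.1, hN i x.1 x.2⟩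
        map_add' := fun x y => Subtype.ext (map_add (M.proj i) x.1 y.1)
        map_smul' := fun c x => Subtype.ext (map_smul (M.proj i) c x.1) })
        (fun i x => M.proj_mem i x.1) (fun i x hx => Subtype.ext (M.proj_of_mem hx))
        (fun i j hij x hx => Subtype.ext (M.proj_of_mem_ne hij hx))
        fun x => ⟨M.wts, Subtype.ext ?_⟩
    rw [AddSubmonoidClass.coe_finsetSum]
    exact M.sum_proj x.1
  smul_mem i j a m ha hm := M.smul_mem i j a m.1 ha hm

/-- The inclusion of a homogeneous submodule. -/
noncomputable def subι (M : GrMod 𝒜) (N : Submodule A M) (hN : ∀ i, ∀ x ∈ N, M.proj i x ∈ N) :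
    sub M N hN ⟶ M := ⟨N.subtype, fun _ _ h => h⟩

end Sub

section CoindWeights

variable {k A : Type u} [Field k] [Ring A] [Algebra k A] {𝒜 : ℤ → Submodule k A}
  [GradedAlgebra 𝒜] [FiniteDimensional k A] {R S T : Subalgebra k A}

lemma _root_.SemiInf.IsHalfTriangular.coind_ext_homogeneous (h : IsHalfTriangular 𝒜 R S T)
    {M : GrMod (subGrading 𝒜 S)} {f g : coind h.homS M}
    (e : ∀ j, ∀ t ∈ T, t ∈ 𝒜 j → coindApp _ f t = coindApp _ g t) : f = g := by
  classical
  refine h.coind_ext fun t => ?_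
  rw [← DirectSum.sum_support_decompose 𝒜 (t : A), coindApp_map_sum, coindApp_map_sum]
  exact Finset.sum_congr rfl fun i _ => e i _ (h.homT i t.2) (DirectSum.decompose 𝒜 (t : A) i).2

lemma _root_.SemiInf.IsHalfTriangular.exists_of_ne_zero (h : IsHalfTriangular 𝒜 R S T)
    {M : GrMod (subGrading 𝒜 S)} {f : coind h.homS M} (hf : f ≠ 0) :
    ∃ j, ∃ t ∈ T, t ∈ 𝒜 j ∧ coindApp _ f t ≠ 0 := by
  by_contra! H
  exact hf (h.coind_ext_homogeneous fun j t ht htj => H j t ht htj)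

/-- The weights of a coinduced module. -/
lemma _root_.SemiInf.IsHalfTriangular.exists_weight (h : IsHalfTriangular 𝒜 R S T)
    {M : GrMod (subGrading 𝒜 S)} {e : ℤ} (he : (coind h.homS M).deg e ≠ ⊥) :
    ∃ j, Subalgebra.toSubmodule T ⊓ 𝒜 j ≠ ⊥ ∧ M.deg (j + e) ≠ ⊥ := by
  obtain ⟨f, hf, hf0⟩ := Submodule.exists_mem_ne_zero_of_ne_bot he
  obtain ⟨j, t, htT, htj, ht⟩ := h.exists_of_ne_zero hf0
  refine ⟨j, fun h0 => ht ?_, fun h0 => ht ?_⟩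
  · have : t ∈ Subalgebra.toSubmodule T ⊓ 𝒜 j := ⟨htT, htj⟩
    rw [h0, Submodule.mem_bot] at this
    rw [this, coindApp_map_zero]
  · have := hf j t htj
    rwa [h0, Submodule.mem_bot] at this

/-- The degree 0 part of `T` is `R`, which lies in `S`, so there `f` is determined by `f 1` by
`S`-linearity; on the other components of `T` both sides take values in zero weight spaces. The case
of interest is an extreme weight `e` of `X`: the unit is then surjective in degree `e`. -/
lemma _root_.SemiInf.IsHalfTriangular.coindUnit_of_top (h : IsHalfTriangular 𝒜 R S T)
    {X : GrMod 𝒜} {e : ℤ}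
    (he : ∀ j, j ≠ 0 → Subalgebra.toSubmodule T ⊓ 𝒜 j ≠ ⊥ → X.deg (j + e) = ⊥)
    {f : coind h.homS (X.res S)} (hf : f ∈ (coind h.homS (X.res S)).deg e) :
    (coindUnit h.homS X).lin (show X from coindApp _ f 1) = f := by
  have h1 : (show X from coindApp h.homS f 1) ∈ X.deg e := by
    have := hf 0 1 SetLike.GradedOne.one_mem
    rwa [zero_add] at this
  refine h.coind_ext_homogeneous fun j t htT htj => ?_
  rw [coindUnit_apply]
  by_cases hj : j = 0
  · subst hj
    have htR : t ∈ Subalgebra.toSubmodule R := by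
      rw [h.zeroT]
      exact ⟨htT, htj⟩
    refine (coindApp_map_mul h.homS f (⟨t, h.leS htR⟩ : S) 1).symm.trans ?_
    exact congrArg (coindApp h.homS f) (mul_one t)
  · by_cases hT : Subalgebra.toSubmodule T ⊓ 𝒜 j = ⊥
    · have : t ∈ Subalgebra.toSubmodule T ⊓ 𝒜 j := ⟨htT, htj⟩
      rw [hT, Submodule.mem_bot] at this
      rw [this, coindApp_map_zero, zero_smul]
      rfl
    · have h2 := X.smul_mem _ _ _ _ htj h1
      have h3 : (show X from coindApp h.homS f t) ∈ X.deg (j + e) := hf j t htj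
      rw [he j hj hT, Submodule.mem_bot] at h2 h3
      exact h2.trans h3.symm

/-- `E` embeds by the unit in the module coinduced from `S`, which is `T`-injective, and splits off.
-/
lemma _root_.SemiInf.IsHalfTriangular.isInjectiveOver_of_injective (h : IsHalfTriangular 𝒜 R S T)
    {E : GrMod 𝒜} (hE : Injective E) : E.IsInjectiveOver T :=
  isInjectiveOver_of_injective_of_mono hE (h.isInjectiveOver_coind (E.res S)) (coindUnit h.homS E)

end CoindWeights

end GrMod

open GrMod

section Triangular

variable {k A : Type u} [Field k] [Ring A] [Algebra k A] {𝒜 : ℤ → Submodule k A}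
  [GradedAlgebra 𝒜] {A0 Ale Age : Subalgebra k A}

/-- An injective module that contains `M`. -/
noncomputable def IsTriangular.injHull (h : IsTriangular 𝒜 A0 Ale Age) [FiniteDimensional k A]
    (M : GrMod 𝒜) : GrMod 𝒜 :=
  coind h.half_ge.homS ((coind h.half_le.homS (M.res Ale)).res Age)

variable (h : IsTriangular 𝒜 A0 Ale Age) [FiniteDimensional k A]

/-- The first coinduction, from `A^{≤0}`, makes the module `A^{≥0}`-injective; the second one, from
`A^{≥0}`, turns this into injectivity over `A`. -/
lemma IsTriangular.injective_injHull (M : GrMod 𝒜) : Injective (h.injHull M) :=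
  injective_coind _ (h.half_le.isInjectiveOver_coind (M.res Ale))

/-- The embedding of a module in an injective module. -/
noncomputable def IsTriangular.injHullι (M : GrMod 𝒜) : M ⟶ h.injHull M :=
  coindUnit _ M ≫ coindUnit _ _

instance (M : GrMod 𝒜) : Mono (h.injHullι M) := by
  exact mono_of_injective _ ((coindUnit_injective _ _).comp (coindUnit_injective _ M))

/-- An element of weight `i` maps the degree `j` part of `A^{≥0}` to weight `j + i`, and only `j ≥
0` occurs. -/
lemma coind_wtLE (h : IsTriangular 𝒜 A0 Ale Age) {M : GrMod (subGrading 𝒜 Ale)} {d : ℤ}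
    (hM : M.WtLE d) : (coind h.half_le.homS M).WtLE d := fun i hi => by
  by_contra H
  obtain ⟨j, hj, hj'⟩ := h.half_le.exists_weight H
  have : 0 ≤ j := by
    by_contra hj0
    exact hj (h.ge_graded j (by omega))
  exact hj' (hM _ (by omega))

lemma coind_wtGE (h : IsTriangular 𝒜 A0 Ale Age) {M : GrMod (subGrading 𝒜 Age)} {d : ℤ}
    (hM : M.WtGE d) : (coind h.half_ge.homS M).WtGE d := fun i hi => by
  by_contra H
  obtain ⟨j, hj, hj'⟩ := h.half_ge.exists_weight H
  have : j ≤ 0 := by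
    by_contra hj0
    exact hj (h.le_graded j (by omega))
  exact hj' (hM _ (by omega))

/-- The unit is onto in the weights `≥ d`, because `A^{≥0}` has no negative degrees and `X` no
weights above `d`. This loss of the top weight is what makes the resolutions convex. -/
lemma quot_coind_wtLE (h : IsTriangular 𝒜 A0 Ale Age) {X Q : GrMod 𝒜} {d : ℤ} (hX : X.WtLE d)
    (q : coind h.half_le.homS (X.res Ale) ⟶ Q) (hq : Function.Surjective q.lin)
    (hq0 : coindUnit _ X ≫ q = 0) : Q.WtLE (d - 1) := fun i hi => by
  rw [eq_bot_iff]
  intro y hy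
  obtain ⟨f, hf, rfl⟩ := exists_mem_deg_of_surjective q hq hy
  rw [Submodule.mem_bot, ← h.half_le.coindUnit_of_top (fun j hj0 hj => hX _ ?_) hf]
  · exact lin_congr hq0 _
  · have : 0 ≤ j := by
      by_contra hj0
      exact hj (h.ge_graded j (by omega))
    omega

lemma quot_coind_wtGE (h : IsTriangular 𝒜 A0 Ale Age) {X Q : GrMod 𝒜} {d : ℤ} (hX : X.WtGE d)
    (q : coind h.half_ge.homS (X.res Age) ⟶ Q) (hq : Function.Surjective q.lin)
    (hq0 : coindUnit _ X ≫ q = 0) : Q.WtGE (d + 1) := fun i hi => by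
  rw [eq_bot_iff]
  intro y hy
  obtain ⟨f, hf, rfl⟩ := exists_mem_deg_of_surjective q hq hy
  rw [Submodule.mem_bot, ← h.half_ge.coindUnit_of_top (fun j hj0 hj => hX _ ?_) hf]
  · exact lin_congr hq0 _
  · have : j ≤ 0 := by
      by_contra hj0
      exact hj (h.le_graded j (by omega))
    omega

end Triangular

end SemiInf

/-! ### Relative injectivity and lifting. -/

namespace SemiInf

open GrMod

section Lift

variable {k A : Type u} [Field k] [Ring A] [Algebra k A] {𝒜 : ℤ → Submodule k A}
  {S : Subalgebra k A}

/-- A module `I` such that maps to `I` extend along `S`-split inclusions. -/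
def RelInjective (S : Subalgebra k A) (I : GrMod 𝒜) : Prop :=
  ∀ ⦃X Y : GrMod 𝒜⦄ (v : X ⟶ Y) (ρ : Y.res S ⟶ X.res S) (_ : resMap S v ≫ ρ = 𝟙 _) (φ : X ⟶ I),
    ∃ ψ : Y ⟶ I, v ≫ ψ = φ

/-- By adjunction the extension problem moves to `S`, where it is solved by composing with the
retraction `ρ`. -/
lemma relInjective_coind [GradedAlgebra 𝒜] [FiniteDimensional k A]
    (hS : DirectSum.SetLike.IsHomogeneous 𝒜 S) (M : GrMod (subGrading 𝒜 S)) :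
    RelInjective S (coind hS M) := fun X Y v ρ hρ φ => by
  refine ⟨coindLift hS (ρ ≫ resMap S φ ≫ coindEv hS M), coind_hom_ext hS ?_⟩
  rw [comp_coindLift, resMap_coindLift, reassoc_of% hρ]

/-- Pull the extension back along `g`. It becomes split over `S`, as `P` is `S`-projective, so
relative injectivity of the kernel term splits it over `A`. -/
lemma RelInjective.exists_lift {P : GrMod 𝒜} (hP : Projective (P.res S)) {C : ShortComplex (GrMod 𝒜)}
    (hC : C.ShortExact) (hI : RelInjective S C.X₁) (g : P ⟶ C.X₃) : ∃ g' : P ⟶ C.X₂, g' ≫ C.g = g := by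
  have := hC.mono_f
  have := hC.epi_g
  let fs : pullback C.g g ⟶ C.X₂ := pullback.fst C.g g
  let sn : pullback C.g g ⟶ P := pullback.snd C.g g
  have hw : fs ≫ C.g = sn ≫ g := pullback.condition
  have hsn : Epi sn := inferInstanceAs (Epi (pullback.snd C.g g))
  have : Epi (resMap S sn) := epi_of_surjective _ (surjective_of_epi sn)
  let s := Projective.factorThru (𝟙 _) (resMap S sn)
  have hs : s ≫ resMap S sn = 𝟙 _ := Projective.factorThru_comp _ _
  -- The idempotent complementary to the section `s`, as an `S`-linear retraction onto the kernel of
  -- `sn`.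
  let ρ : (pullback C.g g).res S ⟶ (ker sn).res S :=
    ⟨(𝟙 _ - resMap S sn ≫ s : (pullback C.g g).res S ⟶ _).lin.codRestrict
      ((LinearMap.ker sn.lin).restrictScalars S) fun x => by
        have : (𝟙 _ - resMap S sn ≫ s : (pullback C.g g).res S ⟶ _) ≫ resMap S sn = 0 := by
          rw [Preadditive.sub_comp, Category.assoc, hs, Category.comp_id, Category.id_comp, sub_self]
        exact lin_congr this x,
      fun i x hx => (𝟙 _ - resMap S sn ≫ s : (pullback C.g g).res S ⟶ _).map_deg i x hx⟩
  have hρ : resMap S (kerι sn) ≫ ρ = 𝟙 _ := by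
    ext x
    refine Subtype.ext ?_
    have : resMap S (kerι sn) ≫ (𝟙 _ - resMap S sn ≫ s) = resMap S (kerι sn) := by
      rw [Preadditive.comp_sub, ← Category.assoc, ← resMap_comp, kerι_comp, Category.comp_id,
        resMap_zero, zero_comp, sub_zero]
    exact lin_congr this x
  let c : ker sn ⟶ C.X₁ := hC.exact.lift (kerι sn ≫ fs) (by
    rw [Category.assoc, hw, ← Category.assoc, kerι_comp, zero_comp])
  have hc : c ≫ C.f = kerι sn ≫ fs := hC.exact.lift_f _ _
  obtain ⟨r, hr⟩ := hI (kerι sn) ρ hρ c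
  -- Correcting the projection `fs` by the extension `r` makes it vanish on the kernel of `sn`; it
  -- descends to `P`, and the descended map is the lift.
  have hd : kerι sn ≫ (fs - r ≫ C.f) = 0 := by
    rw [Preadditive.comp_sub, ← Category.assoc, hr, hc, sub_self]
  have hcol := Abelian.epiIsCokernelOfKernel _ (kerIsLimit sn)
  refine ⟨hcol.desc (CokernelCofork.ofπ _ hd), ?_⟩
  rw [← cancel_epi sn]
  have : sn ≫ hcol.desc (CokernelCofork.ofπ _ hd) = fs - r ≫ C.f :=
    hcol.fac (CokernelCofork.ofπ _ hd) WalkingParallelPair.one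
  rw [← Category.assoc, this, Preadditive.sub_comp, Category.assoc, C.zero, comp_zero, sub_zero, hw]

end Lift

/-! ### Peeling off the lowest weight of an `A^{≤0}`-injective module. -/

section Bottom

variable {k A : Type u} [Field k] [Ring A] [Algebra k A] {𝒜 : ℤ → Submodule k A}
  [GradedAlgebra 𝒜] {A0 Ale Age : Subalgebra k A} (h : IsTriangular 𝒜 A0 Ale Age)

lemma mem_sub_induction {S : Subalgebra k A} (hS : DirectSum.SetLike.IsHomogeneous 𝒜 S)
    {p : S → Prop} (hadd : ∀ a b, p a → p b → p (a + b)) (h0 : p 0)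
    (hmem : ∀ i, ∀ s ∈ subGrading 𝒜 S i, p s) (s : S) : p s := by
  have hs : s ∈ ⨆ i, subGrading 𝒜 S i := by
    rw [iSup_subGrading 𝒜 S hS]
    exact Submodule.mem_top
  induction hs using Submodule.iSup_induction' with
  | mem i s hs => exact hmem i s hs
  | zero => exact h0
  | add a b _ _ ha hb => exact hadd a b ha hb

include h

lemma IsTriangular.eq_zero_of_mem_ge {i : ℤ} (hi : i < 0) {s : Age}
    (hs : s ∈ subGrading 𝒜 Age i) : s = 0 := by
  have : (s : A) ∈ Subalgebra.toSubmodule Age ⊓ 𝒜 i := ⟨s.2, hs⟩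
  rw [h.ge_graded i hi, Submodule.mem_bot] at this
  exact Subtype.ext this

lemma IsTriangular.eq_zero_of_mem_le {i : ℤ} (hi : 0 < i) {s : Ale}
    (hs : s ∈ subGrading 𝒜 Ale i) : s = 0 := by
  have : (s : A) ∈ Subalgebra.toSubmodule Ale ⊓ 𝒜 i := ⟨s.2, hs⟩
  rw [h.le_graded i hi, Submodule.mem_bot] at this
  exact Subtype.ext this

/-- In a module with weights `≥ c`, the sum of the weight spaces of degree `> c` is stable under
the nonnegative part of the algebra. -/
def IsTriangular.aboveBottom {X : GrMod (subGrading 𝒜 Age)} {c : ℤ} (hX : X.WtGE c) :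
    Submodule Age X where
  carrier := {x | X.proj c x = 0}
  add_mem' := fun {a b} ha hb => by
    rw [Set.mem_ofPred_eq] at *
    rw [map_add, ha, hb, add_zero]
  zero_mem' := map_zero _
  smul_mem' := fun s x hx => by
    rw [Set.mem_ofPred_eq] at *
    induction s using mem_sub_induction (𝒜 := 𝒜) h.homogeneous_ge with
    | hadd a b ha hb => rw [add_smul, map_add, ha, hb, add_zero]
    | h0 => rw [zero_smul, map_zero]
    | hmem i s hs =>
      have := X.proj_smul hs (c - i) x
      rw [add_sub_cancel] at this
      rw [this]
      by_cases hi : i < 0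
      · rw [h.eq_zero_of_mem_ge hi hs, zero_smul]
      · by_cases hi' : i = 0
        · rw [hi', sub_zero, hx, smul_zero]
        · have h1 := X.proj_mem (c - i) x
          rw [hX _ (by omega), Submodule.mem_bot] at h1
          rw [h1, smul_zero]

/-- In a module with weights `≥ c`, the weight space of degree `c` is stable under the nonpositive
part of the algebra. -/
def IsTriangular.bottom {X : GrMod (subGrading 𝒜 Ale)} {c : ℤ} (hX : X.WtGE c) :
    Submodule Ale X where
  carrier := {x | x ∈ X.deg c}
  add_mem' := (X.deg c).add_mem
  zero_mem' := (X.deg c).zero_mem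
  smul_mem' := fun s x hx => by
    rw [Set.mem_ofPred_eq] at *
    induction s using mem_sub_induction (𝒜 := 𝒜) h.homogeneous_le with
    | hadd a b ha hb =>
      rw [add_smul]
      exact add_mem ha hb
    | h0 =>
      rw [zero_smul]
      exact zero_mem _
    | hmem i s hs =>
      have h1 := X.smul_mem _ _ _ _ hs hx
      by_cases hi : 0 < i
      · rw [h.eq_zero_of_mem_le hi hs, zero_smul]
        exact zero_mem _
      · by_cases hi' : i = 0
        · rwa [hi', zero_add] at h1
        · rw [hX _ (by omega), Submodule.mem_bot] at h1
          rw [h1]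
          exact zero_mem _

variable [FiniteDimensional k A]

/-- An `A^{≤0}`-injective module with weights `≥ c` maps onto a coinduced module, with an
`A^{≤0}`-injective kernel that has weights `> c`. -/
lemma IsTriangular.exists_coind_quotient {I : GrMod 𝒜} (hI : I.IsInjectiveOver Ale) {c : ℤ}
    (hc : I.WtGE c) : ∃ (M : GrMod (subGrading 𝒜 Age)) (q : I ⟶ coind h.homogeneous_ge M),
      Epi q ∧ (ker q).IsInjectiveOver Ale ∧ (ker q).WtGE (c + 1) := by
  -- The lowest weight space is a quotient of `I` over `A^{≥0}` (called `M` below) and a submodule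
  -- over `A^{≤0}` (called `B` below). The quotient gives the map `q` by adjunction; the submodule
  -- will give an `A^{≤0}`-linear splitting.
  let N := h.aboveBottom (X := I.res Age) hc
  have hN : ∀ i, ∀ x ∈ N, (I.res Age).proj i x ∈ N := fun i x hx => by
    change (I.res Age).proj c ((I.res Age).proj i x) = 0
    by_cases hi : c = i
    · subst hi
      rw [show (I.res Age).proj c x = 0 from hx, map_zero]
    · exact proj_proj_ne _ hi x
  let M := coker (subι (I.res Age) N hN)
  let π : I.res Age ⟶ M := cokerπ (subι (I.res Age) N hN)
  have hπ0 : ∀ x : I, π.lin x = 0 ↔ (I.res Age).proj c x = 0 := fun x => by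
    refine (Submodule.Quotient.mk_eq_zero _).trans ⟨?_, fun hx => ⟨⟨x, hx⟩, rfl⟩⟩
    rintro ⟨y, rfl⟩
    exact y.2
  have hMc : ∀ i, i ≠ c → M.deg i = ⊥ := fun i hi => by
    rw [eq_bot_iff]
    rintro _ ⟨x, hx, rfl⟩
    exact (hπ0 x).2 ((I.res Age).proj_of_mem_ne (Ne.symm hi) hx)
  let q : I ⟶ coind h.homogeneous_ge M := coindLift h.homogeneous_ge π
  have hq1 : ∀ x : I, coindApp h.homogeneous_ge (q.lin x) 1 = π.lin x := fun x =>
    congrArg π.lin (one_smul A x)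
  have hCc : (coind h.homogeneous_ge M).WtGE c :=
    coind_wtGE h fun i hi => hMc i (by omega)
  -- the map is injective in degree `c`
  have hqc : ∀ x ∈ I.deg c, q.lin x = 0 → x = 0 := fun x hx h0 => by
    have h1 := hq1 x
    rw [h0, coindApp_zero] at h1
    rw [← (I.res Age).proj_of_mem hx]
    exact (hπ0 x).1 h1.symm
  -- and surjective in degree `c`
  have hqs : ∀ f ∈ (coind h.homogeneous_ge M).deg c, ∃ x ∈ I.deg c, q.lin x = f := fun f hf => by
    have hf1 : coindApp h.homogeneous_ge f 1 ∈ M.deg c := by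
      have := hf 0 1 SetLike.GradedOne.one_mem
      rwa [zero_add] at this
    obtain ⟨x, hx, hxf⟩ := hf1
    refine ⟨x, hx, h.half_ge.coind_ext_homogeneous fun j t ht htj => ?_⟩
    by_cases hj : j = 0
    · subst hj
      have htR : t ∈ Subalgebra.toSubmodule A0 := by
        rw [h.zero_eq_le]
        exact ⟨ht, htj⟩
      have htS : t ∈ Age := h.half_ge.leS htR
      have key : ∀ g : coind h.homogeneous_ge M, coindApp h.homogeneous_ge g t =
          (⟨t, htS⟩ : Age) • coindApp h.homogeneous_ge g 1 := fun g => by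
        rw [← coindApp_map_mul]
        exact congrArg (coindApp h.homogeneous_ge g) (mul_one t).symm
      refine (key _).trans (Eq.trans ?_ (key _).symm)
      exact congrArg _ ((hq1 x).trans hxf)
    · have h1 : coindApp h.homogeneous_ge (q.lin x) t ∈ M.deg (j + c) := q.map_deg c x hx j t htj
      have h2 : coindApp h.homogeneous_ge f t ∈ M.deg (j + c) := hf j t htj
      rw [hMc _ (by omega), Submodule.mem_bot] at h1 h2
      exact h1.trans h2.symm
  -- the inclusion of the bottom extends to the coinduced module
  let B := h.bottom (X := I.res Ale) hc
  have hB : ∀ i, ∀ x ∈ B, (I.res Ale).proj i x ∈ B := fun i x hx => by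
    by_cases hi : i = c
    · rw [hi]
      exact (I.res Ale).proj_mem c x
    · rw [(I.res Ale).proj_of_mem_ne hi hx]
      exact zero_mem _
  let β := subι (I.res Ale) B hB
  obtain ⟨g, hg⟩ := (injective_iff_exists_extension (I.res Ale)).1 hI _ _ (β ≫ resMap Ale q)
    (by
      refine (injective_iff_map_eq_zero _).2 fun x hx => Subtype.ext (hqc x.1 x.2 hx)) β
  have hg' : ∀ x ∈ I.deg c, g.lin (q.lin x) = x := fun x hx => hg ⟨x, hx⟩
  have hgq : ∀ f ∈ (coind h.homogeneous_ge M).deg c, q.lin (show I from g.lin f) = f :=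
    fun f hf => by
      obtain ⟨x, hx, rfl⟩ := hqs f hf
      exact congrArg q.lin (hg' x hx)
  -- Some homogeneous element of `A^{≤0}` moves a given nonzero homogeneous element of the coinduced
  -- module to a nonzero element of the lowest weight `c`, since `M` lives in degree `c`. There `g ≫
  -- q` is the identity, and it is `A^{≤0}`-linear, so nothing is killed.
  have hinj : Function.Injective (g ≫ resMap Ale q).lin := by
    refine (injective_iff_map_eq_zero _).2 fun f hf => eq_zero_of_proj fun e => ?_
    by_contra hf0
    have he := (coind h.homogeneous_ge M).proj_mem e f
    have hf' : (g ≫ resMap Ale q).lin ((coind h.homogeneous_ge M).proj e f) = 0 :=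
      (map_proj (g ≫ resMap Ale q) e f).trans (by rw [hf, map_zero])
    obtain ⟨j, t, ht, htj, hft⟩ := h.half_ge.exists_of_ne_zero hf0
    have hje : j + e = c := by
      by_contra hje
      have := he j t htj
      rw [hMc _ hje, Submodule.mem_bot] at this
      exact hft this
    have h1 := (coind h.homogeneous_ge M).smul_mem j e t _ htj he
    rw [hje] at h1
    have h2 := hgq _ h1
    have h3 : (g ≫ resMap Ale q).lin ((⟨t, ht⟩ : Ale) • (coind h.homogeneous_ge M).proj e f :
        (coind h.homogeneous_ge M).res Ale) = 0 :=
      ((g ≫ resMap Ale q).lin.map_smul (⟨t, ht⟩ : Ale) _).trans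
        ((congrArg _ hf').trans (smul_zero _))
    have h4 : t • (coind h.homogeneous_ge M).proj e f = 0 := h2.symm.trans h3
    have h5 := congrArg (fun u => coindApp h.homogeneous_ge u 1) h4
    simp only [coindApp_smul, one_mul] at h5
    exact hft h5
  -- An injective endomorphism of a finite dimensional space is bijective. Hence `q` is surjective
  -- and split over `A^{≤0}`.
  have hbij : Function.Bijective (g ≫ resMap Ale q).lin := by
    refine ⟨hinj, ?_⟩
    exact LinearMap.surjective_of_injective (K := k)
      (f := (g ≫ resMap Ale q).lin.restrictScalars k) hinj
  have := isIso_of_bijective _ hbij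
  refine ⟨M, q, ?_, ?_, ?_⟩
  · refine epi_of_surjective q fun f => ?_
    obtain ⟨f', hf'⟩ := hbij.2 f
    exact ⟨g.lin f', hf'⟩
  · let p : I.res Ale ⟶ I.res Ale := 𝟙 _ - resMap Ale q ≫ inv (g ≫ resMap Ale q) ≫ g
    have hp : p ≫ resMap Ale q = 0 := by
      simp [p, Preadditive.sub_comp]
    let r : I.res Ale ⟶ (ker q).res Ale :=
      ⟨p.lin.codRestrict ((LinearMap.ker q.lin).restrictScalars Ale) fun x => lin_congr hp x,
        p.map_deg⟩
    have : Injective (I.res Ale) := hI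
    refine Retract.injective (X := (ker q).res Ale) (Y := I.res Ale) ⟨resMap Ale (kerι q), r, ?_⟩
    ext x
    refine Subtype.ext ?_
    have : resMap Ale (kerι q) ≫ p = resMap Ale (kerι q) := by
      rw [Preadditive.comp_sub, Category.comp_id, ← Category.assoc, ← resMap_comp, kerι_comp,
        resMap_zero, zero_comp, sub_zero]
    exact lin_congr this x
  · intro i hi
    rw [eq_bot_iff]
    intro x hx
    refine Subtype.ext ?_
    by_cases hic : i = c
    · subst hic
      exact hqc x.1 hx x.2
    · have : x.1 ∈ I.deg i := hx
      rwa [hc i (by omega), Submodule.mem_bot] at this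

end Bottom

end SemiInf

/-! ### Vanishing of `Ext^1` from `A^{≥0}`-projective to `A^{≤0}`-injective modules. -/

namespace SemiInf

open GrMod

section Exact

variable {k A : Type u} [Field k] [Ring A] [Algebra k A] {𝒜 : ℤ → Submodule k A}

lemma GrMod.exact_iff (C : ShortComplex (GrMod 𝒜)) :
    C.Exact ↔ ∀ x, C.g.lin x = 0 → ∃ y, C.f.lin y = x := by
  rw [ShortComplex.exact_iff_exact_up_to_refinements]
  constructor
  · intro h x hx
    obtain ⟨B, π, _, x₁, h1⟩ := h (kerι C.g) (kerι_comp _)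
    obtain ⟨b, hb⟩ := surjective_of_epi π ⟨x, hx⟩
    refine ⟨x₁.lin b, ?_⟩
    have := lin_congr h1 b
    rw [comp_lin, hb, comp_lin] at this
    exact this.symm
  · intro h B x₂ hx₂
    let l : C.X₁ ⟶ ker C.g := (kerIsLimit C.g).lift (KernelFork.ofι C.f C.zero)
    have hl : l ≫ kerι C.g = C.f :=
      (kerIsLimit C.g).fac (KernelFork.ofι C.f C.zero) WalkingParallelPair.zero
    let x' : B ⟶ ker C.g := (kerIsLimit C.g).lift (KernelFork.ofι x₂ hx₂)
    have hx' : x' ≫ kerι C.g = x₂ :=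
      (kerIsLimit C.g).fac (KernelFork.ofι x₂ hx₂) WalkingParallelPair.zero
    have : Epi l := epi_of_surjective l fun x => by
      obtain ⟨y, hy⟩ := h x.1 x.2
      exact ⟨y, Subtype.ext ((lin_congr hl y).trans hy)⟩
    refine ⟨pullback x' l, pullback.fst x' l, inferInstance, pullback.snd x' l, ?_⟩
    have e : pullback.fst x' l ≫ x' ≫ kerι C.g = pullback.snd x' l ≫ l ≫ kerι C.g := by
      rw [← Category.assoc, pullback.condition, Category.assoc]
    rwa [hx', hl] at e

variable {S : Subalgebra k A}

/-- Over `S` the sequence splits, because its first term is injective. -/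
lemma isInjectiveOver_X₃ {C : ShortComplex (GrMod 𝒜)} (hC : C.ShortExact)
    (h₁ : C.X₁.IsInjectiveOver S) (h₂ : C.X₂.IsInjectiveOver S) : C.X₃.IsInjectiveOver S := by
  let C' : ShortComplex (GrMod (subGrading 𝒜 S)) :=
    ShortComplex.mk (resMap S C.f) (resMap S C.g) (by rw [← resMap_comp, C.zero, resMap_zero])
  have := hC.mono_f
  have := hC.epi_g
  have hC' : C'.ShortExact :=
    { exact := (GrMod.exact_iff C').2 ((GrMod.exact_iff C).1 hC.exact)
      mono_f := mono_of_injective _ (injective_of_mono C.f)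
      epi_g := epi_of_surjective _ (surjective_of_epi C.g) }
  have : Injective C'.X₁ := h₁
  have : Injective C'.X₂ := h₂
  let s := hC'.splittingOfInjective
  exact Retract.injective (X := C'.X₃) (Y := C'.X₂) ⟨s.s, C'.g, s.s_g⟩

lemma isInjectiveOver_of_isZero {M : GrMod 𝒜} (hM : IsZero M) : M.IsInjectiveOver S := by
  refine (injective_iff_exists_extension _).2 fun X Y f hf g => ⟨0, fun x => ?_⟩
  exact (lin_congr ((IsZero.iff_id_eq_zero _).1 hM) (g.lin x)).symm

end Exact

section Ext

open Abelian

variable {k A : Type u} [Field k] [Ring A] [Algebra k A] {𝒜 : ℤ → Submodule k A}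
  [GradedAlgebra 𝒜] {A0 Ale Age : Subalgebra k A} (h : IsTriangular 𝒜 A0 Ale Age)

include h

/-- Induction on the width of the weights of `I`. The lowest weight is removed by an extension of a
module coinduced from `A^{≥0}` by an `A^{≤0}`-injective kernel; the kernel is narrower, and for the
coinduced quotient the vanishing is Shapiro's lemma. -/
lemma IsTriangular.ext_one_eq_zero [HasExt.{w} (GrMod 𝒜)] {P : GrMod 𝒜}
    (hP : Projective (P.res Age)) {I : GrMod 𝒜} (hI : I.IsInjectiveOver Ale) (x : Ext P I 1) :
    x = 0 := by
  have := h.finite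
  -- All weights lie in the interval from `d - n + 1` to `d`, which has `n` elements and is empty
  -- for `n = 0`.
  have key : ∀ (n : ℕ) (I : GrMod 𝒜) (_ : I.IsInjectiveOver Ale) (d : ℤ) (_ : I.WtLE d)
      (_ : I.WtGE (d - n + 1)) (x : Ext P I 1), x = 0 := by
    intro n
    induction n with
    | zero =>
      intro I hI d hd hd' x
      have : IsZero I := isZero_of_deg_eq_bot I fun i => by
        rcases lt_or_ge d i with hi | hi
        · exact hd i hi
        · exact hd' i (by simp; omega)
      rw [← x.comp_mk₀_id, (IsZero.iff_id_eq_zero _).1 this, Ext.mk₀_zero, Ext.comp_zero]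
    | succ n ih =>
      intro I hI d hd hd' x
      obtain ⟨M, q, _, hk, hk'⟩ := h.exists_coind_quotient hI hd'
      let C := ShortComplex.mk (kerι q) q (kerι_comp q)
      have hC : C.ShortExact :=
        { exact := (GrMod.exact_iff C).2 fun x hx => ⟨⟨x, hx⟩, rfl⟩
          mono_f := mono_of_injective _ Subtype.val_injective
          epi_g := ‹_› }
      -- Embed the coinduced module in an injective one. A class in `Ext^1` is then the connecting
      -- image of a map `g` to the cokernel, and `g` lifts by relative injectivity.
      have hM : ∀ y : Ext P C.X₃ 1, y = 0 := fun y => by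
        let D := ShortComplex.mk _ _ (comp_cokerπ (h.injHullι C.X₃))
        have hD : D.ShortExact :=
          { exact := (GrMod.exact_iff D).2 fun x hx => (Submodule.Quotient.mk_eq_zero _).1 hx
            mono_f := inferInstanceAs (Mono (h.injHullι C.X₃))
            epi_g := epi_of_surjective _ (Submodule.mkQ_surjective _) }
        have : Injective D.X₂ := h.injective_injHull _
        obtain ⟨z, rfl⟩ := Ext.covariant_sequence_exact₁ P hD y (Ext.eq_zero_of_injective _)
          (zero_add 1)
        obtain ⟨g, rfl⟩ := Ext.homEquiv₀.symm.surjective z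
        obtain ⟨g', rfl⟩ := (relInjective_coind h.homogeneous_ge M).exists_lift hP (C := D) hD g
        rw [Ext.homEquiv₀_symm_apply, ← Ext.mk₀_comp_mk₀, Ext.comp_assoc (h₁₂ := zero_add 0)
          (h₂₃ := zero_add 1), hD.comp_extClass, Ext.comp_zero]
        rfl
      obtain ⟨z, rfl⟩ := Ext.covariant_sequence_exact₂ P hC x (hM _)
      rw [ih (ker q) hk d (fun i hi => deg_eq_bot_of_injective (kerι q) Subtype.val_injective
        (hd i hi)) (by convert hk' using 1; push_cast; ring) z, Ext.zero_comp]
  obtain ⟨d, hd⟩ := I.exists_wtLE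
  obtain ⟨c, hc⟩ := I.exists_wtGE
  refine key (d - c + 1).toNat I hI d hd (fun i hi => hc i ?_) x
  have := Int.self_le_toNat (d - c + 1)
  omega

/-- Maps from an `A^{≥0}`-projective module lift along epimorphisms with an `A^{≤0}`-injective
kernel. -/
lemma IsTriangular.exists_lift {P : GrMod 𝒜} (hP : Projective (P.res Age))
    {C : ShortComplex (GrMod 𝒜)} (hC : C.ShortExact) (hI : C.X₁.IsInjectiveOver Ale)
    (g : P ⟶ C.X₃) : ∃ g' : P ⟶ C.X₂, g' ≫ C.g = g := by
  have := HasExt.standard (GrMod 𝒜)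
  obtain ⟨y, hy⟩ := Ext.covariant_sequence_exact₃ P hC (Ext.mk₀ g) (zero_add 1)
    (h.ext_one_eq_zero hP hI _)
  obtain ⟨g', rfl⟩ := Ext.homEquiv₀.symm.surjective y
  refine ⟨g', (Ext.mk₀_bijective _ _).1 ?_⟩
  rwa [Ext.homEquiv₀_symm_apply, Ext.mk₀_comp_mk₀] at hy

end Ext

end SemiInf

/-! ### Null-homotopic maps to acyclic complexes. -/

namespace SemiInf

open GrMod

section NullHomotopy

open CochainComplex CochainComplex.HomComplex

variable {C : Type*} [Category* C] [Abelian C] {K L : CochainComplex C ℤ}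

/-- Downward construction of a null-homotopy. If `α` is correct above `n`, the error in degree `n`
is killed by the differential of `L`, so it factors through the preceding differential, and the
factor is added to `α` as a component starting in degree `n`. This does not disturb the degrees
above `n`. -/
lemma exists_homotopy_step
    (hKL : ∀ (p q r : ℤ) (_ : q + 1 = r) (g : K.X p ⟶ L.X r), g ≫ L.d r (r + 1) = 0 →
      ∃ g' : K.X p ⟶ L.X q, g' ≫ L.d q r = g)
    (f : K ⟶ L) (α : Cochain K L (-1)) (n : ℤ)
    (hα : ∀ p, n < p → (δ (-1) 0 α).v p p (add_zero p) = f.f p) :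
    ∃ β : Cochain K L (-1), ∀ p, n ≤ p → (δ (-1) 0 β).v p p (add_zero p) = f.f p := by
  obtain ⟨g', hg'⟩ := hKL n (n - 1) n (by omega) (f.f n - (δ (-1) 0 α).v n n (add_zero n)) (by
    have h1 := hα (n + 1) (by omega)
    rw [δ_v (-1) 0 (neg_add_cancel 1) α _ _ (add_zero _) n (n + 2) (by omega) (by omega)] at h1
    rw [δ_v (-1) 0 (neg_add_cancel 1) α _ _ (add_zero _) (n - 1) (n + 1) (by omega) (by omega)]
    have h2 := congrArg (fun u => K.d n (n + 1) ≫ u) h1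
    simp only [Int.negOnePow_zero, one_smul, Preadditive.comp_add,
      HomologicalComplex.d_comp_d_assoc, zero_comp, add_zero] at h2
    simp only [Int.negOnePow_zero, one_smul, Preadditive.sub_comp, Preadditive.add_comp,
      Category.assoc, HomologicalComplex.d_comp_d, comp_zero, zero_add, ← h2, f.comm]
    rw [h2, sub_self])
  refine ⟨α + Cochain.single g' (-1), fun p hp => ?_⟩
  rw [δ_add, Cochain.add_v, δ_v (-1) 0 (neg_add_cancel 1) (Cochain.single g' (-1)) p p
    (add_zero _) (p - 1) (p + 1) (by omega) (by omega),
    Cochain.single_v_eq_zero _ _ _ _ _ (by omega : p + 1 ≠ n), comp_zero, smul_zero, add_zero]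
  rcases hp.lt_or_eq with h | rfl
  · rw [Cochain.single_v_eq_zero _ _ _ _ _ (by omega : p ≠ n), zero_comp, add_zero, hα p h]
  · rw [Cochain.single_v, hg']
    abel

/-- Nothing is to be done above `b`, and nothing remains below `a`, so finitely many downward steps
suffice. For this reason `K` has to be bounded on both sides. -/
lemma nonempty_homotopy_zero_of_lifting
    (hKL : ∀ (p q r : ℤ) (_ : q + 1 = r) (g : K.X p ⟶ L.X r), g ≫ L.d r (r + 1) = 0 →
      ∃ g' : K.X p ⟶ L.X q, g' ≫ L.d q r = g)
    (a b : ℤ) [K.IsStrictlyGE a] [K.IsStrictlyLE b] (f : K ⟶ L) : Nonempty (Homotopy f 0) := by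
  have key : ∀ n : ℕ, ∃ β : Cochain K L (-1), ∀ p, b - n < p →
      (δ (-1) 0 β).v p p (add_zero p) = f.f p := by
    intro n
    induction n with
    | zero => exact ⟨0, fun p hp => (K.isZero_of_isStrictlyLE b p (by simpa using hp)).eq_of_src _ _⟩
    | succ n ih =>
      obtain ⟨α, hα⟩ := ih
      obtain ⟨β, hβ⟩ := exists_homotopy_step hKL f α (b - n) hα
      exact ⟨β, fun p hp => hβ p (by push_cast at hp; omega)⟩
  obtain ⟨β, hβ⟩ := key (b - a + 1).toNat
  refine ⟨(Cochain.equivHomotopy f 0).symm ⟨β, ?_⟩⟩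
  rw [Cochain.ofHom_zero, add_zero]
  ext p
  rw [Cochain.ofHom_v]
  by_cases hp : p < a
  · exact (K.isZero_of_isStrictlyGE a p hp).eq_of_src _ _
  · refine (hβ p ?_).symm
    have := Int.self_le_toNat (b - a + 1)
    omega

end NullHomotopy

section Cocycles

variable {k A : Type u} [Field k] [Ring A] [Algebra k A] {𝒜 : ℤ → Submodule k A}
  {S : Subalgebra k A} {L : CochainComplex (GrMod 𝒜) ℤ}

/-- The map to the next cocycles that a differential induces. -/
noncomputable def toCocycles (L : CochainComplex (GrMod 𝒜) ℤ) (p q r : ℤ) :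
    L.X p ⟶ ker (L.d q r) :=
  (kerIsLimit (L.d q r)).lift (KernelFork.ofι (L.d p q) (L.d_comp_d p q r))

instance {M N : GrMod 𝒜} (f : M ⟶ N) : Mono (kerι f) :=
  mono_of_injective _ Subtype.val_injective

lemma toCocycles_comp (p q r : ℤ) : toCocycles L p q r ≫ kerι (L.d q r) = L.d p q :=
  (kerIsLimit (L.d q r)).fac (KernelFork.ofι (L.d p q) (L.d_comp_d p q r))
    WalkingParallelPair.zero

lemma shortExact_cocycles (hL : L.Acyclic) (p q r : ℤ) (hpq : p + 1 = q) (hqr : q + 1 = r) :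
    (ShortComplex.mk (kerι (L.d p q)) (toCocycles L p q r) (by
      rw [← cancel_mono (kerι (L.d q r)), Category.assoc, toCocycles_comp, kerι_comp,
        zero_comp])).ShortExact where
  exact := (GrMod.exact_iff _).2 fun x hx =>
    ⟨⟨x, congrArg Subtype.val hx⟩, rfl⟩
  mono_f := inferInstanceAs (Mono (kerι _))
  epi_g := epi_of_surjective _ fun y => by
    obtain ⟨x, hx⟩ := (GrMod.exact_iff _).1
      ((L.exactAt_iff' p q r (by simp; omega) (by simp; omega)).1 (hL q)) y.1 y.2
    exact ⟨x, Subtype.ext hx⟩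

/-- Starting at the left end, where the cocycles vanish, each object of cocycles is the quotient of
a term of `L` by the previous cocycles, and quotients of `S`-injectives by `S`-injectives are
`S`-injective. -/
lemma isInjectiveOver_cocycles (hL : L.Acyclic) (hI : ∀ n, (L.X n).IsInjectiveOver S) (a : ℤ)
    [L.IsStrictlyGE a] (p : ℤ) : (ker (L.d p (p + 1))).IsInjectiveOver S := by
  -- The induction starts in degree `a - 1`, where the term of `L` is zero.
  have key : ∀ n : ℕ, (ker (L.d (a + n - 1) (a + n - 1 + 1))).IsInjectiveOver S := by
    intro n
    induction n with
    | zero =>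
      refine isInjectiveOver_of_isZero (isZero_of_deg_eq_bot _ fun i => ?_)
      exact deg_eq_bot_of_injective (kerι _) Subtype.val_injective
        (deg_eq_bot_of_isZero (L.isZero_of_isStrictlyGE a _ (by simp)) i)
    | succ n ih =>
      have := isInjectiveOver_X₃ (shortExact_cocycles hL (a + n - 1) (a + n - 1 + 1)
        (a + n - 1 + 1 + 1) rfl rfl) ih (hI _)
      convert this using 3
      all_goals push_cast; ring
  by_cases hp : p < a
  · refine isInjectiveOver_of_isZero (isZero_of_deg_eq_bot _ fun i => ?_)
    exact deg_eq_bot_of_injective (kerι _) Subtype.val_injective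
      (deg_eq_bot_of_isZero (L.isZero_of_isStrictlyGE a _ hp) i)
  · obtain ⟨n, hn⟩ := Int.eq_ofNat_of_zero_le (a := p - a + 1) (by omega)
    obtain rfl : p = a + n - 1 := by omega
    exact key n

end Cocycles

section Orthogonality

variable {k A : Type u} [Field k] [Ring A] [Algebra k A] {𝒜 : ℤ → Submodule k A}
  [GradedAlgebra 𝒜] {A0 Ale Age : Subalgebra k A} (h : IsTriangular 𝒜 A0 Ale Age)

include h

/-- Maps from a bounded complex of `A^{≥0}`-projective modules to an acyclic bounded below complex
of `A^{≤0}`-injective modules are null-homotopic. -/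
lemma IsTriangular.nonempty_homotopy_zero {K L : CochainComplex (GrMod 𝒜) ℤ} (a b c : ℤ)
    [K.IsStrictlyGE a] [K.IsStrictlyLE b] [L.IsStrictlyGE c]
    (hK : ∀ n, Projective ((K.X n).res Age)) (hL : L.Acyclic)
    (hI : ∀ n, (L.X n).IsInjectiveOver Ale) (f : K ⟶ L) : Nonempty (Homotopy f 0) := by
  refine nonempty_homotopy_zero_of_lifting (fun p q r hqr g hg => ?_) a b f
  obtain rfl := hqr
  -- The map `g` lands in the cocycles, and the kernel of the epimorphism from the preceding term of
  -- `L` to these cocycles is again an object of cocycles, hence `A^{≤0}`-injective.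
  obtain ⟨g', hg'⟩ := h.exists_lift (hK p)
    (shortExact_cocycles hL q (q + 1) (q + 1 + 1) rfl rfl) (isInjectiveOver_cocycles hL hI c q)
    ((kerIsLimit (L.d (q + 1) (q + 1 + 1))).lift (KernelFork.ofι g hg))
  refine ⟨g', ?_⟩
  have e := congrArg (fun u => u ≫ kerι (L.d (q + 1) (q + 1 + 1))) hg'
  have e' := (kerIsLimit (L.d (q + 1) (q + 1 + 1))).fac (KernelFork.ofι g hg)
    WalkingParallelPair.zero
  rw [← toCocycles_comp q (q + 1) (q + 1 + 1), ← Category.assoc]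
  exact e.trans e'

end Orthogonality

end SemiInf

/-! ### Resolutions of complexes by iterated pushouts. -/

namespace SemiInf

namespace Resolve

variable {C : Type*} [Category* C] [Abelian C]

/-- Exactness of `N ⟶ M ⊞ L ⟶ P` in the middle, in terms of generalized elements. -/
lemma exists_of_pushout_eq {N M L P : C} {i : N ⟶ M} {v : N ⟶ L} {l : M ⟶ P} {r : L ⟶ P}
    (h : IsPushout i v l r) {T : C} (x : T ⟶ M) (y : T ⟶ L) (hxy : x ≫ l = y ≫ r) :
    ∃ (T' : C) (π : T' ⟶ T) (_ : Epi π) (z : T' ⟶ N), z ≫ i = π ≫ x ∧ z ≫ v = π ≫ y := by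
  have h0 : biprod.lift x (-y) ≫ biprod.desc l r = 0 := by
    rw [biprod.lift_desc, hxy, Preadditive.neg_comp, add_neg_cancel]
  obtain ⟨T', π, hπ, z, hz⟩ : ∃ (T' : C) (π : T' ⟶ T) (_ : Epi π) (z : T' ⟶ N),
      π ≫ biprod.lift x (-y) = z ≫ biprod.lift i (-v) :=
    h.exact_shortComplex.exact_up_to_refinements (biprod.lift x (-y)) h0
  refine ⟨T', π, hπ, z, ?_, ?_⟩
  · have := congrArg (fun t => t ≫ biprod.fst) hz
    simpa only [Category.assoc, biprod.lift_fst] using this.symm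
  · have := congrArg (fun t => t ≫ biprod.snd) hz
    simp only [Category.assoc, biprod.lift_snd, Preadditive.comp_neg] at this
    exact (neg_injective this).symm

/-- Surjectivity of `M ⊞ L ⟶ P`, in terms of generalized elements. -/
lemma exists_pushout_lift {N M L P : C} {i : N ⟶ M} {v : N ⟶ L} {l : M ⟶ P} {r : L ⟶ P}
    (h : IsPushout i v l r) {T : C} (t : T ⟶ P) :
    ∃ (T' : C) (π : T' ⟶ T) (_ : Epi π) (x : T' ⟶ M) (y : T' ⟶ L),
      π ≫ t = x ≫ l + y ≫ r := by
  have : Epi (biprod.desc l r) := h.epi_shortComplex_g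
  obtain ⟨T', π, hπ, z, hz⟩ := surjective_up_to_refinements_of_epi (biprod.desc l r) t
  refine ⟨T', π, hπ, z ≫ biprod.fst, z ≫ biprod.snd, hz.trans ?_⟩
  rw [Category.assoc, Category.assoc, ← Preadditive.comp_add]
  congr 1
  apply biprod.hom_ext' <;> simp

section QuasiIso

variable {K J : CochainComplex C ℕ} {φ : K ⟶ J} {N : ℕ → C} {ι : ∀ n, N n ⟶ J.X n}
  [∀ n, Mono (ι n)] {v : ∀ n, N n ⟶ K.X (n + 1)} {l : ∀ n, J.X n ⟶ N (n + 1)}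
  {κ : ∀ n, K.X n ⟶ N n} (h : ∀ n, IsPushout (ι n) (v n) (l n) (κ (n + 1)))
  (hd : ∀ n, J.d n (n + 1) = l n ≫ ι (n + 1)) (hφ : ∀ n, φ.f n = κ n ≫ ι n)
  (hκ : ∀ n, κ n ≫ v n = K.d n (n + 1)) (hl : ∀ n, l n ≫ v (n + 1) = 0) [IsIso (κ 0)]

include h hκ hl in
-- The pushout shows that `y` lies in the image of `v n`. This is the image of the differential of
-- `K`: the source `N n` is spanned by `K.X n`, on which `v n` is the differential, and (for `n >
-- 0`) by the preceding term of `J`, which `v n` kills.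
lemma exists_of_κ_eq (n : ℕ) {T : C} (y : T ⟶ K.X (n + 1)) (x : T ⟶ J.X n)
    (e : y ≫ κ (n + 1) = x ≫ l n) :
    ∃ (T' : C) (π : T' ⟶ T) (_ : Epi π) (z : T' ⟶ K.X n), π ≫ y = z ≫ K.d n (n + 1) := by
  obtain ⟨T', π, _, z, -, hz⟩ := exists_of_pushout_eq (h n) x y e.symm
  cases n with
  | zero => exact ⟨T', π, inferInstance, z ≫ inv (κ 0), by rw [← hz, ← hκ]; simp⟩
  | succ n =>
    obtain ⟨T'', π', _, x', y', h'⟩ := exists_pushout_lift (h n) z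
    refine ⟨T'', π' ≫ π, inferInstance, y', ?_⟩
    rw [Category.assoc, ← hz, ← Category.assoc, h', Preadditive.add_comp, Category.assoc,
      Category.assoc, hl, hκ, comp_zero, zero_add]

include h in
-- By the pushout, the kernel of `l n` is the image under `ι n` of the kernel of `v n`. Since `ι (n
-- + 1)` is mono, it is also the object of cocycles of `J`.
lemma exists_cocycle_lift (n : ℕ) {T : C} (y : T ⟶ J.X n) (e : y ≫ l n = 0) :
    ∃ (T' : C) (π : T' ⟶ T) (_ : Epi π) (z : T' ⟶ N n), z ≫ ι n = π ≫ y ∧ z ≫ v n = 0 := by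
  obtain ⟨T', π, hπ, z, h1, h2⟩ := exists_of_pushout_eq (h n) y 0 (e.trans zero_comp.symm)
  exact ⟨T', π, hπ, z, h1, h2.trans comp_zero⟩

include h hd hφ hκ hl in
-- A cocycle of `J` comes from an element of `N n` killed by `v n`; up to an element of the
-- preceding term of `J`, whose image is a boundary, this is a cocycle of `K`. Conversely, a cocycle
-- of `K` that becomes a boundary in `J` is a boundary by `exists_of_κ_eq`. Degree 0 is separate as
-- there is no preceding term; there `κ 0` is an isomorphism.
lemma quasiIso_of_isPushout : QuasiIso φ where
  quasiIsoAt n := by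
    rw [quasiIsoAt_iff_isIso_homologyMap]
    have hd' : ∀ {T : C} (y : T ⟶ J.X n), y ≫ J.d n (n + 1) = 0 → y ≫ l n = 0 := by
      intro T y hy
      rw [← cancel_mono (ι (n + 1)), zero_comp, Category.assoc, ← hd, hy]
    cases n with
    | zero =>
      have h1 : Mono (HomologicalComplex.homologyMap φ 0) := by
        rw [HomologicalComplex.mono_homologyMap_iff_up_to_refinements _ 0 0 1 (by simp) (by simp)]
        intro T x₂ hx₂ y₁ hy
        refine ⟨T, 𝟙 T, inferInstance, 0, ?_⟩
        rw [J.shape _ _ (by simp), comp_zero, hφ, ← Category.assoc, ← zero_comp (f := ι 0),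
          cancel_mono, ← zero_comp (f := κ 0), cancel_mono] at hy
        rw [hy, comp_zero, zero_comp]
      have h2 : Epi (HomologicalComplex.homologyMap φ 0) := by
        rw [HomologicalComplex.epi_homologyMap_iff_up_to_refinements _ 0 0 1 (by simp) (by simp)]
        intro T y₂ hy₂
        obtain ⟨T', π, hπ, z, hz, hz'⟩ := exists_cocycle_lift h 0 y₂ (hd' _ hy₂)
        refine ⟨T', π, hπ, z ≫ inv (κ 0), ?_, 0, ?_⟩
        · rw [← hκ 0]
          simpa using hz'
        · rw [zero_comp, add_zero, ← hz, hφ]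
          simp
      exact isIso_of_mono_of_epi _
    | succ n =>
      have h1 : Mono (HomologicalComplex.homologyMap φ (n + 1)) := by
        rw [HomologicalComplex.mono_homologyMap_iff_up_to_refinements _ n (n + 1) (n + 2)
          (by simp) (by simp)]
        intro T x₂ hx₂ y₁ hy
        refine exists_of_κ_eq h hκ hl n x₂ y₁ ?_
        rw [← cancel_mono (ι (n + 1)), Category.assoc, Category.assoc, ← hd, ← hφ, hy]
      have h2 : Epi (HomologicalComplex.homologyMap φ (n + 1)) := by
        rw [HomologicalComplex.epi_homologyMap_iff_up_to_refinements _ n (n + 1) (n + 2)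
          (by simp) (by simp)]
        intro T y₂ hy₂
        obtain ⟨T', π, hπ, z, hz, hz'⟩ := exists_cocycle_lift h (n + 1) y₂ (hd' _ hy₂)
        obtain ⟨T'', π', hπ', x', y', h'⟩ := exists_pushout_lift (h n) z
        refine ⟨T'', π' ≫ π, inferInstance, y', ?_, x', ?_⟩
        · have e := congrArg (fun t => t ≫ v (n + 1)) h'
          simp only [Category.assoc, Preadditive.add_comp, hl, hz', comp_zero, zero_add, hκ] at e
          exact e.symm
        · rw [Category.assoc, ← hz, ← Category.assoc, h', Preadditive.add_comp, hφ, hd,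
            Category.assoc, Category.assoc, add_comm (x' ≫ _)]
      exact isIso_of_mono_of_epi _

end QuasiIso

variable (I : C → C) (ι : ∀ M, M ⟶ I M) [∀ M, Mono (ι M)] (K : CochainComplex C ℕ)

/-- The data that the construction of a resolution carries from one degree to the next one. -/
structure State (n : ℕ) where
  /-- the object which is embedded in the `n`-th term of the resolution -/
  N : C
  /-- the map to the complex that is resolved -/
  v : N ⟶ K.X (n + 1)
  v_d : v ≫ K.d (n + 1) (n + 2) = 0
  /-- the map from the complex that is resolved -/
  κ : K.X n ⟶ N
  κ_v : κ ≫ v = K.d n (n + 1)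

/-- The step from one degree to the next one. -/
noncomputable def State.next {n : ℕ} (s : State K n) : State K (n + 1) where
  -- The pushout adds the next term of `K` to the cokernel of the embedding. Where that term is
  -- zero, it is just the cokernel.
  N := pushout (ι s.N) s.v
  v := pushout.desc 0 (K.d (n + 1) (n + 2)) (by rw [comp_zero, s.v_d])
  v_d := by
    apply pushout.hom_ext
    · rw [pushout.inl_desc_assoc, zero_comp, comp_zero]
    · rw [pushout.inr_desc_assoc, K.d_comp_d, comp_zero]
  κ := pushout.inr _ _
  κ_v := pushout.inr_desc _ _ _

/-- All the states. -/
noncomputable def state : ∀ n, State K n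
  | 0 => ⟨K.X 0, K.d 0 1, K.d_comp_d _ _ _, 𝟙 _, Category.id_comp _⟩
  | n + 1 => (state n).next I ι K

/-- The map from a term of the resolution to the next object to be embedded. -/
noncomputable def inl (n : ℕ) : I (state I ι K n).N ⟶ (state I ι K (n + 1)).N :=
  pushout.inl (ι (state I ι K n).N) (state I ι K n).v

lemma inl_v (n : ℕ) : inl I ι K n ≫ (state I ι K (n + 1)).v = 0 :=
  pushout.inl_desc _ _ _

lemma isPushout (n : ℕ) : IsPushout (ι _) (state I ι K n).v (inl I ι K n)
    (state I ι K (n + 1)).κ := IsPushout.of_hasPushout _ _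

/-- The resolution. -/
noncomputable def resolution : CochainComplex C ℕ :=
  CochainComplex.of (fun n => I (state I ι K n).N)
    (fun n => inl I ι K n ≫ ι (state I ι K (n + 1)).N) (fun n => by
      rw [Category.assoc, ← Category.assoc (ι _), (isPushout I ι K _).w, Category.assoc,
        ← Category.assoc (inl I ι K n), inl_v, zero_comp])

lemma resolution_d (n : ℕ) : (resolution I ι K).d n (n + 1) =
    inl I ι K n ≫ ι (state I ι K (n + 1)).N :=
  CochainComplex.of_d (fun n => I (state I ι K n).N)
    (fun n => inl I ι K n ≫ ι (state I ι K (n + 1)).N) n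

lemma toResolution_comm (n : ℕ) : ((state I ι K n).κ ≫ ι _) ≫ inl I ι K n ≫ ι _ =
    K.d n (n + 1) ≫ (state I ι K (n + 1)).κ ≫ ι _ := by
  rw [Category.assoc, ← Category.assoc (ι _), (isPushout I ι K _).w, ← (state I ι K n).κ_v,
    Category.assoc, Category.assoc]

/-- The map to the resolution. -/
noncomputable def toResolution : K ⟶ resolution I ι K where
  f n := (state I ι K n).κ ≫ ι _
  comm' i j hij := by
    obtain rfl : i + 1 = j := hij
    exact (congrArg (fun t => ((state I ι K i).κ ≫ ι _) ≫ t) (resolution_d I ι K i)).trans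
      (toResolution_comm I ι K i)

instance : QuasiIso (toResolution I ι K) :=
  have : ∀ n, Mono (Y := (resolution I ι K).X n) (ι (state I ι K n).N) :=
    fun _ => inferInstanceAs (Mono (ι _))
  have : IsIso (state I ι K 0).κ := inferInstanceAs (IsIso (𝟙 _))
  quasiIso_of_isPushout (J := resolution I ι K) (N := fun n => (state I ι K n).N)
    (ι := fun _ => ι _) (v := fun n => (state I ι K n).v) (κ := fun n => (state I ι K n).κ)
    (isPushout I ι K) (resolution_d I ι K) (fun _ => rfl) (fun n => (state I ι K n).κ_v)
    (inl_v I ι K)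

end Resolve

section

variable {C : Type*} [Category* C] [Abelian C]

open ComplexShape HomologicalComplex

/-- The map from a complex to its restriction to the image of an embedding, extended by zero. -/
noncomputable def toRestrict {c : ComplexShape ℕ} (e : c.Embedding (ComplexShape.up ℤ))
    [e.IsRelIff] (K : CochainComplex C ℤ)
    (h : e.HasLift (𝟙 (restriction K e))) : K ⟶ (restriction K e).extend e :=
  e.liftExtend _ h

lemma isIso_toRestrict_f {c : ComplexShape ℕ} (e : c.Embedding (ComplexShape.up ℤ))
    [e.IsRelIff] (K : CochainComplex C ℤ)
    (h : e.HasLift (𝟙 (restriction K e))) {j : ℤ} {n : ℕ} (hj : e.f n = j) :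
    IsIso ((toRestrict e K h).f j) := by
  rw [toRestrict, e.isIso_liftExtend_f_iff _ h hj]
  exact inferInstanceAs (IsIso (𝟙 _))

/-- Resolutions of bounded below complexes by objects `I M`, for functorless embeddings `M ⟶ I M`:
one can control the objects `M` that occur. -/
theorem exists_resolution (I : C → C) (ι : ∀ M, M ⟶ I M) [∀ M, Mono (ι M)]
    (K : CochainComplex C ℤ) (a : ℤ) [K.IsStrictlyGE a] (P : ℕ → C → Prop) (h0 : P 0 (K.X a))
    (hP : ∀ (n : ℕ) (N : C) (v : N ⟶ K.X (a + n + 1)), P n N → P (n + 1) (pushout (ι N) v)) :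
    ∃ (J : CochainComplex C ℤ) (φ : K ⟶ J), QuasiIso φ ∧ J.IsStrictlyGE a ∧
      ∀ n : ℕ, ∃ N, P n N ∧ Nonempty (J.X (a + n) ≅ I N) := by
  let e := embeddingUpIntGE a
  have hl : e.HasLift (𝟙 (restriction K e)) := fun _ j i' hi' =>
    (K.isZero_of_isStrictlyGE a i' (by
      have := j.notMem hi'
      by_contra! hge
      exact this (i' - a).toNat (by simp [e]; omega))).eq_of_src _ _
  -- `K` vanishes below `a`, so nothing is lost by restricting it to the degrees `≥ a` and extending
  -- by zero.
  have : IsIso (toRestrict e K hl) := by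
    have : ∀ j, IsIso ((toRestrict e K hl).f j) := fun j => by
      by_cases hj : j < a
      · exact ((K.isZero_of_isStrictlyGE a j hj)).isIso
          (isZero_extend_X _ e j (fun i => by simp [e]; omega)) _
      · exact isIso_toRestrict_f e K hl (n := (j - a).toNat) (by simp [e]; omega)
    exact HomologicalComplex.Hom.isIso_of_components _
  have hPn : ∀ n, P n (Resolve.state I ι (restriction K e) n).N := by
    intro n
    induction n with
    | zero =>
      have : a + ((0 : ℕ) : ℤ) = a := by simp
      have key : ∀ (j : ℤ) (_ : j = a), P 0 (K.X j) := by
        rintro _ rfl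
        exact h0
      exact key _ this
    | succ n ih =>
      have : a + ((n + 1 : ℕ) : ℤ) = a + n + 1 := by push_cast; ring
      have key : ∀ (j : ℤ) (_ : j = a + n + 1) (N : C) (v : N ⟶ K.X j), P n N →
          P (n + 1) (pushout (ι N) v) := by
        rintro _ rfl
        exact hP n
      exact key _ this _ (Resolve.state I ι (restriction K e) n).v ih
  refine ⟨(Resolve.resolution I ι (restriction K e)).extend e,
    toRestrict e K hl ≫ extendMap (Resolve.toResolution I ι _) e, inferInstance, ?_, ?_⟩
  · exact inferInstanceAs (IsStrictlySupported _ e)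
  · intro n
    exact ⟨_, hPn n, ⟨extendXIso _ e (by rfl)⟩⟩

end

end SemiInf

/-! ### Existence of convex and concave resolutions. -/

namespace SemiInf

open GrMod DerivedCategory

variable {k A : Type u} [Field k] [Ring A] [Algebra k A] {𝒜 : ℤ → Submodule k A}

section Weights

lemma deg_pushout_eq_bot {N M L : GrMod 𝒜} (f : N ⟶ M) (g : N ⟶ L) {i : ℤ} (hM : M.deg i = ⊥)
    (hL : L.deg i = ⊥) : (pushout f g).deg i = ⊥ := by
  rw [eq_bot_iff]
  intro y hy
  have : Epi (biprod.desc (pushout.inl f g) (pushout.inr f g)) :=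
    (IsPushout.of_hasPushout f g).epi_shortComplex_g
  obtain ⟨z, hz, rfl⟩ := exists_mem_deg_of_surjective _ (surjective_of_epi
    (biprod.desc (pushout.inl f g) (pushout.inr f g))) hy
  have h1 : Hom.lin (biprod.fst : M ⊞ L ⟶ M) z = 0 := by
    have := Hom.map_deg (biprod.fst : M ⊞ L ⟶ M) i z hz
    rwa [hM] at this
  have h2 : Hom.lin (biprod.snd : M ⊞ L ⟶ L) z = 0 := by
    have := Hom.map_deg (biprod.snd : M ⊞ L ⟶ L) i z hz
    rwa [hL] at this
  have h3 : z = 0 := by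
    refine (lin_congr (biprod.total (X := M) (Y := L)) z).symm.trans ?_
    rw [add_lin, comp_lin, comp_lin, h1, h2, map_zero, map_zero, add_zero]
  rw [h3, map_zero]
  exact zero_mem _

lemma surjective_pushout_inl {N M L : GrMod 𝒜} (f : N ⟶ M) (g : N ⟶ L) (hL : IsZero L) :
    Function.Surjective (pushout.inl f g).lin ∧ f ≫ pushout.inl f g = 0 := by
  have : Epi g := ⟨fun _ _ _ => hL.eq_of_src _ _⟩
  refine ⟨surjective_of_epi _, ?_⟩
  rw [pushout.condition, hL.eq_of_tgt g 0, zero_comp]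

lemma exists_wtLE_of_bounded (K : CochainComplex (GrMod 𝒜) ℤ) (a b : ℤ) [K.IsStrictlyGE a]
    [K.IsStrictlyLE b] : ∃ d, ∀ n, (K.X n).WtLE d := by
  choose d hd using fun n => (K.X n).exists_wtLE
  obtain ⟨D, hD⟩ := ((Set.finite_Icc a b).image d).bddAbove
  refine ⟨D, fun n i hi => ?_⟩
  by_cases hn : n ∈ Set.Icc a b
  · exact hd n i ((hD ⟨n, hn, rfl⟩).trans_lt hi)
  · refine deg_eq_bot_of_isZero ?_ i
    rcases lt_or_ge n a with h | h
    · exact K.isZero_of_isStrictlyGE a n h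
    · exact K.isZero_of_isStrictlyLE b n (by simp only [Set.mem_Icc, not_and] at hn; grind)

lemma exists_wtGE_of_bounded (K : CochainComplex (GrMod 𝒜) ℤ) (a b : ℤ) [K.IsStrictlyGE a]
    [K.IsStrictlyLE b] : ∃ d, ∀ n, (K.X n).WtGE d := by
  choose d hd using fun n => (K.X n).exists_wtGE
  obtain ⟨D, hD⟩ := ((Set.finite_Icc a b).image d).bddBelow
  refine ⟨D, fun n i hi => ?_⟩
  by_cases hn : n ∈ Set.Icc a b
  · exact hd n i (hi.trans_le (hD ⟨n, hn, rfl⟩))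
  · refine deg_eq_bot_of_isZero ?_ i
    rcases lt_or_ge n a with h | h
    · exact K.isZero_of_isStrictlyGE a n h
    · exact K.isZero_of_isStrictlyLE b n (by simp only [Set.mem_Icc, not_and] at hn; grind)

end Weights

section Existence

variable [GradedAlgebra 𝒜] {A0 Ale Age : Subalgebra k A} (h : IsTriangular 𝒜 A0 Ale Age)
  [HasDerivedCategory.{w} (GrMod 𝒜)]

lemma exists_bounded_representative (X : Bounded (GrMod 𝒜)) :
    ∃ (K : CochainComplex (GrMod 𝒜) ℤ) (a b : ℤ) (_ : K.IsStrictlyGE a) (_ : K.IsStrictlyLE b),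
      Nonempty (Q.obj K ≅ X.obj) := by
  obtain ⟨⟨a, ha⟩, ⟨b, hb⟩⟩ := X.property
  have : X.obj.IsGE a := ha
  have : X.obj.IsLE b := hb
  obtain ⟨K, h1, h2, ⟨e⟩⟩ := exists_iso_Q_obj_of_isGE_of_isLE X.obj a b
  exact ⟨K, a, b, h1, h2, ⟨e.symm⟩⟩

include h

/-- Resolve by modules coinduced from `A^{≤0}`. As long as `K` has terms, the weights stay at most
`d`; after its end the next object is the cokernel of a unit, and by `quot_coind_wtLE` the bound
goes down by one at each step. -/
theorem IsTriangular.nonempty_convexResolution (X : Bounded (GrMod 𝒜)) :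
    Nonempty (ConvexResolution Age X) := by
  have := h.finite
  obtain ⟨K, a, b, _, _, ⟨e⟩⟩ := exists_bounded_representative X
  obtain ⟨d, hd⟩ := exists_wtLE_of_bounded K a b
  -- The number of steps after which `K` has no further terms; the maximum covers an empty range `b
  -- < a`.
  let c := max 0 (b - a)
  obtain ⟨J, φ, _, _, hJ⟩ := exists_resolution (fun M => coind h.half_le.homS (M.res Ale))
    (fun M => coindUnit _ M) K a (fun n N => N.WtLE (d - max 0 (n - c)))
    (fun i hi => hd _ i (by push_cast at hi; omega)) (by
      intro n N v hN
      by_cases hn : a + n + 1 ≤ b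
      · rw [max_eq_left (by omega)] at hN ⊢
        exact fun i hi => deg_pushout_eq_bot _ _ (coind_wtLE h hN i hi) (hd _ i (by omega))
      · obtain ⟨h1, h2⟩ := surjective_pushout_inl (coindUnit h.half_le.homS N) v
          (K.isZero_of_isStrictlyLE b _ (by omega))
        have := quot_coind_wtLE h hN _ h1 h2
        exact fun i hi => this i (by omega))
  have hJ' : ∀ n : ℕ, (J.X (a + n)).WtLE (d - max 0 (n - c)) ∧
      (J.X (a + n)).IsInjectiveOver Age := fun n => by
    obtain ⟨N, hN, ⟨e⟩⟩ := hJ n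
    exact ⟨fun i hi => (deg_eq_bot_iff_of_iso e).2 (coind_wtLE h hN i hi),
      (h.half_le.isInjectiveOver_coind _).of_iso e⟩
  refine ⟨J, ⟨a, inferInstance⟩, fun m => ?_, fun n => ?_, (asIso (Q.map φ)).symm ≪≫ e⟩
  -- A weight above `m` in degree `a + p` is at most `d - max 0 (p - c)`, which bounds `p` by `c +
  -- (d - m)`.
  · refine ((Set.finite_Icc a (a + c + max 0 (d - m))).prod (Set.finite_Icc m d)).subset ?_
    rintro ⟨n, i⟩ ⟨h1, h2⟩
    dsimp only at h1 h2
    have ha : a ≤ n := by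
      by_contra H
      exact h2 (deg_eq_bot_of_isZero (J.isZero_of_isStrictlyGE a n (by omega)) i)
    obtain ⟨p, hp⟩ := Int.eq_ofNat_of_zero_le (a := n - a) (by omega)
    obtain rfl : n = a + p := by omega
    have hi : i ≤ d - max 0 (p - c) := by
      by_contra H
      exact h2 ((hJ' p).1 i (by omega))
    simp only [Set.mem_prod, Set.mem_Icc]
    omega
  · rcases lt_or_ge n a with ha | ha
    · exact isInjectiveOver_of_isZero (J.isZero_of_isStrictlyGE a n ha)
    · obtain ⟨p, hp⟩ := Int.eq_ofNat_of_zero_le (a := n - a) (by omega)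
      obtain rfl : n = a + p := by omega
      exact (hJ' p).2

/-- The mirror image of the convex case: coinduction from `A^{≥0}` never lowers the lowest weight,
and cokernels of units raise it by one. -/
theorem IsTriangular.nonempty_concaveResolution (X : Bounded (GrMod 𝒜)) :
    Nonempty (ConcaveResolution Ale X) := by
  have := h.finite
  obtain ⟨K, a, b, _, _, ⟨e⟩⟩ := exists_bounded_representative X
  obtain ⟨d, hd⟩ := exists_wtGE_of_bounded K a b
  let c := max 0 (b - a)
  obtain ⟨J, φ, _, _, hJ⟩ := exists_resolution (fun M => coind h.half_ge.homS (M.res Age))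
    (fun M => coindUnit _ M) K a (fun n N => N.WtGE (d + max 0 (n - c)))
    (fun i hi => hd _ i (by push_cast at hi; omega)) (by
      intro n N v hN
      by_cases hn : a + n + 1 ≤ b
      · rw [max_eq_left (by omega)] at hN ⊢
        exact fun i hi => deg_pushout_eq_bot _ _ (coind_wtGE h hN i hi) (hd _ i (by omega))
      · obtain ⟨h1, h2⟩ := surjective_pushout_inl (coindUnit h.half_ge.homS N) v
          (K.isZero_of_isStrictlyLE b _ (by omega))
        have := quot_coind_wtGE h hN _ h1 h2
        exact fun i hi => this i (by omega))
  have hJ' : ∀ n : ℕ, (J.X (a + n)).WtGE (d + max 0 (n - c)) ∧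
      (J.X (a + n)).IsInjectiveOver Ale := fun n => by
    obtain ⟨N, hN, ⟨e⟩⟩ := hJ n
    exact ⟨fun i hi => (deg_eq_bot_iff_of_iso e).2 (coind_wtGE h hN i hi),
      (h.half_ge.isInjectiveOver_coind _).of_iso e⟩
  refine ⟨J, ⟨a, inferInstance⟩, fun m => ?_, fun n => ?_, (asIso (Q.map φ)).symm ≪≫ e⟩
  · refine ((Set.finite_Icc a (a + c + max 0 (m - d))).prod (Set.finite_Icc d m)).subset ?_
    rintro ⟨n, i⟩ ⟨h1, h2⟩
    dsimp only at h1 h2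
    have ha : a ≤ n := by
      by_contra H
      exact h2 (deg_eq_bot_of_isZero (J.isZero_of_isStrictlyGE a n (by omega)) i)
    obtain ⟨p, hp⟩ := Int.eq_ofNat_of_zero_le (a := n - a) (by omega)
    obtain rfl : n = a + p := by omega
    have hi : d + max 0 (p - c) ≤ i := by
      by_contra H
      exact h2 ((hJ' p).1 i (by omega))
    simp only [Set.mem_prod, Set.mem_Icc]
    omega
  · rcases lt_or_ge n a with ha | ha
    · exact isInjectiveOver_of_isZero (J.isZero_of_isStrictlyGE a n ha)
    · obtain ⟨p, hp⟩ := Int.eq_ofNat_of_zero_le (a := n - a) (by omega)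
      obtain rfl : n = a + p := by omega
      exact (hJ' p).2

end Existence

end SemiInf

/-! ### Complexes between which chain maps compute the derived category. -/

namespace SemiInf

open GrMod DerivedCategory Pretriangulated

section Localization

variable {C : Type*} [Category* C] [Abelian C] [HasDerivedCategory.{w} C]
  {K L : CochainComplex C ℤ}

/-- The homotopy classes of maps from `K` to `L` are the morphisms in the derived category. -/
def ComputesHom (K L : CochainComplex C ℤ) : Prop :=
  Function.Bijective (Qh.map : ((HomotopyCategory.quotient C (.up ℤ)).obj K ⟶
    (HomotopyCategory.quotient C (.up ℤ)).obj L) → _)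

lemma computesHom_of_isKInjective [L.IsKInjective] : ComputesHom K L :=
  CochainComplex.IsKInjective.Qh_map_bijective _ _

lemma ComputesHom.exists_map_eq (h : ComputesHom K L) (u : Q.obj K ⟶ Q.obj L) :
    ∃ f : K ⟶ L, Q.map f = u := by
  obtain ⟨v, hv⟩ := h.2 ((quotientCompQhIso C).hom.app K ≫ u ≫ (quotientCompQhIso C).inv.app L)
  obtain ⟨f, rfl⟩ := (HomotopyCategory.quotient C (.up ℤ)).map_surjective v
  refine ⟨f, ?_⟩
  rw [← cancel_epi ((quotientCompQhIso C).hom.app K), ← quotientCompQhIso_hom_naturality, hv]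
  simp

lemma ComputesHom.nonempty_homotopy (h : ComputesHom K L) {f g : K ⟶ L}
    (e : Q.map f = Q.map g) : Nonempty (Homotopy f g) := by
  refine ⟨HomotopyCategory.homotopyOfEq _ _ (h.1 ?_)⟩
  rw [← cancel_mono ((quotientCompQhIso C).hom.app L), quotientCompQhIso_hom_naturality,
    quotientCompQhIso_hom_naturality, e]

lemma acyclic_mappingCone (φ : K ⟶ L) [QuasiIso φ] :
    HomologicalComplex.Acyclic (CochainComplex.mappingCone φ) := by
  rw [← HomotopyCategory.quotient_obj_mem_subcategoryAcyclic_iff_acyclic]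
  refine ((HomotopyCategory.subcategoryAcyclic C).trW_iff_of_distinguished _
    (HomotopyCategory.mappingCone_triangleh_distinguished φ)).1 ?_
  rw [← HomotopyCategory.quasiIso_eq_trW_subcategoryAcyclic]
  exact (HomotopyCategory.quotient_map_mem_quasiIso_iff φ).2
    ((HomologicalComplex.mem_quasiIso_iff φ).2 inferInstance)

/-- By the long exact sequence of the triangle of `φ` in the homotopy category, the vanishing of
maps from `K` and its shift to the cone makes composition with `φ` bijective on maps from `K`. Maps
to the K-injective `E` are already those of the derived category, where `φ` is invertible. -/
lemma computesHom_of_mappingCone {J E : CochainComplex C ℤ} (φ : J ⟶ E) [QuasiIso φ]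
    [E.IsKInjective]
    (h₀ : ∀ f : K ⟶ CochainComplex.mappingCone φ, Nonempty (Homotopy f 0))
    (h₁ : ∀ f : K⟦(1 : ℤ)⟧ ⟶ CochainComplex.mappingCone φ, Nonempty (Homotopy f 0)) :
    ComputesHom K J := by
  have hz : ∀ {K' : CochainComplex C ℤ}
      (_ : ∀ f : K' ⟶ CochainComplex.mappingCone φ, Nonempty (Homotopy f 0))
      (v : (HomotopyCategory.quotient C (.up ℤ)).obj K' ⟶
        (HomotopyCategory.quotient C (.up ℤ)).obj (CochainComplex.mappingCone φ)), v = 0 := by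
    intro K' hK' v
    obtain ⟨f, rfl⟩ := (HomotopyCategory.quotient C (.up ℤ)).map_surjective v
    obtain ⟨H⟩ := hK' f
    exact (HomotopyCategory.eq_of_homotopy _ _ H).trans (Functor.map_zero _ _ _)
  have hT := HomotopyCategory.mappingCone_triangleh_distinguished φ
  have hiso : IsIso (Qh.map ((HomotopyCategory.quotient C (.up ℤ)).map φ)) := by
    have := (NatIso.isIso_map_iff (quotientCompQhIso C) φ).2 inferInstance
    exact this
  constructor
  · refine (injective_iff_map_eq_zero Qh.mapAddHom).2 fun f (hf : Qh.map f = 0) => ?_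
    have h1 : f ≫ (HomotopyCategory.quotient C (.up ℤ)).map φ = 0 := by
      apply (CochainComplex.IsKInjective.Qh_map_bijective _ E).1
      rw [Functor.map_comp, hf, zero_comp, Functor.map_zero]
    obtain ⟨g, hg⟩ := Triangle.coyoneda_exact₁ _ hT (f⟦(1 : ℤ)⟧') (by
      refine (Functor.map_comp _ _ _).symm.trans ?_
      exact (congrArg _ h1).trans (Functor.map_zero _ _ _))
    have hg0 : g = 0 := by
      rw [← cancel_epi (((HomotopyCategory.quotient C (.up ℤ)).commShiftIso (1 : ℤ)).hom.app K),
        comp_zero]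
      exact hz h₁ _
    apply (shiftFunctor (HomotopyCategory C (.up ℤ)) (1 : ℤ)).map_injective
    exact (hg.trans ((congrArg (fun t => t ≫ _) hg0).trans zero_comp)).trans
      (Functor.map_zero _ _ _).symm
  · intro u
    obtain ⟨g, hg⟩ := (CochainComplex.IsKInjective.Qh_map_bijective _ E).2
      (u ≫ Qh.map ((HomotopyCategory.quotient C (.up ℤ)).map φ))
    obtain ⟨g', rfl⟩ := Triangle.coyoneda_exact₂ _ hT g (hz h₀ _)
    refine ⟨g', ?_⟩
    rw [← cancel_mono (Qh.map ((HomotopyCategory.quotient C (.up ℤ)).map φ)), ← hg]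
    exact (Qh.map_comp _ _).symm

/-- K-injectivity is right orthogonality to the acyclic complexes, a condition that is closed under
cones. -/
lemma isKInjective_mappingCone (φ : K ⟶ L) [K.IsKInjective] [L.IsKInjective] :
    (CochainComplex.mappingCone φ).IsKInjective := by
  rw [CochainComplex.isKInjective_iff_rightOrthogonal]
  exact ObjectProperty.ext_of_isTriangulatedClosed₃ _ _
    (HomotopyCategory.mappingCone_triangleh_distinguished φ)
    (CochainComplex.IsKInjective.rightOrthogonal K)
    (CochainComplex.IsKInjective.rightOrthogonal L)

end Localization

variable {k A : Type u} [Field k] [Ring A] [Algebra k A] {𝒜 : ℤ → Submodule k A}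

section Biproduct

lemma biprod_decomp {M N : GrMod 𝒜} (z : (M ⊞ N : GrMod 𝒜)) :
    Hom.lin (biprod.inl : M ⟶ M ⊞ N) (Hom.lin (biprod.fst : M ⊞ N ⟶ M) z) +
      Hom.lin (biprod.inr : N ⟶ M ⊞ N) (Hom.lin (biprod.snd : M ⊞ N ⟶ N) z) = z :=
  lin_congr (biprod.total (X := M) (Y := N)) z

lemma deg_biprod_eq_bot {M N : GrMod 𝒜} {i : ℤ} (hM : M.deg i = ⊥) (hN : N.deg i = ⊥) :
    (M ⊞ N : GrMod 𝒜).deg i = ⊥ := by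
  rw [eq_bot_iff]
  intro z hz
  have h1 : Hom.lin (biprod.fst : M ⊞ N ⟶ M) z = 0 := by
    have := Hom.map_deg (biprod.fst : M ⊞ N ⟶ M) i z hz
    rwa [hM] at this
  have h2 : Hom.lin (biprod.snd : M ⊞ N ⟶ N) z = 0 := by
    have := Hom.map_deg (biprod.snd : M ⊞ N ⟶ N) i z hz
    rwa [hN] at this
  rw [Submodule.mem_bot, ← biprod_decomp z, h1, h2, map_zero, map_zero, add_zero]

lemma isInjectiveOver_biprod {S : Subalgebra k A} {M N : GrMod 𝒜} (hM : M.IsInjectiveOver S)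
    (hN : N.IsInjectiveOver S) : (M ⊞ N : GrMod 𝒜).IsInjectiveOver S := by
  refine (injective_iff_exists_extension _).2 fun X Y f hf g => ?_
  obtain ⟨h₁, hh₁⟩ := (injective_iff_exists_extension _).1 hM X Y f hf
    (g ≫ resMap S (biprod.fst : M ⊞ N ⟶ M))
  obtain ⟨h₂, hh₂⟩ := (injective_iff_exists_extension _).1 hN X Y f hf
    (g ≫ resMap S (biprod.snd : M ⊞ N ⟶ N))
  refine ⟨h₁ ≫ resMap S (biprod.inl : M ⟶ M ⊞ N) + h₂ ≫ resMap S (biprod.inr : N ⟶ M ⊞ N),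
    fun x => ?_⟩
  have e₁ := congrArg (Hom.lin (biprod.inl : M ⟶ M ⊞ N)) (hh₁ x)
  have e₂ := congrArg (Hom.lin (biprod.inr : N ⟶ M ⊞ N)) (hh₂ x)
  exact (congrArg₂ (fun a b : (M ⊞ N : GrMod 𝒜) => a + b) e₁ e₂).trans
    (biprod_decomp (M := M) (N := N) (show (M ⊞ N : GrMod 𝒜) from g.lin x))

variable {K L : CochainComplex (GrMod 𝒜) ℤ} (φ : K ⟶ L)

lemma isInjectiveOver_mappingCone {S : Subalgebra k A} (hK : ∀ n, (K.X n).IsInjectiveOver S)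
    (hL : ∀ n, (L.X n).IsInjectiveOver S) (n : ℤ) :
    ((CochainComplex.mappingCone φ).X n).IsInjectiveOver S :=
  (isInjectiveOver_biprod (hK (n + 1)) (hL n)).of_iso
    (HomologicalComplex.homotopyCofiber.XIsoBiprod φ n (n + 1) rfl)

lemma wtGE_mappingCone {d : ℤ} (hK : ∀ n, (K.X n).WtGE d) (hL : ∀ n, (L.X n).WtGE d) (n : ℤ) :
    ((CochainComplex.mappingCone φ).X n).WtGE d := fun i hi =>
  (deg_eq_bot_iff_of_iso (HomologicalComplex.homotopyCofiber.XIsoBiprod φ n (n + 1) rfl)).2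
    (deg_biprod_eq_bot (hK _ i hi) (hL _ i hi))

end Biproduct

section Triangular

variable [GradedAlgebra 𝒜] {A0 Ale Age : Subalgebra k A} (h : IsTriangular 𝒜 A0 Ale Age)
  [HasDerivedCategory.{w} (GrMod 𝒜)]

include h

lemma IsTriangular.enoughInjectives : EnoughInjectives (GrMod 𝒜) :=
  have := h.finite
  ⟨fun M => ⟨⟨h.injHull M, h.injective_injHull M, h.injHullι M, inferInstance⟩⟩⟩

/-- Morphisms in the derived category from a bounded complex of `A^{≥0}`-projective modules to a
bounded below complex of `A^{≤0}`-injective modules are homotopy classes of chain maps. -/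
lemma IsTriangular.computesHom {K J : CochainComplex (GrMod 𝒜) ℤ} (a b c : ℤ)
    [K.IsStrictlyGE a] [K.IsStrictlyLE b] [J.IsStrictlyGE c]
    (hK : ∀ n, Projective ((K.X n).res Age)) (hJ : ∀ n, (J.X n).IsInjectiveOver Ale) :
    ComputesHom K J := by
  have := h.finite
  have := h.enoughInjectives
  -- Compare `J` with an injective resolution `E`. Injective modules are `A^{≤0}`-injective, so the
  -- cone of `φ` is an acyclic bounded below complex of `A^{≤0}`-injectives, and all maps from `K`
  -- and its shift to it are null-homotopic.
  obtain ⟨E, φ, _, hE, _⟩ :=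
    CochainComplex.Plus.modelCategoryQuillen.exists_quasiIso_injective J c
  have : E.IsKInjective := CochainComplex.isKInjective_of_injective E c
  have hE' : ∀ n, (E.X n).IsInjectiveOver Ale := fun n =>
    h.half_ge.isInjectiveOver_of_injective (hE n)
  have : (CochainComplex.mappingCone φ).IsStrictlyGE (c - 1) :=
    CochainComplex.isStrictlyGE_mappingCone φ c c (c - 1)
  have := K.isStrictlyGE_shift a 1 (a - 1) (by omega)
  have := K.isStrictlyLE_shift b 1 (b - 1) (by omega)
  exact computesHom_of_mappingCone φ
    (fun f => h.nonempty_homotopy_zero a b (c - 1) hK (acyclic_mappingCone φ)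
      (isInjectiveOver_mappingCone φ hJ hE') f)
    (fun f => h.nonempty_homotopy_zero (a - 1) (b - 1) (c - 1) (fun n => hK (n + 1))
      (acyclic_mappingCone φ) (isInjectiveOver_mappingCone φ hJ hE') f)

end Triangular

end SemiInf

/-! ### Models with weights bounded below for the objects of the generated subcategory. -/

namespace SemiInf

open GrMod DerivedCategory Pretriangulated ZeroObject

variable {k A : Type u} [Field k] [Ring A] [Algebra k A] {𝒜 : ℤ → Submodule k A}

section Model

variable [HasDerivedCategory.{w} (GrMod 𝒜)]

/-- The objects of the derived category that are represented by K-injective complexes whose weights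
are bounded below. -/
def hasWtGEModel (𝒜 : ℤ → Submodule k A) [HasDerivedCategory.{w} (GrMod 𝒜)] :
    ObjectProperty (DerivedCategory (GrMod 𝒜)) := fun Z =>
  ∃ (L : CochainComplex (GrMod 𝒜) ℤ) (d : ℤ), L.IsKInjective ∧ (∀ n, (L.X n).WtGE d) ∧
    Nonempty (Z ≅ Q.obj L)

instance : (hasWtGEModel 𝒜).IsClosedUnderIsomorphisms where
  of_iso e := fun ⟨L, d, h1, h2, ⟨e'⟩⟩ => ⟨L, d, h1, h2, ⟨e.symm ≪≫ e'⟩⟩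

instance : (hasWtGEModel 𝒜).ContainsZero where
  exists_zero := by
    refine ⟨Q.obj 0, Functor.map_isZero _ (isZero_zero _), 0, 0, ⟨fun f _ => ⟨?_⟩⟩,
      fun n i _ => ?_, ⟨Iso.refl _⟩⟩
    · exact Homotopy.ofEq ((isZero_zero _).eq_of_tgt _ _)
    · exact deg_eq_bot_of_isZero (Functor.map_isZero
        (HomologicalComplex.eval (GrMod 𝒜) (.up ℤ) n) (isZero_zero _)) i

instance : (hasWtGEModel 𝒜).IsStableUnderShift ℤ where
  isStableUnderShiftBy n := ⟨fun _ => fun ⟨L, d, _, h2, ⟨e⟩⟩ =>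
    ⟨L⟦n⟧, d, inferInstance, fun p => h2 (p + n),
      ⟨(shiftFunctor _ n).mapIso e ≪≫ ((Q.commShiftIso n).app L).symm⟩⟩⟩

instance : (hasWtGEModel 𝒜).IsTriangulatedClosed₃ :=
  ObjectProperty.IsTriangulatedClosed₃.mk' fun T hT => by
    rintro ⟨L₁, d₁, _, hd₁, ⟨e₁⟩⟩ ⟨L₂, d₂, _, hd₂, ⟨e₂⟩⟩
    -- Between K-injective models the first morphism of the triangle is a chain map, and its cone is
    -- a model of the third object.
    obtain ⟨f, hf⟩ := (computesHom_of_isKInjective (K := L₁) (L := L₂)).exists_map_eq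
      (e₁.inv ≫ T.mor₁ ≫ e₂.hom)
    refine ⟨CochainComplex.mappingCone f, min d₁ d₂, isKInjective_mappingCone f,
      wtGE_mappingCone f (fun n i hi => hd₁ n i (by omega)) (fun n i hi => hd₂ n i (by omega)),
      ⟨?_⟩⟩
    refine Triangle.π₃.mapIso (isoTriangleOfIso₁₂ _ _ hT (mappingCone_triangle_distinguished f)
      e₁ e₂ ?_)
    refine Eq.trans ?_ (congrArg (fun t => e₁.hom ≫ t) hf.symm)
    exact (Iso.hom_inv_id_assoc e₁ (T.mor₁ ≫ e₂.hom)).symm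

instance : (hasWtGEModel 𝒜).IsTriangulated where
  toIsTriangulatedClosed₂ := ObjectProperty.IsTriangulatedClosed₂.of_isTriangulatedClosed₃

end Model

section Triangular

variable [GradedAlgebra 𝒜] {A0 Ale Age : Subalgebra k A} (h : IsTriangular 𝒜 A0 Ale Age)
  [HasDerivedCategory.{w} (GrMod 𝒜)]

lemma shortExact_pushout_inl {N M L : GrMod 𝒜} (f : N ⟶ M) [Mono f] (g : N ⟶ L) (hL : IsZero L) :
    (ShortComplex.mk f (pushout.inl f g) (surjective_pushout_inl f g hL).2).ShortExact where
  exact := (GrMod.exact_iff _).2 fun x hx => by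
    have e : pushout.inl f g ≫ pushout.desc (cokerπ f) 0
        (by rw [comp_cokerπ, comp_zero]) = cokerπ f := pushout.inl_desc _ _ _
    have : (cokerπ f).lin x = 0 := by
      rw [← lin_congr e x, comp_lin]
      exact (congrArg _ hx).trans (map_zero _)
    exact (Submodule.Quotient.mk_eq_zero _).1 this
  mono_f := ‹_›
  epi_g := epi_of_surjective _ (surjective_pushout_inl f g hL).1

include h

/-- Coinducing an `A^{≥0}`-injective module from `A^{≥0}` gives an injective module, with the same
lower bound for the weights. The cokernel of the unit is again `A^{≥0}`-injective, as a quotient of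
such modules, so the process can be iterated: it yields an injective resolution all of whose weights
are at least `d`. -/
lemma IsTriangular.hasWtGEModel_single {M : GrMod 𝒜} (hM : M.IsInjectiveOver Age) :
    hasWtGEModel 𝒜 ((singleFunctor (GrMod 𝒜) 0).obj M) := by
  have := h.finite
  obtain ⟨d, hd⟩ := M.exists_wtGE
  let K := (CochainComplex.singleFunctor (GrMod 𝒜) 0).obj M
  have e : K.X 0 ≅ M := HomologicalComplex.singleObjXSelf (.up ℤ) 0 M
  obtain ⟨J, φ, _, _, hJ⟩ := exists_resolution (fun M => coind h.half_ge.homS (M.res Age))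
    (fun M => coindUnit _ M) K 0 (fun _ N => N.IsInjectiveOver Age ∧ N.WtGE d)
    ⟨hM.of_iso e, fun i hi => (deg_eq_bot_iff_of_iso e).2 (hd i hi)⟩ (by
      rintro n N v ⟨hN, hN'⟩
      have hz : IsZero (K.X (0 + n + 1)) := K.isZero_of_isStrictlyLE 0 _ (by omega)
      have hE := shortExact_pushout_inl (coindUnit h.half_ge.homS N) v hz
      refine ⟨isInjectiveOver_X₃ hE hN
        (h.half_le.isInjectiveOver_of_injective (injective_coind h.half_ge.homS hN)), fun i hi => ?_⟩
      exact deg_pushout_eq_bot _ _ (coind_wtGE h hN' i hi) (deg_eq_bot_of_isZero hz i))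
  have hJ' : ∀ n, Injective (J.X n) ∧ (J.X n).WtGE d := fun n => by
    rcases lt_or_ge n 0 with hn | hn
    · have := J.isZero_of_isStrictlyGE 0 n hn
      exact ⟨this.injective, fun i _ => deg_eq_bot_of_isZero this i⟩
    · obtain ⟨p, rfl⟩ := Int.eq_ofNat_of_zero_le hn
      obtain ⟨N, ⟨hN, hN'⟩, ⟨e⟩⟩ := hJ p
      rw [zero_add] at e
      exact ⟨Injective.of_iso e.symm (injective_coind _ hN),
        fun i hi => (deg_eq_bot_iff_of_iso e).2 (coind_wtGE h hN' i hi)⟩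
  have : ∀ n, Injective (J.X n) := fun n => (hJ' n).1
  exact ⟨J, d, CochainComplex.isKInjective_of_injective J 0, fun n => (hJ' n).2,
    ⟨(singleFunctorIsoCompQ _ 0).app M ≪≫ asIso (Q.map φ)⟩⟩

/-- Having a K-injective model with weights bounded below is a triangulated condition, so it
suffices to check it on the generators. -/
theorem IsTriangular.semiInfProp_le :
    semiInfProp 𝒜 Age ≤ (hasWtGEModel 𝒜).inverseImage Bounded.ι :=
  triangulatedHull_le fun _ ⟨_, hM, ⟨e⟩⟩ =>
    (hasWtGEModel 𝒜).prop_of_iso e.symm (h.hasWtGEModel_single hM)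

end Triangular

end SemiInf

/-! ### Brutal truncations, and bounded complexes of injectives as objects of the generated
subcategory. -/

namespace SemiInf

open GrMod DerivedCategory Pretriangulated ZeroObject

section Truncation

open ComplexShape HomologicalComplex CochainComplex.HomComplex

variable {C : Type*} [Category* C] [Abelian C]

lemma hasLift_embeddingUpIntLE (K : CochainComplex C ℤ) (n : ℤ) :
    (embeddingUpIntLE n).HasLift (𝟙 (restriction K (embeddingUpIntLE n))) := fun j hj i' hi' =>
  (hj.notMem hi' (n - i').toNat (by
    have : i' + 1 = n - j := hi'
    simp
    omega)).elim

/-- The brutal truncation of a complex, which keeps the terms of degree at most `n`. -/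
noncomputable def brutalLE (K : CochainComplex C ℤ) (n : ℤ) : CochainComplex C ℤ :=
  (restriction K (embeddingUpIntLE n)).extend (embeddingUpIntLE n)

instance (K : CochainComplex C ℤ) (n : ℤ) : (brutalLE K n).IsStrictlyLE n :=
  inferInstanceAs (IsStrictlySupported ((restriction K (embeddingUpIntLE n)).extend
    (embeddingUpIntLE n)) (embeddingUpIntLE n))

/-- The projection to the brutal truncation. -/
noncomputable def toBrutalLE (K : CochainComplex C ℤ) (n : ℤ) : K ⟶ brutalLE K n :=
  toRestrict (embeddingUpIntLE n) K (hasLift_embeddingUpIntLE K n)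

lemma isIso_toBrutalLE_f (K : CochainComplex C ℤ) {n i : ℤ} (hi : i ≤ n) :
    IsIso ((toBrutalLE K n).f i) :=
  isIso_toRestrict_f _ K (hasLift_embeddingUpIntLE K n) (n := (n - i).toNat) (by simp; omega)

/-- The terms of the brutal truncation. -/
noncomputable def brutalLEXIso (K : CochainComplex C ℤ) {n i : ℤ} (hi : i ≤ n) :
    K.X i ≅ (brutalLE K n).X i :=
  have := isIso_toBrutalLE_f K hi
  asIso ((toBrutalLE K n).f i)

instance (K : CochainComplex C ℤ) (n a : ℤ) [K.IsStrictlyGE a] :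
    (brutalLE K n).IsStrictlyGE a := by
  rw [CochainComplex.isStrictlyGE_iff]
  intro i hi
  rcases le_or_gt i n with h | h
  · exact (K.isZero_of_isStrictlyGE a i hi).of_iso (brutalLEXIso K h).symm
  · exact (brutalLE K n).isZero_of_isStrictlyLE n i h

instance (K : CochainComplex C ℤ) (n i : ℤ) : Epi ((toBrutalLE K n).f i) := by
  rcases le_or_gt i n with h | h
  · have := isIso_toBrutalLE_f K h
    infer_instance
  · exact ⟨fun _ _ _ => ((brutalLE K n).isZero_of_isStrictlyLE n i h).eq_of_src _ _⟩

instance (K : CochainComplex C ℤ) (n : ℤ) : Epi (toBrutalLE K n) := by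
  refine ⟨fun f g hfg => ?_⟩
  ext i
  rw [← cancel_epi ((toBrutalLE K n).f i), ← HomologicalComplex.comp_f,
    ← HomologicalComplex.comp_f, hfg]

variable {K L : CochainComplex C ℤ} {n : ℤ}

lemma exists_toBrutalLE_comp (f : K ⟶ L) (hf : ∀ i, n < i → f.f i = 0) :
    ∃ g : brutalLE K n ⟶ L, toBrutalLE K n ≫ g = f := by
  have key : ∀ i, ∃ g : (brutalLE K n).X i ⟶ L.X i, (toBrutalLE K n).f i ≫ g = f.f i := by
    intro i
    rcases le_or_gt i n with h | h
    · have := isIso_toBrutalLE_f K h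
      exact ⟨inv ((toBrutalLE K n).f i) ≫ f.f i, by simp⟩
    · exact ⟨0, by rw [hf i h, comp_zero]⟩
  choose g hg using key
  refine ⟨{ f := g, comm' := fun i j _ => ?_ }, ?_⟩
  · rw [← cancel_epi ((toBrutalLE K n).f i), ← Category.assoc, hg, f.comm,
      ← Category.assoc, (toBrutalLE K n).comm, Category.assoc, hg]
  · ext i
    exact hg i

/-- A homotopy on `K` descends to the quotient `brutalLE K n` once its components from degrees above
`n` vanish, and by `hz` there are no nonzero candidates for them. -/
lemma nonempty_homotopy_of_toBrutalLE (f g : brutalLE K n ⟶ L)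
    (h : Homotopy (toBrutalLE K n ≫ f) (toBrutalLE K n ≫ g))
    (hz : ∀ p, n < p → ∀ t : K.X p ⟶ L.X (p - 1), t = 0) : Nonempty (Homotopy f g) := by
  have key : ∀ i j, i + (-1) = j → ∃ t : (brutalLE K n).X i ⟶ L.X j,
      (toBrutalLE K n).f i ≫ t = h.hom i j := by
    intro i j hij
    rcases le_or_gt i n with hi | hi
    · have := isIso_toBrutalLE_f K hi
      exact ⟨inv ((toBrutalLE K n).f i) ≫ h.hom i j, by simp⟩
    · obtain rfl : i - 1 = j := by omega
      exact ⟨0, by rw [hz i hi (h.hom _ _), comp_zero]⟩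
  choose t ht using key
  refine ⟨(Cochain.equivHomotopy f g).symm ⟨Cochain.mk t, ?_⟩⟩
  ext p
  rw [← cancel_epi ((toBrutalLE K n).f p), Cochain.add_v, Cochain.ofHom_v, Cochain.ofHom_v,
    δ_v (-1) 0 (neg_add_cancel 1) (Cochain.mk t) p p (add_zero p) (p - 1) (p + 1) rfl rfl,
    Cochain.mk_v, Cochain.mk_v]
  have h1 := h.comm p
  rw [dNext_eq _ (show (ComplexShape.up ℤ).Rel p (p + 1) from rfl),
    prevD_eq _ (show (ComplexShape.up ℤ).Rel (p - 1) p by simp)] at h1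
  simp only [HomologicalComplex.comp_f] at h1
  rw [h1, Int.negOnePow_zero, one_smul, Preadditive.comp_add, Preadditive.comp_add,
    ← Category.assoc _ (t _ _ _), ht, ← Category.assoc _ ((brutalLE K n).d _ _),
    Hom.comm, Category.assoc, ht, add_comm (h.hom _ _ ≫ _)]

end Truncation

variable {k A : Type u} [Field k] [Ring A] [Algebra k A] {𝒜 : ℤ → Submodule k A}

lemma isInjectiveOver_brutalLE {S : Subalgebra k A} {K : CochainComplex (GrMod 𝒜) ℤ}
    (hK : ∀ i, (K.X i).IsInjectiveOver S) (n i : ℤ) : ((brutalLE K n).X i).IsInjectiveOver S := by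
  rcases le_or_gt i n with h | h
  · exact (hK i).of_iso (brutalLEXIso K h).symm
  · exact isInjectiveOver_of_isZero ((brutalLE K n).isZero_of_isStrictlyLE n i h)

section Hull

variable [HasDerivedCategory.{w} (GrMod 𝒜)]

/-- Completing the first morphism to a triangle inside the bounded derived category gives a triangle
isomorphic to `T`, so closure under extensions there can be tested with triangles of the full
derived category. -/
lemma prop_of_triangle {C : Type*} [Category* C] [Abelian C] [HasDerivedCategory.{w} C]
    (P : ObjectProperty (Bounded C)) [P.IsTriangulated] [P.IsClosedUnderIsomorphisms]
    {X Y Z : Bounded C} (T : Triangle (DerivedCategory C)) (hT : T ∈ distTriang _)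
    (e₁ : X.obj ≅ T.obj₁) (e₂ : Y.obj ≅ T.obj₂) (e₃ : Z.obj ≅ T.obj₃) (hX : P X) (hZ : P Z) :
    P Y := by
  let f : X ⟶ Y := ObjectProperty.homMk (e₁.hom ≫ T.mor₁ ≫ e₂.inv)
  obtain ⟨W, g, δ, hT'⟩ := distinguished_cocone_triangle f
  have hT'' := (Bounded.ι (C := C)).map_distinguished _ hT'
  let e : T ≅ _ := isoTriangleOfIso₁₂ _ _ hT hT'' e₁.symm e₂.symm (by
    refine Eq.trans ?_ (congrArg (fun t => e₁.inv ≫ t) (rfl : e₁.hom ≫ T.mor₁ ≫ e₂.inv = _))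
    exact (Iso.inv_hom_id_assoc e₁ _).symm)
  have hW : P W := P.prop_of_iso
    ((Bounded.ι (C := C)).preimageIso (e₃ ≪≫ Triangle.π₃.mapIso e)) hZ
  exact P.ext_of_isTriangulatedClosed₂ _ hT' hX hW

/-- The object of the bounded derived category given by a bounded complex. -/
noncomputable def boundedObj {C : Type*} [Category* C] [Abelian C] [HasDerivedCategory.{w} C]
    (K : CochainComplex C ℤ) (a b : ℤ) [K.IsStrictlyGE a] [K.IsStrictlyLE b] : Bounded C where
  obj := Q.obj K
  property := ⟨⟨a, inferInstanceAs (IsGE (Q.obj K) a)⟩, ⟨b, inferInstanceAs (IsLE (Q.obj K) b)⟩⟩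

instance (S : Subalgebra k A) : (semiInfProp 𝒜 S).IsClosedUnderIsomorphisms :=
  inferInstanceAs (triangulatedHull _).IsClosedUnderIsomorphisms

lemma semiInfProp_single {S : Subalgebra k A} {M : GrMod 𝒜} (hM : M.IsInjectiveOver S) (n : ℤ)
    (Z : Bounded (GrMod 𝒜)) (e : Z.obj ≅ (singleFunctor (GrMod 𝒜) n).obj M) :
    semiInfProp 𝒜 S Z := by
  have h0 : semiInfProp 𝒜 S (Z⟦n⟧) := le_triangulatedHull _ _ ⟨M, hM, ⟨
    ((Bounded.ι (C := GrMod 𝒜)).commShiftIso n).app Z ≪≫ (shiftFunctor _ n).mapIso e ≪≫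
      ((singleFunctors (GrMod 𝒜)).shiftIso n 0 n (by omega)).app M⟩⟩
  exact (semiInfProp 𝒜 S).prop_of_iso ((shiftEquiv _ n).unitIso.symm.app Z)
    ((semiInfProp 𝒜 S).le_shift (-n) _ h0)

/-- Induction on a bound `m` for the number of terms: the complex is an extension of its truncation
below the last degree `b` by the last term, placed in degree `b`. -/
lemma semiInfProp_of_bounded {S : Subalgebra k A} (m : ℕ) :
    ∀ (K : CochainComplex (GrMod 𝒜) ℤ) (a b : ℤ) [K.IsStrictlyGE a] [K.IsStrictlyLE b]
      (_ : b < a + m) (_ : ∀ i, (K.X i).IsInjectiveOver S) (Z : Bounded (GrMod 𝒜))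
      (_ : Z.obj ≅ Q.obj K), semiInfProp 𝒜 S Z := by
  induction m with
  | zero =>
    intro K a b _ _ hab hK Z e
    have hK0 : IsZero K := by
      rw [IsZero.iff_id_eq_zero]
      ext i : 1
      rcases lt_or_ge i a with hi | hi
      · exact (K.isZero_of_isStrictlyGE a i hi).eq_of_src _ _
      · exact (K.isZero_of_isStrictlyLE b i (by simp at hab; omega)).eq_of_src _ _
    have hZ : IsZero Z := by
      rw [IsZero.iff_id_eq_zero]
      apply (Bounded.ι (C := GrMod 𝒜)).map_injective
      exact ((Functor.map_isZero Q hK0).of_iso e).eq_of_src _ _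
    obtain ⟨Z', hZ', h'⟩ := (semiInfProp 𝒜 S).exists_prop_of_containsZero
    exact (semiInfProp 𝒜 S).prop_of_iso (hZ'.iso hZ) h'
  | succ m ih =>
    intro K a b _ _ hab hK Z e
    let T := brutalLE K (b - 1)
    let π : K ⟶ T := toBrutalLE K (b - 1)
    let C : ShortComplex (CochainComplex (GrMod 𝒜) ℤ) :=
      ShortComplex.mk (kernel.ι π) π (kernel.condition π)
    have hC : C.ShortExact :=
      { exact := ShortComplex.exact_kernel π
        mono_f := inferInstanceAs (Mono (kernel.ι π))
        epi_g := inferInstanceAs (Epi (toBrutalLE K (b - 1))) }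
    have hmono : ∀ i, Mono ((kernel.ι π).f i) := fun i =>
      inferInstanceAs (Mono ((HomologicalComplex.eval _ _ i).map (kernel.ι π)))
    -- The kernel of the projection to the truncation is concentrated in degree `b`: below `b` the
    -- projection is an isomorphism, above `b` the complex is zero.
    have hz : ∀ i, i ≠ b → IsZero ((kernel π).X i) := fun i hi => by
      rcases lt_or_gt_of_ne hi with h | h
      · have : IsIso (π.f i) := isIso_toBrutalLE_f K (by omega)
        have h0 : (kernel.ι π).f i = 0 := by
          rw [← cancel_mono (π.f i), ← HomologicalComplex.comp_f, kernel.condition, zero_comp]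
          rfl
        exact IsZero.of_mono_eq_zero _ h0
      · exact IsZero.of_mono ((kernel.ι π).f i) (K.isZero_of_isStrictlyLE b i h)
    have : (kernel π).IsStrictlyGE b :=
      (CochainComplex.isStrictlyGE_iff _ _).2 fun i hi => hz i (by omega)
    have : (kernel π).IsStrictlyLE b :=
      (CochainComplex.isStrictlyLE_iff _ _).2 fun i hi => hz i (by omega)
    obtain ⟨M, ⟨eM⟩⟩ := CochainComplex.exists_iso_single (kernel π) b
    have hM : M.IsInjectiveOver S := by
      have e1 : K.X b ≅ (kernel π).X b := by
        have hs := hC.map_of_exact (HomologicalComplex.eval (GrMod 𝒜) (.up ℤ) b)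
        have : IsIso ((kernel.ι π).f b) := hs.isIso_f_iff.2
          ((brutalLE K (b - 1)).isZero_of_isStrictlyLE (b - 1) b (by omega))
        exact (asIso ((kernel.ι π).f b)).symm
      exact (hK b).of_iso ((e1 ≪≫ (HomologicalComplex.eval (GrMod 𝒜) (.up ℤ) b).mapIso eM ≪≫
        HomologicalComplex.singleObjXSelf (.up ℤ) b M).symm)
    exact prop_of_triangle (semiInfProp 𝒜 S) (X := boundedObj (kernel π) b b)
      (Z := boundedObj T a (b - 1)) _ (triangleOfSES_distinguished hC) (Iso.refl _) e (Iso.refl _)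
      (semiInfProp_single hM b _ (Q.mapIso eM ≪≫ (singleFunctorIsoCompQ _ b).symm.app M))
      (ih T a (b - 1) (by push_cast at hab; omega) (isInjectiveOver_brutalLE hK _) _ (Iso.refl _))

end Hull

end SemiInf

/-! ### Self-injective algebras are cogenerators. -/

namespace SemiInf

section Kasch

/-- Injectivity applied to the embedding of `X` modulo the kernel of `f`. -/
lemma exists_linearMap_comp_eq {R Q : Type u} [Ring R] [AddCommGroup Q] [Module R Q]
    (hQ : Module.Injective R Q) {X Y : Type u} [AddCommGroup X] [AddCommGroup Y] [Module R X]
    [Module R Y] (f : X →ₗ[R] Y) (g : X →ₗ[R] Q) (hfg : ∀ x, f x = 0 → g x = 0) :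
    ∃ φ : Y →ₗ[R] Q, ∀ x, φ (f x) = g x := by
  obtain ⟨φ, hφ⟩ := hQ.out ((LinearMap.ker f).liftQ f le_rfl)
    (LinearMap.ker_eq_bot.1 (Submodule.ker_liftQ_eq_bot _ _ _ le_rfl))
    ((LinearMap.ker f).liftQ g hfg)
  exact ⟨φ, fun x => hφ (Submodule.Quotient.mk x)⟩

lemma exists_idempotent_generator {B : Type*} [Ring B] [IsSemisimpleRing B] (L : Ideal B) :
    ∃ p ∈ L, p * p = p ∧ ∀ x ∈ L, x * p = x := by
  obtain ⟨p, hp, rfl⟩ := IsSemisimpleRing.ideal_eq_span_idempotent L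
  refine ⟨p, Ideal.mem_span_singleton_self p, hp, fun x hx => ?_⟩
  obtain ⟨a, rfl⟩ := Ideal.mem_span_singleton'.1 hx
  rw [mul_assoc, hp.eq]

/-- A two-sided ideal `B p` satisfies `p * b * p = p * b`. The defect `b * p - p * b * p` lies in a
left ideal with square zero, and in a semisimple ring such an ideal vanishes. -/
lemma exists_central_idempotent_generator {B : Type*} [Ring B] [IsSemisimpleRing B] (L : Ideal B)
    [L.IsTwoSided] : ∃ p ∈ L, p * p = p ∧ (∀ x ∈ L, x * p = x) ∧ ∀ b, b * p = p * b := by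
  obtain ⟨p, hpL, hp, hL⟩ := exists_idempotent_generator L
  refine ⟨p, hpL, hp, hL, fun b => ?_⟩
  have h1 : ∀ a, p * a * p = p * a := fun a => hL _ (L.mul_mem_right a hpL)
  -- Products of elements of `N` vanish, because `x * y = x * p * y = 0`; so its idempotent
  -- generator is zero.
  let N : Ideal B :=
    { carrier := {x | x * p = x ∧ p * x = 0}
      add_mem' := fun {x y} hx hy => ⟨by rw [add_mul, hx.1, hy.1], by rw [mul_add, hx.2, hy.2, add_zero]⟩
      zero_mem' := ⟨zero_mul _, mul_zero _⟩
      smul_mem' := fun c x hx => ⟨by rw [smul_eq_mul, mul_assoc, hx.1], by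
        rw [smul_eq_mul, ← mul_assoc, ← h1, mul_assoc, hx.2, mul_zero]⟩ }
  obtain ⟨q, hq, hqq, hN⟩ := exists_idempotent_generator N
  have hq0 : q = 0 := by rw [← hqq, show q * q = q * p * q by rw [hq.1], mul_assoc, hq.2, mul_zero]
  have hb : b * p - p * b * p ∈ N :=
    ⟨by rw [sub_mul, mul_assoc, hp, mul_assoc (p * b), hp], by
      rw [mul_sub, ← mul_assoc, ← mul_assoc, ← mul_assoc, hp, sub_self]⟩
  have h0 := hN _ hb
  rw [hq0, mul_zero] at h0
  rw [sub_eq_zero.1 h0.symm, h1]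

variable {R B : Type u} [Ring R] [Ring B] [IsSemisimpleRing B] {ι : B →+* R} {J : Ideal R}
  [J.IsTwoSided]

/-- Take a nonzero element of the last nonzero module among the `J ^ n • m`. -/
lemma exists_ne_zero_of_nilpotent (hJ : IsNilpotent J) {M : Type*} [AddCommGroup M] [Module R M]
    {m : M} (hm : m ≠ 0) : ∃ r : R, r • m ≠ 0 ∧ ∀ j ∈ J, j • r • m = 0 := by
  obtain ⟨n, hn⟩ := hJ
  have key : ∀ n : ℕ, (∀ r ∈ J ^ n, r • m = 0) →
      ∃ r : R, r • m ≠ 0 ∧ ∀ j ∈ J, j • r • m = 0 := by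
    intro n
    induction n with
    | zero => exact fun h => absurd (by simpa using h 1 (by rw [Submodule.pow_zero, Ideal.one_eq_top]; exact Submodule.mem_top)) hm
    | succ n ih =>
      intro h
      by_cases hn : ∀ r ∈ J ^ n, r • m = 0
      · exact ih hn
      · push Not at hn
        obtain ⟨r, hr, hrm⟩ := hn
        refine ⟨r, hrm, fun j hj => ?_⟩
        rw [← mul_smul]
        exact h _ (by rw [Ideal.IsTwoSided.pow_succ]; exact Ideal.mul_mem_mul hj hr)
  exact key n fun r hr => by
    rw [hn] at hr
    rw [show r = 0 from hr, zero_smul]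

/-- A cyclic module that is annihilated by `J` and by `f` maps to any right ideal of the socle
whose annihilator is generated by `f`. -/
lemma exists_socle_element (hι : ∀ r : R, ∃ b, r - ι b ∈ J) {M : Type*} [AddCommGroup M]
    [Module R M] {v : M} (hv : v ≠ 0) (hJv : ∀ j ∈ J, j • v = 0) {f : B}
    (hf : ∀ b, b * f = f * b) (hfv : ι f • v = 0)
    (H : ∀ b, (∀ z, (∀ j ∈ J, j * z = 0) → ι b * (z * ι (1 - f)) = 0) → b * f = b) :
    ∃ z, (∀ j ∈ J, j * z = 0) ∧ z * ι (1 - f) ≠ 0 ∧ ∀ r : R, r • v = 0 → r * (z * ι (1 - f)) = 0 := by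
  let L : Ideal B :=
    { carrier := {b | ι b • v = 0}
      add_mem' := fun {a b} ha hb => by
        simp only [Set.mem_ofPred_eq, map_add, add_smul] at ha hb ⊢
        rw [ha, hb, add_zero]
      zero_mem' := by simp
      smul_mem' := fun c b hb => by
        simp only [Set.mem_ofPred_eq, smul_eq_mul, map_mul, mul_smul] at hb ⊢
        rw [hb, smul_zero] }
  obtain ⟨p, hpL, hp, hL⟩ := exists_idempotent_generator L
  -- The annihilator of `v` in `B` is `B p`. It contains `f`, so `(1 - p) * f = 0`, whereas `1 - p ≠
  -- 0` since `v ≠ 0`. Hence by `H` the element `1 - p` does not kill the socle times `1 - f`; the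
  -- element sought is `ι (1 - p) * z`, which is killed on the left by everything that kills `v`.
  have h1 : (1 - p) * f ≠ 1 - p := by
    rw [hf, mul_sub, mul_one, hL f hfv, sub_self]
    intro h0
    have : ι p • v = 0 := hpL
    rw [← sub_eq_zero.1 h0.symm, map_one, one_smul] at this
    exact hv this
  obtain ⟨z, hz, hz'⟩ : ∃ z, (∀ j ∈ J, j * z = 0) ∧ ι (1 - p) * (z * ι (1 - f)) ≠ 0 := by
    by_contra! h0
    exact h1 (H _ h0)
  have hJz : ∀ j ∈ J, j * (ι (1 - p) * z) = 0 := fun j hj => by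
    rw [← mul_assoc]
    exact hz _ (J.mul_mem_right _ hj)
  refine ⟨ι (1 - p) * z, hJz, by rwa [mul_assoc], fun r hr => ?_⟩
  obtain ⟨b, hb⟩ := hι r
  have hbv : ι b • v = 0 := by
    have := hJv _ hb
    rwa [sub_smul, hr, zero_sub, neg_eq_zero] at this
  have h2 : ι b * ι (1 - p) = 0 := by
    rw [← map_mul, mul_sub, mul_one, hL b hbv, sub_self, map_zero]
  rw [← sub_add_cancel r (ι b), add_mul, ← mul_assoc _ _ (ι (1 - f)), hJz _ hb, zero_mul, zero_add,
    ← mul_assoc, ← mul_assoc, h2, zero_mul, zero_mul]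

/-- In a self-injective algebra, a central idempotent `e` of the semisimple part such that
`e * soc R * (1 - e) = 0` generates the annihilator of `soc R * (1 - e)`. -/
lemma annihilator_socle (k : Type u) [Field k] [Algebra k R] [FiniteDimensional k R]
    (hinj : Module.Injective R R) (hι : ∀ r : R, ∃ b, r - ι b ∈ J)
    (hι' : Function.Injective ι) (hJ : IsNilpotent J) (e : B) (he : e * e = e)
    (hc : ∀ b, b * e = e * b)
    (hsoc : ∀ z, (∀ j ∈ J, j * z = 0) → ι e * (z * ι (1 - e)) = 0) (b : B)
    (hb : ∀ z, (∀ j ∈ J, j * z = 0) → ι b * (z * ι (1 - e)) = 0) : b * e = b := by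
  -- The annihilator is generated by a central idempotent `f` with `e * f = e`. If `f ≠ e`, then `f`
  -- generates a larger ideal and satisfies the same hypotheses, so the claim may be assumed for
  -- `f`; the difference `f - e` is then shown to be a nilpotent idempotent.
  induction hI : Ideal.span {e} using WellFoundedGT.induction generalizing e b with
  | _ I ih => ?_
  subst hI
  let L : Ideal B :=
    { carrier := {b | ∀ z, (∀ j ∈ J, j * z = 0) → ι b * (z * ι (1 - e)) = 0}
      add_mem' := fun {a b} ha hb z hz => by rw [map_add, add_mul, ha z hz, hb z hz, add_zero]
      zero_mem' := fun z _ => by rw [map_zero, zero_mul]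
      smul_mem' := fun c b hb z hz => by
        rw [smul_eq_mul, map_mul, mul_assoc, hb z hz, mul_zero] }
  have hL2 : L.IsTwoSided := ⟨fun {a} c ha z hz => by
    rw [map_mul, mul_assoc, ← mul_assoc (ι c)]
    exact ha _ fun j hj => by
      rw [← mul_assoc]
      exact hz _ (J.mul_mem_right _ hj)⟩
  obtain ⟨f, hfL, hf, hL, hfc⟩ := exists_central_idempotent_generator L
  have hef : e * f = e := hL e hsoc
  have hfe : f * e = e := by rw [hc, hef]
  suffices hg : f - e = 0 by
    rw [← sub_eq_zero.1 hg]
    exact hL b hb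
  by_contra hne
  have hlt : Ideal.span {e} < Ideal.span {f} := by
    rw [lt_iff_le_and_ne]
    refine ⟨(Ideal.span_singleton_le_iff_mem _).2 (Ideal.mem_span_singleton'.2 ⟨e, hef⟩), ?_⟩
    intro h
    have hfm : f ∈ Ideal.span {e} := h ▸ Ideal.mem_span_singleton_self f
    obtain ⟨a, ha⟩ := Ideal.mem_span_singleton'.1 hfm
    apply hne
    rw [← hfe, ← ha, mul_assoc, he, ha, sub_self]
  have h1e : (1 - e) * (1 - f) = 1 - f := by
    rw [sub_mul, one_mul, mul_sub, mul_one, hef, sub_self, sub_zero]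
  have IH := fun b hb => ih _ hlt f hf hfc (fun z hz => by
    rw [← h1e, map_mul, ← mul_assoc, ← mul_assoc, mul_assoc (ι f), hfL z hz, zero_mul]) b hb rfl
  have hge : (f - e) * (1 - e) = f - e := by
    rw [mul_sub, mul_one, sub_mul, hfe, he, sub_self, sub_zero]
  have hgf : (f - e) * (1 - f) = 0 := by
    rw [mul_sub, mul_one, sub_mul, hf, hef, sub_self]
  -- Modulo `J` the element `r` lies in `B`, where `1 - f` is central and `(f - e) * (1 - f) = 0`.
  have hgJ : ∀ r, ι (f - e) * (r * ι (1 - f)) ∈ J := fun r => by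
    obtain ⟨c, hc'⟩ := hι r
    have h0 : ι (f - e) * (ι c * ι (1 - f)) = 0 := by
      rw [← map_mul, ← map_mul, mul_sub, mul_one, hfc, ← one_sub_mul, ← mul_assoc,
        hgf, zero_mul, map_zero]
    rw [← sub_add_cancel r (ι c), add_mul, mul_add, h0, add_zero]
    exact J.mul_mem_left _ (J.mul_mem_right _ hc')
  let β := Module.finBasis k R
  -- The aim is to write `f - e` as a combination, with right coefficients, of the elements `(f - e)
  -- * β j * (1 - f)` of `J`. By self-injectivity it is enough that whatever kills all these
  -- elements from the left also kills `f - e`.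
  obtain ⟨φ, hφ⟩ := exists_linearMap_comp_eq hinj
    (LinearMap.pi fun j => LinearMap.toSpanSingleton R R (ι (f - e) * (β j * ι (1 - f))))
    (LinearMap.toSpanSingleton R R (ι (f - e))) (fun x hx => by
      by_contra h0
      have hx' : ∀ r, x * (ι (f - e) * (r * ι (1 - f))) = 0 := fun r => by
        rw [← β.sum_repr r, Finset.sum_mul, Finset.mul_sum, Finset.mul_sum]
        refine Finset.sum_eq_zero fun j _ => ?_
        rw [smul_mul_assoc, mul_smul_comm, mul_smul_comm]
        exact (congrArg _ (congrFun hx j)).trans (smul_zero _)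
      obtain ⟨a, ha, haJ⟩ := exists_ne_zero_of_nilpotent hJ h0
      set v : R := a • LinearMap.toSpanSingleton R R (ι (f - e)) x with hv
      have hva : v = a * (x * ι (f - e)) := rfl
      have hfv : ι f • v = 0 := by
        have := hfL v haJ
        rwa [hva, mul_assoc, mul_assoc, ← map_mul, hge, ← hva] at this
      -- The nonzero socle element `v` is killed by `f`, as `v = v * (1 - e)`. So by the induction
      -- hypothesis there is a nonzero `z * (1 - f)` in the socle whose left annihilator contains
      -- that of `v`. By self-injectivity it is a right multiple of `v`, but `v * R * (1 - f) = 0`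
      -- by the choice of `x`.
      obtain ⟨z, hz, hz0, hzv⟩ := exists_socle_element hι ha haJ hfc hfv IH
      obtain ⟨ψ, hψ⟩ := exists_linearMap_comp_eq hinj (LinearMap.toSpanSingleton R R v)
        (LinearMap.toSpanSingleton R R (z * ι (1 - f))) hzv
      have h2 := hψ 1
      rw [LinearMap.toSpanSingleton_apply_one, LinearMap.toSpanSingleton_apply_one] at h2
      have h3 : v * ψ 1 = z * ι (1 - f) := by rw [← h2, ← smul_eq_mul, ← map_smul, smul_eq_mul, mul_one]
      have h4 : v * ψ 1 * ι (1 - f) = 0 := by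
        rw [hva, mul_assoc, mul_assoc, mul_assoc, hx', mul_zero]
      rw [h3, mul_assoc, ← map_mul, mul_sub, mul_one, sub_mul, hf, one_mul, sub_self, sub_zero] at h4
      exact hz0 h4)
  have hg : ι (f - e) ∈ J := by
    have h1 := hφ 1
    rw [LinearMap.toSpanSingleton_apply_one] at h1
    rw [← h1, LinearMap.pi_apply_eq_sum_univ φ]
    refine sum_mem fun j _ => J.mul_mem_right _ ?_
    rw [LinearMap.pi_apply, LinearMap.toSpanSingleton_apply_one]
    exact hgJ _
  -- An idempotent in a nilpotent ideal is zero.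
  obtain ⟨n, hn⟩ := hJ
  have hpow : ∀ n : ℕ, ι (f - e) ∈ J ^ n := fun n => by
    induction n with
    | zero =>
      rw [Submodule.pow_zero, Ideal.one_eq_top]
      exact Submodule.mem_top
    | succ n ih =>
      have : ι (f - e) = ι (f - e) * ι (f - e) := by
        rw [← map_mul, sub_mul, mul_sub, mul_sub, hf, he, hef, hfe, sub_self, sub_zero]
      rw [this, Ideal.IsTwoSided.pow_succ]
      exact Ideal.mul_mem_mul hg ih
  have h0 := hpow n
  rw [hn] at h0
  exact hne (hι' (by rw [map_zero]; exact h0))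

/-- A self-injective algebra with a semisimple complement of a nilpotent ideal is a cogenerator. -/
lemma exists_linearMap_apply_ne_zero (hinj : Module.Injective R R)
    (hι : ∀ r : R, ∃ b, r - ι b ∈ J) (hι' : Function.Injective ι) (hJ : IsNilpotent J)
    (k : Type u) [Field k] [Algebra k R] [FiniteDimensional k R]
    {M : Type u} [AddCommGroup M] [Module R M] {m : M} (hm : m ≠ 0) :
    ∃ φ : M →ₗ[R] R, φ m ≠ 0 := by
  obtain ⟨r, hr, hJr⟩ := exists_ne_zero_of_nilpotent hJ hm
  -- With the idempotent `0`, `annihilator_socle` says that no nonzero element of `B` kills the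
  -- socle of `R`. So the module spanned by a socle element of `M` maps nontrivially to `R`, and the
  -- map extends to `M` by self-injectivity.
  obtain ⟨z, _, hz0, hz⟩ := exists_socle_element (f := 0) hι hr hJr (by simp) (by simp)
    (fun b hb => annihilator_socle k hinj hι hι' hJ 0 (by simp) (by simp) (by simp) b hb)
  obtain ⟨φ, hφ⟩ := exists_linearMap_comp_eq hinj (LinearMap.toSpanSingleton R M (r • m))
    (LinearMap.toSpanSingleton R R (z * ι (1 - 0))) hz
  refine ⟨φ, fun h0 => hz0 ?_⟩
  have h1 := hφ 1
  rw [LinearMap.toSpanSingleton_apply_one, LinearMap.toSpanSingleton_apply_one, map_smul, h0,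
    smul_zero] at h1
  exact h1.symm

end Kasch

/-! ### Injective and projective graded modules over the nonnegative part. -/

section SelfInjective

open GrMod

variable {k A : Type u} [Field k] [Ring A] [Algebra k A] {𝒜 : ℤ → Submodule k A}

/-- A homogeneous linear map, as a morphism to a shifted module. -/
noncomputable def homShiftDeg {M N : GrMod 𝒜} (h𝒜 : ⨆ i, 𝒜 i = ⊤) (φ : M →ₗ[A] N) (d : ℤ) :
    M ⟶ shiftDeg N d where
  lin := degPart (N := N) h𝒜 φ d
  map_deg _ _ hx := degPart_mem (M := M) (N := N) h𝒜 φ d hx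

lemma exists_homShiftDeg_ne_zero {M N : GrMod 𝒜} (h𝒜 : ⨆ i, 𝒜 i = ⊤) (φ : M →ₗ[A] N) {x : M}
    (hx : φ x ≠ 0) : ∃ d : ℤ, (homShiftDeg h𝒜 φ d).lin x ≠ 0 := by
  by_contra h0
  apply hx
  rw [← sum_degPart h𝒜 φ, LinearMap.sum_apply]
  exact Finset.sum_eq_zero fun d _ => not_not.1 (not_exists.1 h0 d)

variable [GradedAlgebra 𝒜] {A0 Ale Age : Subalgebra k A} (h : IsTriangular 𝒜 A0 Ale Age)

/-- The nonnegative part of the algebra, as a graded module over itself. -/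
noncomputable def IsTriangular.regularGE : GrMod (subGrading 𝒜 Age) :=
  have := h.finite
  regular (subGrading 𝒜 Age) (isInternal_subGrading 𝒜 Age h.homogeneous_ge)
    (subGrading_mul_mem 𝒜 Age)

/-- The homogeneous components of an element of the nonnegative part of the algebra. -/
noncomputable def IsTriangular.part (i : ℤ) : Age →ₗ[k] Age := h.regularGE.proj i

lemma IsTriangular.part_mem (i : ℤ) (r : Age) : h.part i r ∈ subGrading 𝒜 Age i :=
  h.regularGE.proj_mem i r

lemma IsTriangular.part_eq_zero {i : ℤ} (hi : i < 0) (r : Age) : h.part i r = 0 :=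
  h.eq_zero_of_mem_ge hi (h.part_mem i r)

/-- Lower bounds for degrees add up under multiplication. This makes `weightGE` a multiplicative
filtration of `A^{≥0}`. -/
lemma IsTriangular.proj_smul_eq_zero {M : GrMod (subGrading 𝒜 Age)} {a n : ℤ} {r : Age} {x : M}
    (hr : ∀ i < a, h.part i r = 0) (hx : ∀ i < n, M.proj i x = 0) {i : ℤ}
    (hi : i < a + n) : M.proj i (r • x) = 0 := by
  have key : ∀ j l, M.proj i (h.part j r • M.proj l x) = 0 := fun j l => by
    by_cases hj : j < a
    · rw [hr j hj, zero_smul, map_zero]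
    by_cases hl : l < n
    · rw [hx l hl, smul_zero, map_zero]
    have : i ≠ j + l := by omega
    exact M.proj_of_mem_ne this (M.smul_mem j l _ _ (h.part_mem j r) (M.proj_mem l x))
  have h1 : ∀ l, M.proj i (r • M.proj l x) = 0 := fun l => by
    have h2 : r = ∑ j ∈ h.regularGE.wts, h.part j r := (h.regularGE.sum_proj r).symm
    rw [h2, Finset.sum_smul, map_sum]
    exact Finset.sum_eq_zero fun j _ => key j l
  rw [← M.sum_proj x, Finset.smul_sum, map_sum]
  exact Finset.sum_eq_zero fun l _ => h1 l

/-- The elements of the nonnegative part of the algebra without components of degree `< n`. -/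
def IsTriangular.weightGE (n : ℤ) : Ideal Age where
  carrier := {x | ∀ i < n, h.part i x = 0}
  add_mem' hx hy i hi := by rw [map_add, hx i hi, hy i hi, add_zero]
  zero_mem' i _ := map_zero _
  smul_mem' r x hx i hi := h.proj_smul_eq_zero (M := h.regularGE)
    (fun _ hj => h.part_eq_zero hj r) hx (hi.trans_eq (zero_add n).symm)

/-- The nonnegative part of the algebra, as a graded module over itself, with weights moved down
by `d`. -/
noncomputable def IsTriangular.free (d : ℤ) : GrMod (subGrading 𝒜 Age) := shiftDeg h.regularGE d

/-- Ungraded self-injectivity is enough, since graded extensions are obtained from ungraded ones. -/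
lemma IsTriangular.injective_free (d : ℤ) : Injective (h.free d) :=
  injective_of_exists_linear_extension h.homogeneous_ge _ fun _ _ f hf g =>
    h.selfInjective.out f.lin hf g.lin

/-- The morphism from a free module that is given by an element. -/
noncomputable def IsTriangular.freeHom {M : GrMod (subGrading 𝒜 Age)} {d : ℤ} {x : M}
    (hx : x ∈ M.deg (-d)) : h.free d ⟶ M where
  lin := LinearMap.toSpanSingleton Age M x
  map_deg i r hr := by
    have := M.smul_mem (i + d) (-d) r x hr hx
    rwa [add_neg_cancel_right] at this

lemma IsTriangular.one_mem_free (d : ℤ) : (1 : Age) ∈ (h.free d).deg (-d) := by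
  change (1 : A) ∈ 𝒜 (-d + d)
  rw [neg_add_cancel]
  exact SetLike.GradedOne.one_mem (A := 𝒜)

lemma IsTriangular.projective_free (d : ℤ) : Projective (h.free d) where
  factors {X Y} f e _ := by
    obtain ⟨x, hx, hxy⟩ := exists_mem_deg_of_surjective e (surjective_of_epi e)
      (f.map_deg (-d) (1 : Age) (h.one_mem_free d))
    refine ⟨h.freeHom hx, hom_ext fun (r : Age) => ?_⟩
    refine (map_smul e.lin r x).trans ?_
    rw [hxy]
    exact (map_smul f.lin r (1 : Age)).symm.trans (congrArg f.lin (mul_one r))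

include h

/-- The cogenerator property applies with `J` the positive part of `A^{≥0}`, which is nilpotent
because the degrees are bounded, and with `A^0` as its semisimple complement. -/
lemma IsTriangular.exists_linearMap_ne_zero {M : GrMod (subGrading 𝒜 Age)} {x : M} (hx : x ≠ 0) :
    ∃ φ : M →ₗ[Age] Age, φ x ≠ 0 := by
  have := h.finite
  have := h.semisimple
  have hJ2 : (h.weightGE 1).IsTwoSided := ⟨fun {a} c ha i hi =>
    h.proj_smul_eq_zero (M := h.regularGE) ha (fun j hj => h.part_eq_zero hj c)
      (hi.trans_eq (add_zero 1).symm)⟩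
  have hpow : ∀ n : ℕ, h.weightGE 1 ^ n ≤ h.weightGE n := fun n => by
    induction n with
    | zero => exact fun r _ i hi => h.part_eq_zero hi r
    | succ n ih =>
      rw [Ideal.IsTwoSided.pow_succ, Ideal.mul_le]
      intro r hr s hs i hi
      refine h.proj_smul_eq_zero (M := h.regularGE) hr (ih hs) (hi.trans_eq ?_)
      push_cast
      ring
  have hJ : IsNilpotent (h.weightGE 1) := by
    obtain ⟨d, hd⟩ := h.regularGE.exists_wtLE
    refine ⟨(d + 1).toNat, le_bot_iff.1 fun r hr => eq_zero_of_proj (M := h.regularGE) fun i => ?_⟩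
    by_cases hi : d < i
    · have := h.regularGE.proj_mem i r
      rwa [hd i hi] at this
    · exact hpow _ hr i (by have := Int.self_le_toNat (d + 1); omega)
  refine exists_linearMap_apply_ne_zero (J := h.weightGE 1) h.selfInjective
    (ι := (Subalgebra.inclusion (h.zero_eq.le.trans inf_le_right) : A0 →ₐ[k] Age).toRingHom)
    (fun r => ?_) (Subalgebra.inclusion_injective _) hJ k hx
  have h0 : (h.part 0 r : A) ∈ Subalgebra.toSubmodule A0 := by
    rw [h.zero_eq_ge]
    exact ⟨(h.part 0 r).2, h.part_mem 0 r⟩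
  refine ⟨⟨_, h0⟩, fun i hi => ?_⟩
  refine (map_sub (h.part i) r (h.part 0 r)).trans ?_
  rcases (Int.lt_add_one_iff.1 (hi.trans_eq (zero_add 1).symm)).lt_or_eq with hi | rfl
  · rw [h.part_eq_zero hi, h.part_eq_zero hi, sub_zero]
  · rw [sub_eq_zero]
    exact (h.regularGE.proj_of_mem (h.part_mem 0 r)).symm

lemma IsTriangular.exists_hom_free {M : GrMod (subGrading 𝒜 Age)} {x : M} (hx : x ≠ 0) :
    ∃ (d : ℤ) (f : M ⟶ h.free d), f.lin x ≠ 0 := by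
  obtain ⟨φ, hφ⟩ := h.exists_linearMap_ne_zero hx
  obtain ⟨d, hd⟩ := exists_homShiftDeg_ne_zero (N := h.regularGE)
    (iSup_subGrading 𝒜 Age h.homogeneous_ge) φ hφ
  exact ⟨d, _, hd⟩

/-- Choose a map to a projective module with minimal kernel. A nonzero element of the kernel would
be detected by a map to a shifted free module, and adding that module to the target would shrink the
kernel. -/
lemma IsTriangular.exists_mono (M : GrMod (subGrading 𝒜 Age)) :
    ∃ (P : GrMod (subGrading 𝒜 Age)) (f : M ⟶ P), Projective P ∧ Mono f := by
  obtain ⟨_, ⟨P, f, hP, rfl⟩, hmin⟩ := wellFounded_lt.has_min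
    {K : Submodule k M | ∃ (P : GrMod (subGrading 𝒜 Age)) (f : M ⟶ P), Projective P ∧
      (LinearMap.ker f.lin).restrictScalars k = K} ⟨_, h.free 0, 0, h.projective_free 0, rfl⟩
  refine ⟨P, f, hP, mono_of_injective f ((injective_iff_map_eq_zero _).2 fun x hx => ?_)⟩
  by_contra hx0
  obtain ⟨d, g, hg⟩ := h.exists_hom_free hx0
  have := h.projective_free d
  have h1 : ∀ y, (biprod.lift f g).lin y = 0 → f.lin y = 0 ∧ g.lin y = 0 := fun y hy => by
    have h1 := lin_congr (biprod.lift_fst f g) y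
    have h2 := lin_congr (biprod.lift_snd f g) y
    rw [comp_lin, hy, map_zero] at h1 h2
    exact ⟨h1.symm, h2.symm⟩
  refine hmin _ ⟨P ⊞ h.free d, biprod.lift f g, inferInstance, rfl⟩ (lt_of_le_not_ge ?_ ?_)
  · exact fun y hy => (h1 y hy).1
  · exact fun hle => hg (h1 x (hle hx)).2

/-- Choose a map from an injective module with maximal range. Shifted free modules are injective, so
a homogeneous element outside the range could be added to it. -/
lemma IsTriangular.exists_epi (M : GrMod (subGrading 𝒜 Age)) :
    ∃ (P : GrMod (subGrading 𝒜 Age)) (f : P ⟶ M), Injective P ∧ Epi f := by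
  obtain ⟨_, ⟨P, f, hP, rfl⟩, hmax⟩ := wellFounded_gt.has_min
    {K : Submodule k M | ∃ (P : GrMod (subGrading 𝒜 Age)) (f : P ⟶ M), Injective P ∧
      rng f = K} ⟨_, h.free 0, 0, h.injective_free 0, rfl⟩
  refine ⟨P, f, hP, epi_of_surjective f fun x => ?_⟩
  have key : ∀ i, ∀ x ∈ M.deg i, x ∈ rng f := fun i x hx => by
    by_contra hx0
    rw [← neg_neg i] at hx
    have := h.injective_free (-i)
    refine hmax _ ⟨P ⊞ h.free (-i), biprod.desc f (h.freeHom hx), inferInstance, rfl⟩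
      (lt_of_le_not_ge ?_ ?_)
    · rintro _ ⟨y, rfl⟩
      exact ⟨(biprod.inl : P ⟶ P ⊞ h.free (-i)).lin y, lin_congr (biprod.inl_desc f _) y⟩
    · exact fun hle => hx0 (hle ⟨(biprod.inr : h.free (-i) ⟶ P ⊞ h.free (-i)).lin (1 : Age),
        (lin_congr (biprod.inr_desc f (h.freeHom hx)) (1 : Age)).trans (one_smul Age x)⟩)
  rw [← M.sum_proj x]
  exact (sum_mem fun i _ => key i _ (M.proj_mem i x) : _ ∈ rng f)

/-- A module is injective over the nonnegative part of the algebra if and only if it is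
projective over it. -/
theorem IsTriangular.isInjectiveOver_iff_projective (M : GrMod 𝒜) :
    M.IsInjectiveOver Age ↔ Projective (M.res Age) := by
  constructor
  · intro hM
    have : Injective (M.res Age) := hM
    obtain ⟨P, f, hP, hf⟩ := h.exists_mono (M.res Age)
    exact Retract.projective ⟨f, Injective.factorThru (𝟙 _) f, Injective.comp_factorThru _ _⟩
  · intro hM
    obtain ⟨P, f, hP, hf⟩ := h.exists_epi (M.res Age)
    exact Retract.injective ⟨Projective.factorThru (𝟙 _) f, f, Projective.factorThru_comp _ _⟩

end SelfInjective

end SemiInf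

/-! ### Vanishing of maps in high degrees and the classification of diagrams. -/

namespace SemiInf

open GrMod DerivedCategory CochainComplex.HomComplex

variable {k A : Type u} [Field k] [Ring A] [Algebra k A] {𝒜 : ℤ → Submodule k A}

section Weights

lemma IsConvex.exists_wtLE {K : CochainComplex (GrMod 𝒜) ℤ} (hK : IsConvex K) (d : ℤ) :
    ∃ N, ∀ p, N ≤ p → (K.X p).WtLE d := by
  obtain ⟨N, hN⟩ := ((hK d).image Prod.fst).bddAbove
  refine ⟨N + 1, fun p hp i hi => ?_⟩
  by_contra H
  have := hN ⟨(p, i), ⟨hi, H⟩, rfl⟩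
  dsimp only at this
  omega

lemma IsConcave.exists_wtGE {K : CochainComplex (GrMod 𝒜) ℤ} (hK : IsConcave K) (d : ℤ) :
    ∃ N, ∀ p, N ≤ p → (K.X p).WtGE d := by
  obtain ⟨N, hN⟩ := ((hK d).image Prod.fst).bddAbove
  refine ⟨N + 1, fun p hp i hi => ?_⟩
  by_contra H
  have := hN ⟨(p, i), ⟨hi, H⟩, rfl⟩
  dsimp only at this
  omega

lemma hom_eq_zero_of_wt {M N : GrMod 𝒜} {d : ℤ} (hM : M.WtLE (d - 1)) (hN : N.WtGE d)
    (f : M ⟶ N) : f = 0 :=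
  hom_eq_zero_of_deg (fun i => (lt_or_ge i d).symm.imp (fun h => hM i (by omega)) (hN i)) f

/-- In high degrees all weights of `K` are less than `d` and those of `L` at least `d`, so graded
maps between any such terms vanish. -/
lemma IsConvex.exists_hom_eq_zero {K L : CochainComplex (GrMod 𝒜) ℤ} (hK : IsConvex K) {d : ℤ}
    (hL : ∃ N, ∀ p, N ≤ p → (L.X p).WtGE d) :
    ∃ N, ∀ p q, N ≤ p → N ≤ q → ∀ f : K.X p ⟶ L.X q, f = 0 := by
  obtain ⟨N, hN⟩ := hK.exists_wtLE (d - 1)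
  obtain ⟨N', hN'⟩ := hL
  exact ⟨max N N', fun p q hp hq f =>
    hom_eq_zero_of_wt (hN p (by omega)) (hN' q (by omega)) f⟩

end Weights

/-! ### Factoring morphisms through brutal truncations. -/

section Colimit

variable {C : Type*} [Category* C] [Abelian C] {K L : CochainComplex C ℤ}

/-- The transition map between brutal truncations. -/
lemma exists_brutalLE_transition (K : CochainComplex C ℤ) {m n : ℤ} (hmn : n ≤ m) :
    ∃ τ : brutalLE K m ⟶ brutalLE K n, toBrutalLE K m ≫ τ = toBrutalLE K n :=
  exists_toBrutalLE_comp _ fun i hi =>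
    ((brutalLE K n).isZero_of_isStrictlyLE n i (by omega)).eq_of_tgt _ _

lemma exists_factor_brutalLE {N : ℤ} (hN : ∀ p q, N ≤ p → N ≤ q → ∀ f : K.X p ⟶ L.X q, f = 0)
    (f : K ⟶ L) {n : ℤ} (hn : N ≤ n) : ∃ g : brutalLE K n ⟶ L, toBrutalLE K n ≫ g = f :=
  exists_toBrutalLE_comp f fun i hi => hN i i (by omega) (by omega) _

lemma nonempty_homotopy_brutalLE {N : ℤ}
    (hN : ∀ p q, N ≤ p → N ≤ q → ∀ f : K.X p ⟶ L.X q, f = 0) {n : ℤ} (hn : N ≤ n)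
    {f g : brutalLE K n ⟶ L} (H : Homotopy (toBrutalLE K n ≫ f) (toBrutalLE K n ≫ g)) :
    Nonempty (Homotopy f g) :=
  nonempty_homotopy_of_toBrutalLE f g H fun p hp => hN p (p - 1) (by omega) (by omega)

variable [HasDerivedCategory.{w} C] [L.IsKInjective]

/-- A morphism to a K-injective complex is a chain map, and it vanishes above `n`. With the next
lemma, this says that morphisms from `K` to `Z` are the same as morphisms from its `n`-th
truncation, for all large `n`. -/
lemma exists_Q_factor_brutalLE {N : ℤ}
    (hN : ∀ p q, N ≤ p → N ≤ q → ∀ f : K.X p ⟶ L.X q, f = 0) {Z : DerivedCategory C}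
    (e : Z ≅ Q.obj L) (v : Q.obj K ⟶ Z) {n : ℤ} (hn : N ≤ n) :
    ∃ u : Q.obj (brutalLE K n) ⟶ Z, Q.map (toBrutalLE K n) ≫ u = v := by
  obtain ⟨f, hf⟩ := (computesHom_of_isKInjective (K := K) (L := L)).exists_map_eq (v ≫ e.hom)
  obtain ⟨g, rfl⟩ := exists_factor_brutalLE hN f hn
  refine ⟨Q.map g ≫ e.inv, ?_⟩
  rw [← Category.assoc, ← Functor.map_comp, hf, Category.assoc, e.hom_inv_id, Category.comp_id]

/-- Both morphisms are chain maps to `L` that become homotopic on `K`; the homotopy vanishes above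
`n`, so it descends. -/
lemma Q_hom_ext_brutalLE {N : ℤ}
    (hN : ∀ p q, N ≤ p → N ≤ q → ∀ f : K.X p ⟶ L.X q, f = 0) {Z : DerivedCategory C}
    (e : Z ≅ Q.obj L) {n : ℤ} (hn : N ≤ n) {u u' : Q.obj (brutalLE K n) ⟶ Z}
    (h : Q.map (toBrutalLE K n) ≫ u = Q.map (toBrutalLE K n) ≫ u') : u = u' := by
  obtain ⟨g, hg⟩ := (computesHom_of_isKInjective (L := L)).exists_map_eq (u ≫ e.hom)
  obtain ⟨g', hg'⟩ := (computesHom_of_isKInjective (L := L)).exists_map_eq (u' ≫ e.hom)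
  obtain ⟨H⟩ := (computesHom_of_isKInjective (K := K) (L := L)).nonempty_homotopy
    (f := toBrutalLE K n ≫ g) (g := toBrutalLE K n ≫ g') (by
      rw [Functor.map_comp, Functor.map_comp, hg, hg', ← Category.assoc, h, Category.assoc])
  obtain ⟨H'⟩ := nonempty_homotopy_brutalLE hN hn H
  rw [← cancel_mono e.hom, ← hg, ← hg']
  exact Q_map_eq_of_homotopy _ H'

end Colimit

section Classes

variable [GradedAlgebra 𝒜] {A0 Ale Age : Subalgebra k A} [HasDerivedCategory.{w} (GrMod 𝒜)]

/-- The shift of a resolution. -/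
noncomputable def ConcaveResolution.shift {S : Subalgebra k A} {Y : Bounded (GrMod 𝒜)}
    (J : ConcaveResolution S Y) (i : ℤ) : ConcaveResolution S (Y⟦i⟧) where
  cx := J.cx⟦i⟧
  boundedBelow := by
    obtain ⟨n, hn⟩ := J.boundedBelow
    exact ⟨n - i, J.cx.isStrictlyGE_shift n i (n - i) (by omega)⟩
  concave n := by
    have : Function.Injective fun q : ℤ × ℤ => (q.1 + i, q.2) := fun q r h => by
      simp only [Prod.mk.injEq, add_left_inj] at h
      exact Prod.ext h.1 h.2
    exact (J.concave n).preimage this.injOn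
  injective n := J.injective (n + i)
  iso := J.shiftIso i

variable {X Y : Bounded (GrMod 𝒜)} (I : ConvexResolution Age X) (J : ConcaveResolution Ale Y)

lemma ConvexResolution.semiInfProp_brutalLE (n : ℤ) (Z : Bounded (GrMod 𝒜))
    (e : Z.obj ≅ Q.obj (brutalLE I.cx n)) : semiInfProp 𝒜 Age Z := by
  obtain ⟨a, ha⟩ := I.boundedBelow
  refine semiInfProp_of_bounded (n - a + 1).toNat (brutalLE I.cx n) a n ?_
    (isInjectiveOver_brutalLE I.injective n) Z e
  have := Int.self_le_toNat (n - a + 1)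
  omega

/-- The brutal truncation of a resolution, as an object of the subcategory generated by the
injective modules. -/
noncomputable def ConvexResolution.trunc (n : ℤ) : (semiInfProp 𝒜 Age).FullSubcategory :=
  have := I.boundedBelow.choose_spec
  ⟨boundedObj (brutalLE I.cx n) I.boundedBelow.choose n,
    I.semiInfProp_brutalLE n (boundedObj (brutalLE I.cx n) I.boundedBelow.choose n) (Iso.refl _)⟩

variable {I J} in
/-- The diagram `X ⟶ σ_{≤ n} I ⟶ Y` that is given by a chain map. -/
noncomputable def diagram {n : ℤ} (g : brutalLE I.cx n ⟶ J.cx) : HomThroughInjectives Age X Y :=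
  HomThrough.mk (I.trunc n) (ObjectProperty.homMk (I.iso.inv ≫ Q.map (toBrutalLE I.cx n)))
    (ObjectProperty.homMk (Q.map g ≫ J.iso.hom))

variable {I J}

/-- The homotopy class of a chain map that is defined on a brutal truncation. -/
noncomputable def truncClass {n : ℤ} (g : brutalLE I.cx n ⟶ J.cx) :
    (HomotopyCategory.quotient (GrMod 𝒜) (.up ℤ)).obj I.cx ⟶
      (HomotopyCategory.quotient (GrMod 𝒜) (.up ℤ)).obj J.cx :=
  (HomotopyCategory.quotient _ _).map (toBrutalLE I.cx n ≫ g)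

lemma truncClass_comp {m n : ℤ} {τ : brutalLE I.cx m ⟶ brutalLE I.cx n}
    (hτ : toBrutalLE I.cx m ≫ τ = toBrutalLE I.cx n) (g : brutalLE I.cx n ⟶ J.cx) :
    truncClass (τ ≫ g) = truncClass g := by
  rw [truncClass, truncClass, ← hτ, Category.assoc]

lemma diagram_comp {m n : ℤ} {τ : brutalLE I.cx m ⟶ brutalLE I.cx n}
    (hτ : toBrutalLE I.cx m ≫ τ = toBrutalLE I.cx n) (g : brutalLE I.cx n ⟶ J.cx) :
    diagram (τ ≫ g) = diagram g := by
  refine HomThrough.sound (ObjectProperty.homMk (ObjectProperty.homMk (Q.map τ))) ?_ ?_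
  · apply ObjectProperty.hom_ext
    refine (Category.assoc _ _ _).trans (congrArg (fun t => I.iso.inv ≫ t) ?_)
    exact (Q.map_comp _ _).symm.trans (congrArg Q.map hτ)
  · apply ObjectProperty.hom_ext
    refine (Category.assoc _ _ _).symm.trans (congrArg (fun t => t ≫ J.iso.hom) ?_)
    exact (Q.map_comp _ _).symm

lemma exists_truncClass_eq (c : (HomotopyCategory.quotient (GrMod 𝒜) (.up ℤ)).obj I.cx ⟶
    (HomotopyCategory.quotient (GrMod 𝒜) (.up ℤ)).obj J.cx) :
    ∃ (n : ℤ) (g : brutalLE I.cx n ⟶ J.cx), truncClass g = c := by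
  obtain ⟨f, rfl⟩ := (HomotopyCategory.quotient (GrMod 𝒜) (.up ℤ)).map_surjective c
  obtain ⟨N, hN⟩ := I.convex.exists_hom_eq_zero (J.concave.exists_wtGE 0)
  obtain ⟨g, rfl⟩ := exists_factor_brutalLE hN f le_rfl
  exact ⟨N, g, rfl⟩

/-- A diagram `X ⟶ Z ⟶ Y` is represented by a chain map `σ_{≤ n} I ⟶ J`. -/
def Represents (d : ThroughDiagram (semiInfProp 𝒜 Age).ι X Y) {n : ℤ}
    (g : brutalLE I.cx n ⟶ J.cx) : Prop :=
  ∃ u : Q.obj (brutalLE I.cx n) ⟶ d.mid.obj.obj,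
    Q.map (toBrutalLE I.cx n) ≫ u = I.iso.hom ≫ d.fst.hom ∧ u ≫ d.snd.hom = Q.map g ≫ J.iso.hom

lemma Represents.of_hom {d d' : ThroughDiagram (semiInfProp 𝒜 Age).ι X Y} (m : d ⟶ d') {n : ℤ}
    {g : brutalLE I.cx n ⟶ J.cx} (hg : Represents d g) : Represents d' g := by
  obtain ⟨u, h1, h2⟩ := hg
  refine ⟨u ≫ m.map.hom.hom, ?_, ?_⟩
  · rw [← Category.assoc, h1, Category.assoc]
    exact congrArg (fun t => I.iso.hom ≫ InducedCategory.Hom.hom t) m.fst_comp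
  · rw [Category.assoc, ← h2]
    exact congrArg (fun t => u ≫ InducedCategory.Hom.hom t) m.comp_snd

lemma Represents.comp {d : ThroughDiagram (semiInfProp 𝒜 Age).ι X Y} {m n : ℤ}
    {τ : brutalLE I.cx m ⟶ brutalLE I.cx n} (hτ : toBrutalLE I.cx m ≫ τ = toBrutalLE I.cx n)
    {g : brutalLE I.cx n ⟶ J.cx} (hg : Represents d g) : Represents d (τ ≫ g) := by
  obtain ⟨u, h1, h2⟩ := hg
  refine ⟨Q.map τ ≫ u, ?_, ?_⟩
  · rw [← Category.assoc, ← Functor.map_comp, hτ, h1]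
  · rw [Category.assoc, h2, Functor.map_comp, Category.assoc]

lemma represents_diagram {n : ℤ} (g : brutalLE I.cx n ⟶ J.cx) :
    Represents (⟨I.trunc n, ObjectProperty.homMk (I.iso.inv ≫ Q.map (toBrutalLE I.cx n)),
      ObjectProperty.homMk (Q.map g ≫ J.iso.hom)⟩ :
        ThroughDiagram (semiInfProp 𝒜 Age).ι X Y) g :=
  ⟨𝟙 _, (Category.comp_id _).trans (Iso.hom_inv_id_assoc I.iso _).symm, Category.id_comp _⟩

/-- The map `u` is itself a morphism of diagrams from the truncated resolution. -/
lemma Represents.mk_eq {d : ThroughDiagram (semiInfProp 𝒜 Age).ι X Y} {n : ℤ}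
    {g : brutalLE I.cx n ⟶ J.cx} (hg : Represents d g) :
    HomThrough.mk d.mid d.fst d.snd = diagram g := by
  obtain ⟨u, h1, h2⟩ := hg
  refine (HomThrough.sound (ObjectProperty.homMk (ObjectProperty.homMk u)) ?_ ?_).symm
  · apply ObjectProperty.hom_ext
    refine (Category.assoc _ _ _).trans ?_
    exact (congrArg (fun t => I.iso.inv ≫ t) h1).trans (Iso.inv_hom_id_assoc I.iso _)
  · exact ObjectProperty.hom_ext _ h2

variable (h : IsTriangular 𝒜 A0 Ale Age)

include h

/-- The truncation is bounded with `A^{≥0}`-injective, hence `A^{≥0}`-projective, terms. -/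
lemma IsTriangular.computesHom_brutalLE (n : ℤ) : ComputesHom (brutalLE I.cx n) J.cx := by
  obtain ⟨a, _⟩ := I.boundedBelow
  obtain ⟨c, _⟩ := J.boundedBelow
  exact h.computesHom a n c
    (fun i => (h.isInjectiveOver_iff_projective _).1 (isInjectiveOver_brutalLE I.injective n i))
    J.injective

/-- The middle object has a K-injective model with weights bounded below, so the first arrow factors
through a truncation of the convex complex. The resulting morphism from the truncation to `Y` is a
chain map to `J` by `computesHom_brutalLE`. -/
lemma IsTriangular.exists_represents (d : ThroughDiagram (semiInfProp 𝒜 Age).ι X Y) :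
    ∃ (n : ℤ) (g : brutalLE I.cx n ⟶ J.cx), Represents d g := by
  obtain ⟨L, w, _, hw, ⟨e⟩⟩ := h.semiInfProp_le _ d.mid.property
  obtain ⟨N, hN⟩ := I.convex.exists_hom_eq_zero (L := L) ⟨0, fun p _ => hw p⟩
  obtain ⟨u, hu⟩ := exists_Q_factor_brutalLE hN e (I.iso.hom ≫ d.fst.hom) le_rfl
  obtain ⟨g, hg⟩ := (h.computesHom_brutalLE (I := I) (J := J) N).exists_map_eq
    (u ≫ d.snd.hom ≫ J.iso.inv)
  refine ⟨N, g, u, hu, ?_⟩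
  rw [hg, Category.assoc, Category.assoc, J.iso.inv_hom_id]
  exact congrArg _ (Category.comp_id _).symm

/-- After passing to a common, sufficiently large truncation, the factorization through the middle
object is unique, and so is the chain map up to homotopy. -/
lemma IsTriangular.truncClass_eq_of_represents {d : ThroughDiagram (semiInfProp 𝒜 Age).ι X Y}
    {n n' : ℤ} {g : brutalLE I.cx n ⟶ J.cx} {g' : brutalLE I.cx n' ⟶ J.cx} (hg : Represents d g)
    (hg' : Represents d g') : truncClass g = truncClass g' := by
  obtain ⟨L, w, _, hw, ⟨e⟩⟩ := h.semiInfProp_le _ d.mid.property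
  obtain ⟨N, hN⟩ := I.convex.exists_hom_eq_zero (L := L) ⟨0, fun p _ => hw p⟩
  obtain ⟨τ, hτ⟩ := exists_brutalLE_transition I.cx (le_max_left n (max n' N))
  obtain ⟨τ', hτ'⟩ := exists_brutalLE_transition I.cx
    ((le_max_left n' N).trans (le_max_right n (max n' N)))
  obtain ⟨u, h1, h2⟩ := hg.comp hτ
  obtain ⟨u', h1', h2'⟩ := hg'.comp hτ'
  obtain rfl : u = u' := Q_hom_ext_brutalLE hN e (by omega) (h1.trans h1'.symm)
  have hQ : Q.map (τ ≫ g) = Q.map (τ' ≫ g') := by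
    rw [← cancel_mono J.iso.hom, ← h2, h2']
  obtain ⟨H⟩ := (h.computesHom_brutalLE _).nonempty_homotopy hQ
  rw [← truncClass_comp hτ, ← truncClass_comp hτ']
  exact HomotopyCategory.eq_of_homotopy _ _ (H.compLeft _)

lemma IsTriangular.diagram_eq_iff {n n' : ℤ} {g : brutalLE I.cx n ⟶ J.cx}
    {g' : brutalLE I.cx n' ⟶ J.cx} : diagram g = diagram g' ↔ truncClass g = truncClass g' := by
  constructor
  · intro e
    -- Being represented by a map of the given class is invariant under morphisms of diagrams in
    -- both directions, so it is a property of connected components.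
    let F : HomThroughInjectives Age X Y → Prop := HomThrough.lift
      (fun d => ∃ (m : ℤ) (f : brutalLE I.cx m ⟶ J.cx), Represents d f ∧
        truncClass f = truncClass g)
      fun d d' m => propext ⟨fun ⟨n, f, h1, h2⟩ => ⟨n, f, h1.of_hom m, h2⟩, fun ⟨n, f, h1, h2⟩ => by
        obtain ⟨n', f', hf'⟩ := h.exists_represents (I := I) (J := J) d
        exact ⟨n', f', hf', (h.truncClass_eq_of_represents (hf'.of_hom m) h1).trans h2⟩⟩
    have h1 : F (diagram g) := ⟨n, g, represents_diagram g, rfl⟩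
    rw [e] at h1
    obtain ⟨m, f, hf, hf'⟩ := h1
    exact hf'.symm.trans (h.truncClass_eq_of_represents hf (represents_diagram g'))
  · intro e
    -- A homotopy between the maps on the whole resolution descends to a truncation beyond `N`; the
    -- weight `0` is an arbitrary place to separate convex from concave.
    obtain ⟨N, hN⟩ := I.convex.exists_hom_eq_zero (J.concave.exists_wtGE 0)
    obtain ⟨τ, hτ⟩ := exists_brutalLE_transition I.cx (le_max_left n (max n' N))
    obtain ⟨τ', hτ'⟩ := exists_brutalLE_transition I.cx
      ((le_max_left n' N).trans (le_max_right n (max n' N)))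
    rw [← diagram_comp hτ, ← diagram_comp hτ']
    rw [← truncClass_comp hτ, ← truncClass_comp hτ'] at e
    obtain ⟨H⟩ := nonempty_homotopy_brutalLE hN (by omega) (HomotopyCategory.homotopyOfEq _ _ e)
    rw [diagram, diagram, Q_map_eq_of_homotopy _ H]

lemma IsTriangular.exists_diagram_eq (t : HomThroughInjectives Age X Y) :
    ∃ (n : ℤ) (g : brutalLE I.cx n ⟶ J.cx), diagram g = t := by
  induction t using HomThrough.ind with
  | _ Z f s => ?_
  obtain ⟨n, g, hg⟩ := h.exists_represents (I := I) (J := J) ⟨Z, f, s⟩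
  exact ⟨n, g, hg.mk_eq.symm⟩

variable (I J)

/-- The morphisms through the subcategory generated by the injective modules are the homotopy
classes of chain maps between the resolutions. -/
noncomputable def IsTriangular.homThroughEquiv : HomThroughInjectives Age X Y ≃+
    ((HomotopyCategory.quotient (GrMod 𝒜) (.up ℤ)).obj I.cx ⟶
      (HomotopyCategory.quotient (GrMod 𝒜) (.up ℤ)).obj J.cx) := by
  choose n g hg using h.exists_diagram_eq (I := I) (J := J)
  refine AddEquiv.ofBijective (AddMonoidHom.mk' (fun t => truncClass (g t)) fun s t => ?_) ⟨?_, ?_⟩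
  · obtain ⟨τ, hτ⟩ := exists_brutalLE_transition I.cx (le_max_left (n s) (n t))
    obtain ⟨τ', hτ'⟩ := exists_brutalLE_transition I.cx (le_max_right (n s) (n t))
    rw [← truncClass_comp hτ, ← truncClass_comp hτ' (g t)]
    have e : truncClass (τ ≫ g s) + truncClass (τ' ≫ g t) = truncClass (τ ≫ g s + τ' ≫ g t) := by
      rw [truncClass, truncClass, truncClass, Preadditive.comp_add, Functor.map_add]
    rw [e, ← h.diagram_eq_iff, hg]
    conv_lhs => rw [← hg s, ← hg t, ← diagram_comp hτ, ← diagram_comp hτ']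
    -- On a common truncation the two diagrams share their first arrow, so their sum is formed on
    -- the second arrows alone.
    refine (HomThrough.mk_add_mk_same _ _ _ _).trans (congrArg (HomThrough.mk _ _) ?_)
    apply ObjectProperty.hom_ext
    refine (Preadditive.add_comp _ _ _ _ _ _).symm.trans ?_
    exact congrArg (fun t => t ≫ J.iso.hom) (Q.map_add).symm
  · intro s t e
    rw [← hg s, ← hg t]
    exact h.diagram_eq_iff.2 e
  · intro c
    obtain ⟨m, f, rfl⟩ := exists_truncClass_eq c
    exact ⟨diagram f, h.diagram_eq_iff.1 (hg _)⟩

variable {I J}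

lemma IsTriangular.homThroughEquiv_diagram {n : ℤ} (g : brutalLE I.cx n ⟶ J.cx) :
    h.homThroughEquiv I J (diagram g) = truncClass g :=
  h.diagram_eq_iff.1 (h.exists_diagram_eq (diagram g)).choose_spec.choose_spec

lemma IsTriangular.homThroughEquiv_mk {d : ThroughDiagram (semiInfProp 𝒜 Age).ι X Y} {n : ℤ}
    {g : brutalLE I.cx n ⟶ J.cx} (hg : Represents d g) :
    h.homThroughEquiv I J (HomThrough.mk d.mid d.fst d.snd) = truncClass g := by
  rw [hg.mk_eq, h.homThroughEquiv_diagram]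

/-- The chain map `a` descends to the `n`-th truncations, so composing a representative with it
represents the new diagram. -/
lemma IsTriangular.homThroughEquiv_precomp {X' : Bounded (GrMod 𝒜)} (f : X' ⟶ X)
    {I' : ConvexResolution Age X'} (a : I'.cx ⟶ I.cx)
    (ha : Q.map a ≫ I.iso.hom = I'.iso.hom ≫ f.hom) (t : HomThroughInjectives Age X Y) :
    h.homThroughEquiv I' J (t.precomp f) =
      (HomotopyCategory.quotient _ _).map a ≫ h.homThroughEquiv I J t := by
  induction t using HomThrough.ind with
  | _ Z p s => ?_
  obtain ⟨n, g, hg⟩ := h.exists_represents (I := I) (J := J) ⟨Z, p, s⟩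
  obtain ⟨a', ha'⟩ := exists_toBrutalLE_comp (n := n) (a ≫ toBrutalLE I.cx n) fun i hi =>
    ((brutalLE I.cx n).isZero_of_isStrictlyLE n i hi).eq_of_tgt _ _
  have hr : Represents (I := I') (J := J) ⟨Z, f ≫ p, s⟩ (a' ≫ g) := by
    obtain ⟨u, h1, h2⟩ := hg
    refine ⟨Q.map a' ≫ u, ?_, ?_⟩
    · rw [← Category.assoc, ← Functor.map_comp, ha', Functor.map_comp, Category.assoc, h1,
        ← Category.assoc, ha]
      exact Category.assoc _ _ _
    · rw [Category.assoc, h2, Functor.map_comp, Category.assoc]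
  refine (h.homThroughEquiv_mk hr).trans ?_
  rw [h.homThroughEquiv_mk hg, truncClass, truncClass, ← Functor.map_comp, ← Category.assoc, ha',
    Category.assoc]

lemma IsTriangular.homThroughEquiv_postcomp {Y' : Bounded (GrMod 𝒜)} (f : Y ⟶ Y')
    {J' : ConcaveResolution Ale Y'} (b : J.cx ⟶ J'.cx)
    (hb : Q.map b ≫ J'.iso.hom = J.iso.hom ≫ f.hom) (t : HomThroughInjectives Age X Y) :
    h.homThroughEquiv I J' (t.postcomp f) =
      h.homThroughEquiv I J t ≫ (HomotopyCategory.quotient _ _).map b := by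
  induction t using HomThrough.ind with
  | _ Z p s => ?_
  obtain ⟨n, g, hg⟩ := h.exists_represents (I := I) (J := J) ⟨Z, p, s⟩
  have hr : Represents (I := I) (J := J') ⟨Z, p, s ≫ f⟩ (g ≫ b) := by
    obtain ⟨u, h1, h2⟩ := hg
    refine ⟨u, h1, ?_⟩
    rw [Functor.map_comp, Category.assoc, hb, ← Category.assoc, ← h2]
    exact (Category.assoc _ _ _).symm
  refine (h.homThroughEquiv_mk hr).trans ?_
  rw [h.homThroughEquiv_mk hg, truncClass, truncClass, ← Functor.map_comp, Category.assoc]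

/-- As `K` vanishes above `n`, the map `p` factors through the `n`-th truncation; composed with `q`,
the factor represents the diagram. -/
lemma IsTriangular.homThroughEquiv_of_bounded (Z : (semiInfProp 𝒜 Age).FullSubcategory)
    (K : CochainComplex (GrMod 𝒜) ℤ) (n : ℤ) [K.IsStrictlyLE n] (c : Q.obj K ≅ Z.obj.obj)
    (p : I.cx ⟶ K) (q : K ⟶ J.cx) :
    h.homThroughEquiv I J (HomThrough.mk Z
      (ObjectProperty.homMk (I.iso.inv ≫ Q.map p ≫ c.hom))
      (ObjectProperty.homMk (c.inv ≫ Q.map q ≫ J.iso.hom))) =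
      (HomotopyCategory.quotient _ _).map (p ≫ q) := by
  obtain ⟨p', rfl⟩ := exists_toBrutalLE_comp (n := n) p fun i hi =>
    (K.isZero_of_isStrictlyLE n i hi).eq_of_tgt _ _
  refine (h.homThroughEquiv_mk (n := n) (g := p' ≫ q) (d := ⟨Z, _, _⟩)
    ⟨Q.map p' ≫ c.hom, ?_, ?_⟩).trans ?_
  · refine Eq.trans ?_ (Iso.hom_inv_id_assoc I.iso _).symm
    rw [Functor.map_comp, Category.assoc]
  · refine (Category.assoc _ _ _).trans ?_
    rw [Q.map_comp p' q, Category.assoc]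
    exact congrArg (fun t => Q.map p' ≫ t) (Iso.hom_inv_id_assoc c (Q.map q ≫ J.iso.hom))
  · rw [truncClass, Category.assoc]

end Classes

end SemiInf

/-! ### Shifts and the comparison with cohomology classes. -/

namespace SemiInf

section Comparison

open DerivedCategory CochainComplex.HomComplex

variable {k A : Type u} [Field k] [Ring A] [Algebra k A] {𝒜 : ℤ → Submodule k A}
  [GradedAlgebra 𝒜] {A0 Ale Age : Subalgebra k A} [HasDerivedCategory.{w} (GrMod 𝒜)]

lemma ConcaveResolution.shiftIso_naturality {S : Subalgebra k A} {Y Y' : Bounded (GrMod 𝒜)}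
    {J : ConcaveResolution S Y} {J' : ConcaveResolution S Y'} (g : Y ⟶ Y') (b : J.cx ⟶ J'.cx)
    (hb : Q.map b ≫ J'.iso.hom = J.iso.hom ≫ g.hom) (i : ℤ) :
    Q.map (b⟦i⟧') ≫ (J'.shift i).iso.hom = (J.shift i).iso.hom ≫ (g⟦i⟧').hom := by
  have h1 := (Q.commShiftIso i).hom.naturality b
  have h2 := ((Bounded.ι (C := GrMod 𝒜)).commShiftIso i).inv.naturality g
  have h3 := congrArg (fun t => t⟦i⟧') hb
  simp only [Functor.map_comp] at h3
  refine (Category.assoc _ _ _).symm.trans ?_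
  refine (congrArg (fun t => t ≫ _) h1).trans ?_
  refine (Category.assoc _ _ _).trans (Eq.trans ?_ (Category.assoc _ _ _).symm)
  refine congrArg (fun t => (Q.commShiftIso i).hom.app J.cx ≫ t) ?_
  refine (Category.assoc _ _ _).symm.trans ?_
  refine (congrArg (fun t => t ≫ _) h3).trans ?_
  refine (Category.assoc _ _ _).trans (Eq.trans ?_ (Category.assoc _ _ _).symm)
  exact congrArg (fun t => J.iso.hom⟦i⟧' ≫ t) h2

variable (h : IsTriangular 𝒜 A0 Ale Age) {X Y : Bounded (GrMod 𝒜)}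

/-- The comparison isomorphism between the morphisms through the subcategory generated by the
injective modules and the semi-infinite Ext groups. -/
noncomputable def IsTriangular.semiInfExtEquiv (I : ConvexResolution Age X)
    (J : ConcaveResolution Ale Y) (i : ℤ) :
    HomThroughInjectives Age X (Y⟦i⟧) ≃+ SemiInfExt I J i :=
  (h.homThroughEquiv I (J.shift i)).trans CohomologyClass.homAddEquiv.symm

/-- Cocycles of degree `i` are chain maps to the `i`-th shift. This reduces statements about
cohomology classes to statements about morphisms in the homotopy category. -/
lemma IsTriangular.semiInfExtEquiv_eq_mk_iff {I : ConvexResolution Age X}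
    {J : ConcaveResolution Ale Y} {i : ℤ} {t : HomThroughInjectives Age X (Y⟦i⟧)}
    {z : Cocycle I.cx J.cx i} : h.semiInfExtEquiv I J i t = CohomologyClass.mk z ↔
      h.homThroughEquiv I (J.shift i) t =
        (HomotopyCategory.quotient _ _).map (Cocycle.equivHomShift.symm z) := by
  refine (AddEquiv.symm_apply_eq
    (CohomologyClass.homAddEquiv (K := I.cx) (L := J.cx) (n := i))).trans ?_
  exact Eq.congr_right (CohomologyClass.toHom_mk z)

end Comparison

end SemiInf

open SemiInf DerivedCategory CochainComplex.HomComplex in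
theorem mainTheorem1 {k A : Type u} [Field k] [Ring A] [Algebra k A]
    (𝒜 : ℤ → Submodule k A) [GradedAlgebra 𝒜] (A0 Ale Age : Subalgebra k A)
    (hA : IsTriangular 𝒜 A0 Ale Age) [HasDerivedCategory.{w} (GrMod 𝒜)] :
    -- for graded `A`-modules, `A^{≥0}`-injective is the same as `A^{≥0}`-projective
    (∀ M : GrMod 𝒜, M.IsInjectiveOver Age ↔ Projective (M.res Age)) ∧
    -- the resolutions that define the semi-infinite Ext groups exist
    (∀ X : Bounded (GrMod 𝒜), Nonempty (ConvexResolution Age X)) ∧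
    (∀ Y : Bounded (GrMod 𝒜), Nonempty (ConcaveResolution Ale Y)) ∧
    -- and there are isomorphisms, for all choices of the resolutions,
    ∃ e : ∀ (X Y : Bounded (GrMod 𝒜)) (I : ConvexResolution Age X) (J : ConcaveResolution Ale Y)
        (i : ℤ), HomThroughInjectives Age X (Y⟦i⟧) ≃+ SemiInfExt I J i,
      -- which are natural in `X`,
      (∀ (X' X Y : Bounded (GrMod 𝒜)) (f : X' ⟶ X)
        (I' : ConvexResolution Age X') (I : ConvexResolution Age X) (J : ConcaveResolution Ale Y)
        (a : I'.cx ⟶ I.cx), Q.map a ≫ I.iso.hom = I'.iso.hom ≫ f.hom →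
        ∀ (i : ℤ) (t : HomThroughInjectives Age X (Y⟦i⟧)) (z : Cocycle I.cx J.cx i),
          e X Y I J i t = CohomologyClass.mk z →
          e X' Y I' J i (t.precomp f) = CohomologyClass.mk (z.precomp a)) ∧
      -- natural in `Y`,
      (∀ (X Y Y' : Bounded (GrMod 𝒜)) (g : Y ⟶ Y')
        (I : ConvexResolution Age X) (J : ConcaveResolution Ale Y) (J' : ConcaveResolution Ale Y')
        (b : J.cx ⟶ J'.cx), Q.map b ≫ J'.iso.hom = J.iso.hom ≫ g.hom →
        ∀ (i : ℤ) (t : HomThroughInjectives Age X (Y⟦i⟧)) (z : Cocycle I.cx J.cx i),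
          e X Y I J i t = CohomologyClass.mk z →
          e X Y' I J' i (t.postcomp (g⟦i⟧')) = CohomologyClass.mk (z.postcomp b)) ∧
      -- and which send the diagram `X ⟶ Z ⟶ Y[i]` that is represented by chain maps
      -- `I ⟶ K ⟶ J[i]`, for a bounded complex `K` representing `Z`, to the class of their composite
      (∀ (X Y : Bounded (GrMod 𝒜)) (I : ConvexResolution Age X) (J : ConcaveResolution Ale Y)
        (i : ℤ) (Z : (semiInfProp 𝒜 Age).FullSubcategory)
        (K : CochainComplex (GrMod 𝒜) ℤ) (m n : ℤ) (_ : K.IsStrictlyGE m) (_ : K.IsStrictlyLE n)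
        (c : Q.obj K ≅ Z.obj.obj) (p : I.cx ⟶ K) (q : K ⟶ J.cx⟦i⟧),
        e X Y I J i (HomThrough.mk Z
            (ObjectProperty.homMk (I.iso.inv ≫ Q.map p ≫ c.hom))
            (ObjectProperty.homMk (c.inv ≫ Q.map q ≫ (J.shiftIso i).hom))) =
          CohomologyClass.mk (Cocycle.equivHomShift (p ≫ q))) := by
  refine ⟨hA.isInjectiveOver_iff_projective, hA.nonempty_convexResolution,
    hA.nonempty_concaveResolution, fun X Y I J i => hA.semiInfExtEquiv I J i, ?_, ?_, ?_⟩
  · intro X' X Y f I' I J a ha i t z hz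
    rw [hA.semiInfExtEquiv_eq_mk_iff] at hz ⊢
    rw [hA.homThroughEquiv_precomp f a ha, hz, Cocycle.equivHomShift_symm_precomp]
    exact (Functor.map_comp _ _ _).symm
  · intro X Y Y' g I J J' b hb i t z hz
    rw [hA.semiInfExtEquiv_eq_mk_iff] at hz ⊢
    refine (hA.homThroughEquiv_postcomp (J := J.shift i) (J' := J'.shift i) (g⟦i⟧') (b⟦i⟧')
      (ConcaveResolution.shiftIso_naturality g b hb i) t).trans ?_
    rw [hz, Cocycle.equivHomShift_symm_postcomp]
    exact (Functor.map_comp _ _ _).symm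
  · intro X Y I J i Z K m n _ _ c p q
    rw [hA.semiInfExtEquiv_eq_mk_iff, AddEquiv.symm_apply_apply]
    exact hA.homThroughEquiv_of_bounded (J := J.shift i) Z K n c p q
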